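/- **Setting.** Let $(E,\mathcal E)$ be a standard measurable space with measurable functions $m,a:E\to(0,\infty)$ (mass, diffusivity), and let $K(y,y',dz)$ be a kernel of finite measures from $E\times E$ to $E$, symmetric in $(y,y')$, with $m(z)=m(y)+m(y')$ for $K(y,y',\cdot)$-a.a. $z$. Let $\phi:(0,\infty)\to(0,\infty)$ be continuous with $\phi(\lambda r)\le\lambda\phi(r)$ for $\lambda\ge1$, and put $w(y)=a(y)^{d/2}\phi(m(y))$. Assume: $a$ and $1/a$ are bounded on $m^{-1}(B)$ for every compact $B\subset(0,\infty)$; $a(z)\le a(y)$ for $K(y,y',\cdot)$-a.a. $z$; $\inf w>0$; and $K(y,y',E)\le w(y)w(y')$ for all $y,y'$. Let $\mathcal M$ be the set of finite measures on $\mathbb R^d\times E$ whose first marginal is absolutely continuous, and for $\mu\in\mathcal M$ write $\mu(dx,dy)=\mu(x,dy)\,dx$. A process $(\mu_t)_{t<T}$ in $\mathcal M$, where $T\in[0,\infty]$, is a family in $\mathcal M$ such that $t\mapsto\mu_t(B\times A)$ is measurable on $[0,T)$ for all measurable $B,A$; the kernels $\mu_t(x,dy)$ are then chosen jointly measurable in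 $(t,x)$. Set $$K^+(\mu)(B\times A)=\tfrac12\int_{B\times E\times E}K(y,y',A)\mu(x,dy)\mu(x,dy')dx,\quad K^-(\mu)(B\times A)=\int_{B\times A\times E}K(y,y',E)\mu(x,dy)\mu(x,dy')dx,$$ $$P_t\mu(dx',dy)=\int_{x\in\mathbb R^d}\mu(dx,dy)\,p(a(y)t,x,x')\,dx',\qquad p(t,x,x')=(2\pi t)^{-d/2}e^{-|x-x'|^2/2t}.$$ A strong solution of $\dot\mu_t=\frac12a\Delta\mu_t+K^+(\mu_t)-K^-(\mu_t)$ is a process $(\mu_t)_{t<T}$ in $\mathcal M$ such that $$\mu_t+\int_0^tP_{t-s}K^-(\mu_s)ds=P_t\mu_0+\int_0^tP_{t-s}K^+(\mu_s)ds,\quad t\in(0,T),$$ $\int w\,d\mu_0<\infty$, $\mu_0(dx,dy)\le dx\otimes\mu_0^*(dy)$ for some measure $\mu_0^*$ on $E$ with $\int w\,d\mu_0^*<\infty$, and, for all $t<T$, $$\sup_{s\le t}\int w(y)\mu_s(dx,dy)<\infty,\qquad\int_0^t\operatorname*{ess\,sup}_{x}\int_Ew(y)^2\mu_s(x,dy)\,ds<\infty.$$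 Given such a process, let $c_t(x,y)=\int_EK(y,y',E)\mu_t(x,dy')$ and let $P^\mu_{ts}$ be the propagator of $\frac12a(y)\Delta-c_t(\cdot,y)$: $P^\mu_{ss}\nu=\nu$ and, for $s<t$, $$P^\mu_{ts}\nu(dx',dy)=\int_{x\in\mathbb R^d}\nu(dx,dy)\,p(a(y)(t-s),x,x')\,\mathbb E\Big[\exp\Big(-\int_s^tc_\tau(W_\tau,y)d\tau\Big)\Big]dx',$$ where $W$ is a Brownian bridge of diffusivity $a(y)$ from $x$ at time $s$ to $x'$ at time $t$. **Theorem.** Let $(\mu_t)_{t<T}$ be a strong solution (for example, the maximal strong solution starting from $\mu_0$). Then: 1. $(\mu_t)_{t<T}$ is the minimal non-negative solution, among processes $(\nu_t)_{t<T}$ in $\mathcal M$, of $$\nu_t=P^\mu_{t0}\mu_0+\int_0^tP^\mu_{ts}K^+(\nu_s)ds,\quad t<T;$$ that is, it is a solution, every solution $(\nu_t)_{t<T}$ satisfies $\mu_t\le\nu_t$ for all $t<T$, and $\mu_t(S)=\lim_{k\to\infty}\nu^k_t(S)$ for all $t<T$ and all measurable $S$, where $(\nu^k_t)_{t<T}$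 are the processes in $\mathcal M$ given by $\nu^0_t=P^\mu_{t0}\mu_0$, $\nu^{k+1}_t=P^\mu_{t0}\mu_0+\int_0^tP^\mu_{ts}K^+(\nu^k_s)ds$. 2. If $\mu_0$ has integer mass distribution, i.e. is supported on $\mathbb R^d\times m^{-1}(\mathbb N)$, then so has $\mu_t$ for all $t<T$. 3. If $\mu_0$ has absolutely continuous mass distribution, then so has $\mu_t$ for all $t<T$. This holds both when the notion means that $\mu=\int_{(0,\infty)}\rho(r,\cdot)\,dr$ for a kernel $\rho$ from $(0,\infty)$ to $\mathbb R^d\times E$ with $m(y)=r$ for $\rho(r,\cdot)$-a.a. $(x,y)$, for all $r$, and when it means, locally in position, that $\mu(dx,dy)=\int_{(0,\infty)}\rho((x,r),dy)\,dr\,dx$ for a kernel $\rho$ from $\mathbb R^d\times(0,\infty)$ to $E$ with $m(y)=r$ for $\rho((x,r),\cdot)$-a.a. $y$, for all $x,r$. -/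

import Mathlib

open MeasureTheory ProbabilityTheory Set Filter Topology
open scoped ENNReal ProbabilityTheory

noncomputable section

namespace CoagDiff

/-- The position space `ℝ^d`, with its Euclidean norm, Borel sets and Lebesgue measure. -/
abbrev Space (d : ℕ) : Type := EuclideanSpace ℝ (Fin d)

/-! ### The coefficients -/

/-- The data of the coagulation-diffusion equation on `ℝ^d × E` with their standing assumptions:
the mass function `m`, the diffusivity `a`, the function `φ`, the coagulation kernel `K`.
A function on `E` is locally bounded if it is bounded on `m⁻¹(B)` for all compact
`B ⊆ (0, ∞)`. -/
structure Model (d : ℕ) (E : Type*) [MeasurableSpace E] where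
  /-- the mass of a type -/
  m : E → ℝ
  /-- the diffusivity of a type -/
  a : E → ℝ
  /-- the sublinear function `φ : (0, ∞) → (0, ∞)`; only its values on `(0, ∞)` matter -/
  φ : ℝ → ℝ
  /-- the coagulation kernel `K(y, y', dz)` -/
  K : Kernel (E × E) E
  measurable_m : Measurable m
  m_pos : ∀ y, 0 < m y
  measurable_a : Measurable a
  a_pos : ∀ y, 0 < a y
  continuousOn_φ : ContinuousOn φ (Ioi 0)
  φ_pos : ∀ r, 0 < r → 0 < φ r
  φ_sublinear : ∀ l r : ℝ, 1 ≤ l → 0 < r → φ (l * r) ≤ l * φ r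
  K_symm : ∀ y y', K (y, y') = K (y', y)
  K_mass : ∀ y y', ∀ᵐ z ∂K (y, y'), m z = m y + m y'
  a_locallyBounded : ∀ B : Set ℝ, IsCompact B → B ⊆ Ioi 0 → ∃ C : ℝ, ∀ y, m y ∈ B → a y ≤ C
  a_inv_locallyBounded :
    ∀ B : Set ℝ, IsCompact B → B ⊆ Ioi 0 → ∃ C : ℝ, ∀ y, m y ∈ B → (a y)⁻¹ ≤ C
  a_decreasing : ∀ y y', ∀ᵐ z ∂K (y, y'), a z ≤ a y
  /-- the weight `w(y) = a(y)^{d/2} φ(m(y))` is uniformly positive -/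
  w_pos : ∃ ε : ℝ, 0 < ε ∧ ∀ y, ε ≤ a y ^ ((d : ℝ) / 2) * φ (m y)
  /-- `K(y, y', E) ≤ w(y) w(y')` -/
  K_le : ∀ y y', K (y, y') univ ≤ ENNReal.ofReal
    ((a y ^ ((d : ℝ) / 2) * φ (m y)) * (a y' ^ ((d : ℝ) / 2) * φ (m y')))

variable {d : ℕ} {E : Type*} [MeasurableSpace E]

/-- The weight `w(y) = a(y)^{d/2} φ(m(y))`, as an extended non-negative number. -/
def Model.w (M : Model d E) (y : E) : ℝ≥0∞ :=
  ENNReal.ofReal (M.a y ^ ((d : ℝ) / 2) * M.φ (M.m y))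

/-! ### Processes in the state space and their densities -/

/-- The time interval `[0, T)`, for `T ∈ [0, ∞]`. -/
def timeDomain (T : ℝ≥0∞) : Set ℝ := {t | 0 ≤ t ∧ ENNReal.ofReal t < T}

/-- `(μ_t)_{t < T}` is a process in the set of finite measures on `ℝ^d × E` whose first marginal is
absolutely continuous: every `μ_t` lies in this set and `t ↦ μ_t(B × A)` is measurable on `[0, T)`
for all measurable `B` and `A`. The values of `μ` outside `[0, T)` are irrelevant. -/
structure IsProcess (T : ℝ≥0∞) (μ : ℝ → Measure (Space d × E)) : Prop where
  finite : ∀ t ∈ timeDomain T, IsFiniteMeasure (μ t)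
  absolutelyContinuous : ∀ t ∈ timeDomain T, (μ t).fst ≪ volume
  measurable : ∀ (B : Set (Space d)) (A : Set E), MeasurableSet B → MeasurableSet A →
    Measurable fun t : timeDomain T => μ t (B ×ˢ A)

/-- `κ` is a version, jointly measurable in time and position, of the kernels `μ_t(x, dy)`:
each `κ (t, x)` is a finite measure and `μ_t(B × A) = ∫_B κ (t, x) (A) dx` for `t < T`. -/
structure IsDensity (T : ℝ≥0∞) (μ : ℝ → Measure (Space d × E)) (κ : Kernel (ℝ × Space d) E) :
    Prop where
  finite : ∀ p, IsFiniteMeasure (κ p)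
  eq_lintegral : ∀ t ∈ timeDomain T, ∀ (B : Set (Space d)) (A : Set E),
    MeasurableSet B → MeasurableSet A → μ t (B ×ˢ A) = ∫⁻ x in B, κ (t, x) A

/-- A kernel of finite measures is s-finite. -/
lemma isSFiniteKernel_of_finite {X Y : Type*} [MeasurableSpace X] [MeasurableSpace Y]
    (κ : Kernel X Y) (h : ∀ x, IsFiniteMeasure (κ x)) : IsSFiniteKernel κ := by
  classical
  have hm : Measurable fun x => κ x univ := κ.measurable_coe MeasurableSet.univ
  have hs : ∀ n : ℕ, MeasurableSet {x | ⌊(κ x univ).toReal⌋₊ = n} := fun n =>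
    (Nat.measurable_floor.comp hm.ennreal_toReal) (measurableSet_singleton n)
  refine ⟨fun n => Kernel.piecewise (hs n) κ 0, fun n => ⟨⟨(n : ℝ≥0∞) + 1, by finiteness, ?_⟩⟩, ?_⟩
  · intro x
    rw [Kernel.piecewise_apply]
    split_ifs with hx
    · rw [← ENNReal.ofReal_toReal (measure_ne_top (κ x) univ)]
      refine (ENNReal.ofReal_le_ofReal (Nat.lt_floor_add_one _).le).trans ?_
      rw [show ⌊(κ x univ).toReal⌋₊ = n from hx]
      rw [ENNReal.ofReal_add (by positivity) zero_le_one, ENNReal.ofReal_natCast,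
        ENNReal.ofReal_one]
    · simp
  · ext x A hA
    rw [Kernel.sum_apply' _ _ hA, tsum_eq_single ⌊(κ x univ).toReal⌋₊]
    · rw [Kernel.piecewise_apply, if_pos (by exact rfl)]
    · intro n hn
      rw [Kernel.piecewise_apply, if_neg (show ¬ _ ∈ _ from fun h => hn (Eq.symm h))]
      simp

/-- Every process has a density, when `E` is a standard measurable space. -/
lemma exists_isDensity [StandardBorelSpace E] {T : ℝ≥0∞} {μ : ℝ → Measure (Space d × E)}
    (hμ : IsProcess T μ) : ∃ κ, IsDensity T μ κ := by
  classical
  have hT : MeasurableSet (timeDomain T) :=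
    measurableSet_Ici.inter (measurableSet_lt ENNReal.measurable_ofReal measurable_const)
  rcases isEmpty_or_nonempty E with hE | hE
  · refine ⟨0, ⟨fun p => by simp; infer_instance, fun t _ B A _ _ => ?_⟩⟩
    simp [Set.eq_empty_of_isEmpty A]
  have hfin : ∀ t : timeDomain T, IsFiniteMeasure (μ t) := fun t => hμ.finite t t.2
  -- the process, normalized to mass at most one
  have hmeas : Measurable fun t : timeDomain T => μ t := by
    refine Measurable.measure_of_isPiSystem generateFrom_prod.symm isPiSystem_prod ?_ ?_
    · rintro _ ⟨B, hB, A, hA, rfl⟩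
      exact hμ.measurable B A hB hA
    · rw [← univ_prod_univ]
      exact hμ.measurable _ _ MeasurableSet.univ MeasurableSet.univ
  let g : timeDomain T → ℝ≥0∞ := fun t => 1 + μ t univ
  have hg : Measurable g := measurable_const.add (Measure.measurable_measure.1 hmeas _
    MeasurableSet.univ)
  have hg0 : ∀ t, g t ≠ 0 := fun t => by simp [g]
  have hgT : ∀ t, g t ≠ ∞ := fun t => by
    have := hfin t; simp [g]
  let η : Kernel (timeDomain T) (Space d × E) :=
    ⟨fun t => (g t)⁻¹ • μ t, by
      refine Measure.measurable_of_measurable_coe _ fun S hS => ?_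
      simp only [Measure.smul_apply, smul_eq_mul]
      exact hg.inv.mul (Measure.measurable_measure.1 hmeas S hS)⟩
  have hη : ∀ t S, η t S = (g t)⁻¹ * μ t S := fun t S => by
    change ((g t)⁻¹ • μ t) S = _
    simp
  have hfinη : IsFiniteKernel η := ⟨⟨1, ENNReal.one_lt_top, fun t => by
    rw [hη, mul_comm, ← div_eq_mul_inv]
    refine ENNReal.div_le_of_le_mul ?_
    rw [one_mul]
    exact le_add_self⟩⟩
  -- a finite measure equivalent to Lebesgue measure
  obtain ⟨f, hf0, hfm, hf⟩ := exists_pos_lintegral_lt_of_sigmaFinite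
    (volume : Measure (Space d)) one_ne_zero
  let l : Measure (Space d) := volume.withDensity fun x => f x
  have hl : IsFiniteMeasure l := ⟨by
    simp only [l, withDensity_apply _ MeasurableSet.univ, Measure.restrict_univ]
    exact hf.trans ENNReal.one_lt_top⟩
  have hvl : (volume : Measure (Space d)) ≪ l :=
    withDensity_absolutelyContinuous' hfm.coe_nnreal_ennreal.aemeasurable
      (ae_of_all _ fun x => by simpa using (hf0 x).ne')
  let L : Kernel (timeDomain T) (Space d) := Kernel.const _ l
  have hac : ∀ t, Kernel.fst η t ≪ L t := fun t => by
    refine Measure.AbsolutelyContinuous.trans ?_ hvl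
    refine Measure.AbsolutelyContinuous.trans ?_ (hμ.absolutelyContinuous t t.2)
    rw [Kernel.fst_apply, Measure.fst]
    refine Measure.AbsolutelyContinuous.map ?_ measurable_fst
    exact Measure.AbsolutelyContinuous.mk fun S _ h => by rw [hη, h, mul_zero]
  -- the density of the first marginal
  let r : timeDomain T → Space d → ℝ≥0∞ := fun t x => Kernel.rnDeriv (Kernel.fst η) L t x
  have hr : Measurable (Function.uncurry r) := Kernel.measurable_rnDeriv _ _
  let F : timeDomain T → Space d → ℝ≥0∞ := fun t x => ((g t * r t x * f x).toNNReal : ℝ≥0∞)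
  have hF : Measurable (Function.uncurry F) := by
    have h1 : Measurable fun p : timeDomain T × Space d => g p.1 * r p.1 p.2 * f p.2 :=
      ((hg.comp measurable_fst).mul hr).mul (hfm.coe_nnreal_ennreal.comp measurable_snd)
    exact h1.ennreal_toNNReal.coe_nnreal_ennreal
  let κ₀ : Kernel (timeDomain T × Space d) E :=
    ⟨fun p => F p.1 p.2 • Kernel.condKernel η p, by
      refine Measure.measurable_of_measurable_coe _ fun S hS => ?_
      simp only [Measure.smul_apply, smul_eq_mul]
      exact hF.mul (Kernel.measurable_coe _ hS)⟩
  have hκ₀ : ∀ p S, κ₀ p S = F p.1 p.2 * Kernel.condKernel η p S := fun p S => by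
    change (F p.1 p.2 • Kernel.condKernel η p) S = _
    simp
  have hmain : ∀ t : timeDomain T, ∀ (B : Set (Space d)) (A : Set E), MeasurableSet B →
      MeasurableSet A → μ t (B ×ˢ A) = ∫⁻ x in B, κ₀ (t, x) A := by
    intro t B A hB hA
    have hcond : Measurable fun x => Kernel.condKernel η (t, x) A :=
      (Kernel.measurable_coe _ hA).comp measurable_prodMk_left
    have hrt : Measurable (r t) := hr.comp measurable_prodMk_left
    have e1 : η t (B ×ˢ A) = ∫⁻ x in B, Kernel.condKernel η (t, x) A ∂(Kernel.fst η t) := by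
      conv_lhs => rw [← Kernel.disintegrate η (Kernel.condKernel η)]
      rw [Kernel.compProd_apply (hB.prod hA), ← lintegral_indicator hB]
      refine lintegral_congr fun x => ?_
      by_cases hx : x ∈ B <;> simp [hx]
    have e2 : Kernel.fst η t = (volume : Measure (Space d)).withDensity fun x => r t x * f x := by
      have h1 := Measure.withDensity_rnDeriv_eq _ _ (hac t)
      have h2 : r t =ᵐ[l] (Kernel.fst η t).rnDeriv (L t) := Kernel.rnDeriv_eq_rnDeriv_measure
      rw [← h1]
      change l.withDensity _ = _
      rw [← withDensity_congr_ae h2]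
      change (volume.withDensity fun x => (f x : ℝ≥0∞)).withDensity (r t) = _
      rw [← withDensity_mul _ hfm.coe_nnreal_ennreal hrt]
      congr 1
      funext x
      exact mul_comm _ _
    have hrf : Measurable fun x => r t x * f x := hrt.mul hfm.coe_nnreal_ennreal
    have hlt : ∀ᵐ x ∂(volume : Measure (Space d)), r t x * f x < ∞ := by
      refine ae_lt_top hrf ?_
      have h3 : Kernel.fst η t univ ≠ ∞ := measure_ne_top _ _
      rwa [e2, withDensity_apply _ MeasurableSet.univ, Measure.restrict_univ] at h3
    have e3 : μ t (B ×ˢ A) = g t * η t (B ×ˢ A) := by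
      rw [hη, ← mul_assoc, ENNReal.mul_inv_cancel (hg0 t) (hgT t), one_mul]
    rw [e3, e1, e2, setLIntegral_withDensity_eq_setLIntegral_mul _ hrf hcond hB,
      ← lintegral_const_mul _ (hrf.mul hcond)]
    refine lintegral_congr_ae (ae_restrict_of_ae ?_)
    filter_upwards [hlt] with x hx
    rw [hκ₀]
    simp only [F, Pi.mul_apply]
    rw [mul_assoc (g t) (r t x), ENNReal.coe_toNNReal (ENNReal.mul_ne_top (hgT t) hx.ne)]
    simp only [mul_assoc]
  -- extension by zero to all times
  have hfin₀ : ∀ p, IsFiniteMeasure (κ₀ p) := fun p => ⟨by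
    rw [hκ₀]
    exact ENNReal.mul_lt_top ENNReal.coe_lt_top (measure_lt_top _ _)⟩
  have hemb : MeasurableSet {p : ℝ × Space d | p.1 ∈ timeDomain T} := measurable_fst hT
  refine ⟨⟨fun p => if h : p.1 ∈ timeDomain T then κ₀ (⟨p.1, h⟩, p.2) else 0, ?_⟩, ?_, ?_⟩
  · refine Measurable.dite (s := {p : ℝ × Space d | p.1 ∈ timeDomain T})
      (f := fun p => κ₀ (⟨p.1.1, p.2⟩, p.1.2)) (g := fun _ => 0) ?_ measurable_const hemb
    refine κ₀.measurable.comp ?_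
    exact ((measurable_fst.comp measurable_subtype_coe).subtype_mk).prodMk
      (measurable_snd.comp measurable_subtype_coe)
  · intro p
    change IsFiniteMeasure (if h : p.1 ∈ timeDomain T then κ₀ (⟨p.1, h⟩, p.2) else 0)
    split_ifs
    · exact hfin₀ _
    · infer_instance
  · intro t ht B A hB hA
    rw [hmain ⟨t, ht⟩ B A hB hA]
    refine lintegral_congr fun x => ?_
    change _ = (if h : t ∈ timeDomain T then κ₀ (⟨t, h⟩, x) else 0) A
    rw [dif_pos ht]

open Classical in
/-- A version of the kernels `μ_t(x, dy)`. Every process on a standard measurable space `E` has one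
(`exists_isDensity`), and for each `t < T` it is determined for almost all `x`. -/
def density (T : ℝ≥0∞) (μ : ℝ → Measure (Space d × E)) : Kernel (ℝ × Space d) E :=
  if h : ∃ κ, IsDensity T μ κ then h.choose else 0

lemma isDensity_density [StandardBorelSpace E] {T : ℝ≥0∞} {μ : ℝ → Measure (Space d × E)}
    (hμ : IsProcess T μ) : IsDensity T μ (density T μ) := by
  have h := exists_isDensity hμ
  rw [density, dif_pos h]
  exact h.choose_spec

/-! ### Coagulation -/

/-- `K⁺(μ_s)`, where `κ` is the density of `(μ_t)`:
`K⁺(μ_s)(B × A) = 1/2 ∫_B ∫_E ∫_E K(y, y', A) κ_s(x, dy) κ_s(x, dy') dx`. -/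
def Kplus (M : Model d E) (κ : Kernel (ℝ × Space d) E) (s : ℝ) : Measure (Space d × E) :=
  (2⁻¹ : ℝ≥0∞) • (volume ⊗ₘ (M.K ∘ₖ (κ.sectR s ×ₖ κ.sectR s)))

/-- The loss rate `c_s(x, y) = ∫_E K(y, y', E) κ_s(x, dy')`. -/
def lossRate (M : Model d E) (κ : Kernel (ℝ × Space d) E) (s : ℝ) (x : Space d) (y : E) : ℝ≥0∞ :=
  ∫⁻ y', M.K (y, y') univ ∂κ (s, x)

/-- `K⁻(μ_s)`, where `κ` is the density of `(μ_t)`: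
`K⁻(μ_s)(B × A) = ∫_B ∫_A ∫_E K(y, y', E) κ_s(x, dy') κ_s(x, dy) dx`. -/
def Kminus (M : Model d E) (κ : Kernel (ℝ × Space d) E) (s : ℝ) : Measure (Space d × E) :=
  (volume ⊗ₘ κ.sectR s).withDensity fun q => lossRate M κ s q.1 q.2

/-! ### Diffusion -/

/-- The heat kernel `p(t, x, x') = (2πt)^{-d/2} exp(-|x - x'|² / (2t))` for `t > 0`. -/
def heatKernel (t : ℝ) (x x' : Space d) : ℝ :=
  (2 * Real.pi * t) ^ (-((d : ℝ) / 2)) * Real.exp (-(‖x - x'‖ ^ 2 / (2 * t)))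

/-- `P_t μ (B × A) = ∫_{ℝ^d × A} ∫_B p(a(y)t, x, x') dx' μ(dx, dy)`, for `t > 0`. -/
def heat (M : Model d E) (t : ℝ) (μ : Measure (Space d × E)) : Measure (Space d × E) :=
  ((μ.prod (volume : Measure (Space d))).withDensity fun q =>
    ENNReal.ofReal (heatKernel (M.a q.1.2 * t) q.1.1 q.2)).map fun q => (q.2, q.1.2)

/-! ### Brownian bridge

The standard Brownian bridge from `0` to `0` on `[0, 1]` in `ℝ^d`, by Lévy's construction: its
coordinates are the series `∑ ξ_{n,k} S_{n,k}` in the Schauder functions, with independent standard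
Gaussian coefficients. This is the process with the law of `(B_r - r B_1)_{0 ≤ r ≤ 1}`
for a standard Brownian motion `B`. -/

/-- The sample space of the Gaussian coefficients `ξ_{n,k}` of the `d` coordinates. -/
abbrev BridgeSpace (d : ℕ) : Type := ℕ × ℕ × Fin d → ℝ

/-- The law that makes the coefficients independent standard Gaussian variables. -/
def bridgeMeasure (d : ℕ) : Measure (BridgeSpace d) :=
  Measure.infinitePi fun _ => gaussianReal 0 1

/-- The Schauder function `S_{n,k}`, for `0 ≤ k < 2^n`: the primitive of the Haar function
`2^{n/2} (1_{[k/2^n, (k+1/2)/2^n)} - 1_{[(k+1/2)/2^n, (k+1)/2^n)})`,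
a tent of height `2^{-n/2-1}` over the interval `[k/2^n, (k+1)/2^n]`. -/
def schauder (n k : ℕ) (r : ℝ) : ℝ :=
  (2 : ℝ) ^ (-((n : ℝ) / 2) - 1) * max 0 (1 - |2 ^ (n + 1) * r - (2 * k + 1)|)

/-- The standard Brownian bridge in `ℝ^d` at time `r ∈ [0, 1]`. -/
def bridge (r : ℝ) (ω : BridgeSpace d) : Space d :=
  WithLp.toLp 2 fun i => ∑' n : ℕ, ∑ k ∈ Finset.range (2 ^ n), ω (n, k, i) * schauder n k r

/-- The Brownian bridge of diffusivity `a` from `x` at time `s` to `x'` at time `t`,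
at time `τ ∈ [s, t]`. -/
def bridgePath (a s t : ℝ) (x x' : Space d) (ω : BridgeSpace d) (τ : ℝ) : Space d :=
  x + ((τ - s) / (t - s)) • (x' - x) + √(a * (t - s)) • bridge ((τ - s) / (t - s)) ω

/-! ### The propagators -/

/-- `u ↦ exp(-u)` on `[0, ∞]`. -/
def expNeg (u : ℝ≥0∞) : ℝ≥0∞ := if u = ∞ then 0 else ENNReal.ofReal (Real.exp (-u.toReal))

/-- The transition density
`p_y(s, x; t, x') = p(a(y)(t - s), x, x') E[exp(-∫_s^t c_τ(W_τ, y) dτ)]` of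
`½ a(y) Δ - c_τ(., y)`, where `W` is the Brownian bridge of diffusivity `a(y)` from `x` at
time `s` to `x'` at time `t`. -/
def killedKernel (M : Model d E) (c : ℝ → Space d → E → ℝ≥0∞) (s t : ℝ) (x : Space d) (y : E)
    (x' : Space d) : ℝ≥0∞ :=
  ENNReal.ofReal (heatKernel (M.a y * (t - s)) x x') *
    ∫⁻ ω, expNeg (∫⁻ τ in Ioo s t, c τ (bridgePath (M.a y) s t x x' ω τ) y) ∂bridgeMeasure d

open Classical in
/-- The propagator on measures associated to `½ a(y) Δ - c_τ(., y)`, from time `s` to time `t`: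
`P_{ts} μ(dx', dy) = ∫_x μ(dx, dy) p_y(s, x; t, x') dx'` for `s < t`, and `P_{ss} μ = μ`. -/
def propagate (M : Model d E) (c : ℝ → Space d → E → ℝ≥0∞) (s t : ℝ)
    (μ : Measure (Space d × E)) : Measure (Space d × E) :=
  if s < t then
    ((μ.prod (volume : Measure (Space d))).withDensity fun q =>
      killedKernel M c s t q.1.1 q.1.2 q.2).map fun q => (q.2, q.1.2)
  else μ

/-- The propagator `P^μ_{ts}`, whose loss rate is that of the process `(μ_t)_{t < T}`. -/
def propagator (M : Model d E) (T : ℝ≥0∞) (μ : ℝ → Measure (Space d × E)) (s t : ℝ) :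
    Measure (Space d × E) → Measure (Space d × E) :=
  propagate M (lossRate M (density T μ)) s t

/-! ### Notions of solution -/

/-- The condition on initial measures: `w` is `μ₀`-integrable and `μ₀(dx, dy) ≤ dx ⊗ μ₀*(dy)` for
some measure `μ₀*` on `E` for which `w` is integrable. -/
structure IsInitial (M : Model d E) (μ₀ : Measure (Space d × E)) : Prop where
  lintegral_w : (∫⁻ q, M.w q.2 ∂μ₀) < ∞
  dominated : ∃ μs : Measure E, (∫⁻ y, M.w y ∂μs) < ∞ ∧ μ₀ ≤ (volume : Measure (Space d)).prod μs

/-- `(μ_t)_{t < T}` is a strong solution of the coagulation-diffusion equation. -/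
structure IsStrongSolution (M : Model d E) (T : ℝ≥0∞) (μ : ℝ → Measure (Space d × E)) :
    Prop where
  process : IsProcess T μ
  /-- `μ_t + ∫_0^t P_{t-s} K⁻(μ_s) ds = P_t μ_0 + ∫_0^t P_{t-s} K⁺(μ_s) ds` for `0 < t < T` -/
  equation : ∀ t ∈ timeDomain T, 0 < t → ∀ S : Set (Space d × E), MeasurableSet S →
    μ t S + ∫⁻ s in Ioo 0 t, heat M (t - s) (Kminus M (density T μ) s) S =
      heat M t (μ 0) S + ∫⁻ s in Ioo 0 t, heat M (t - s) (Kplus M (density T μ) s) S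
  initial : IsInitial M (μ 0)
  /-- `sup_{s ≤ t} ‖⟨w, μ_s⟩‖₁ < ∞` for `t < T` -/
  moment_one : ∀ t ∈ timeDomain T, (⨆ s ∈ Icc 0 t, ∫⁻ q, M.w q.2 ∂μ s) < ∞
  /-- `∫_0^t ‖⟨w², μ_s⟩‖_∞ ds < ∞` for `t < T` -/
  moment_two : ∀ t ∈ timeDomain T,
    (∫⁻ s in Ioo 0 t, essSup (fun x => ∫⁻ y, M.w y ^ 2 ∂density T μ (s, x)) volume) < ∞

/-- `(ν_t)_{t < T}` is a non-negative solution of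
`ν_t = P^μ_{t0} μ_0 + ∫_0^t P^μ_{ts} K⁺(ν_s) ds`, `t < T`. -/
structure IsPropagatorSolution (M : Model d E) (T : ℝ≥0∞) (μ ν : ℝ → Measure (Space d × E)) :
    Prop where
  process : IsProcess T ν
  equation : ∀ t ∈ timeDomain T, ∀ S : Set (Space d × E), MeasurableSet S →
    ν t S = propagator M T μ 0 t (μ 0) S +
      ∫⁻ s in Ioo 0 t, propagator M T μ s t (Kplus M (density T ν) s) S

/-- The successive approximations `ν^0_t = P^μ_{t0} μ_0`,
`ν^{k+1}_t = P^μ_{t0} μ_0 + ∫_0^t P^μ_{ts} K⁺(ν^k_s) ds`, `t < T`. -/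
structure IsIteration (M : Model d E) (T : ℝ≥0∞) (μ : ℝ → Measure (Space d × E))
    (ν : ℕ → ℝ → Measure (Space d × E)) : Prop where
  process : ∀ k, IsProcess T (ν k)
  zero : ∀ t ∈ timeDomain T, ν 0 t = propagator M T μ 0 t (μ 0)
  succ : ∀ k, ∀ t ∈ timeDomain T, ∀ S : Set (Space d × E), MeasurableSet S →
    ν (k + 1) t S = propagator M T μ 0 t (μ 0) S +
      ∫⁻ s in Ioo 0 t, propagator M T μ s t (Kplus M (density T (ν k)) s) S

/-- `(ν_t)_{t < T}` is the minimal non-negative solution of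
`ν_t = P^μ_{t0} μ_0 + ∫_0^t P^μ_{ts} K⁺(ν_s) ds`, `t < T`: it is a solution, it lies
below every other one, and it is the limit of the successive approximations. -/
structure IsMinimalPropagatorSolution (M : Model d E) (T : ℝ≥0∞)
    (μ ν : ℝ → Measure (Space d × E)) : Prop where
  solution : IsPropagatorSolution M T μ ν
  minimal : ∀ ν', IsPropagatorSolution M T μ ν' → ∀ t ∈ timeDomain T, ν t ≤ ν' t
  limit : ∃ νk, IsIteration M T μ νk ∧ ∀ t ∈ timeDomain T, ∀ S : Set (Space d × E),
    MeasurableSet S → Tendsto (fun k => νk k t S) atTop (𝓝 (ν t S))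

/-! ### Mass distributions -/

/-- A measure on `Y` has integer mass distribution, with respect to a mass function `m` on `Y`, if
it is supported on `m⁻¹(ℕ)`. -/
def HasIntegerMass {Y : Type*} [MeasurableSpace Y] (m : Y → ℝ) (μ : Measure Y) : Prop :=
  μ {y | ¬ ∃ n : ℕ, m y = n} = 0

/-- A measure `μ` on `Y` has absolutely continuous mass distribution, with respect to a mass
function `m` on `Y`, if `μ = ∫_{(0, ∞)} ρ(r, .) dr` for a kernel `ρ` from `(0, ∞)` to `Y` such
that `m = r` holds `ρ(r, .)`-almost everywhere, for all `r`. (The values of `ρ` outside `(0, ∞)`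
are irrelevant.) -/
def HasACMass {Y : Type*} [MeasurableSpace Y] (m : Y → ℝ) (μ : Measure Y) : Prop :=
  ∃ ρ : Kernel ℝ Y, (∀ r, 0 < r → ∀ᵐ y ∂ρ r, m y = r) ∧
    ∀ A, MeasurableSet A → μ A = ∫⁻ r in Ioi 0, ρ r A

/-- The version of `HasACMass` that is local in position, for a measure `μ` on `ℝ^d × E`:
`μ(dx, dy) = ∫_{(0, ∞)} ρ((x, r), dy) dr dx` for a kernel `ρ` from `ℝ^d × (0, ∞)` to `E` such that
`m = r` holds `ρ((x, r), .)`-almost everywhere, for all `x` and `r`. -/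
def HasACMassLocally (m : E → ℝ) (μ : Measure (Space d × E)) : Prop :=
  ∃ ρ : Kernel (Space d × ℝ) E, (∀ x r, 0 < r → ∀ᵐ y ∂ρ (x, r), m y = r) ∧
    ∀ (B : Set (Space d)) (A : Set E), MeasurableSet B → MeasurableSet A →
      μ (B ×ˢ A) = ∫⁻ x in B, ∫⁻ r in Ioi 0, ρ (x, r) A

end CoagDiff

end

open MeasureTheory ProbabilityTheory Set Filter Topology
open scoped ENNReal ProbabilityTheory

noncomputable section

namespace CoagDiff

/-! Write `c` for the loss rate of the given solution `μ`, frozen once and for all. Killing at rate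
`c` absorbs the loss term of the mild equation. Duhamel's formula expresses the free heat flow of a
test function as its killed flow plus an integral of `c` times the killed flow, carried back by the
heat flow. Testing the mild equation at each intermediate time `r` against `c_r` times the killed
flow, integrating over `r`, and subtracting the result from the equation at time `t` cancels every
loss term. The moment bounds make the cancelled quantity finite. This is
`apply_eq_lintegral_killFun`.

The resulting equation has only positive terms, and its right-hand side is monotone in the unknown.
The successive approximations therefore increase and stay below every solution, in particular below
`μ`. What has to be shown is that no mass is missing in the limit, and this is measured with the
weight `w`. The heat flow preserves `w`, which does not depend on position, so each approximation
satisfies an exact balance of weight, gain and loss (`lintegral_w_add_loss`). Since `φ` is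
subadditive and diffusivities decrease in collisions, `w(z) ≤ w(y) + w(y')` for the products `z`.
Hence for `ν ≤ μ` the excess of gain of `μ` over `ν` is at most the excess of loss plus `‖⟨w²,
μ_s⟩‖_∞` times the missing weight (`collision_le`). In the limit the missing weight obeys a linear
integral inequality with integrable coefficient, and Grönwall's lemma makes it zero
(`iSup_weight_picardIterate`). As `w` is bounded below, the approximations converge to `μ` on every
set, which gives minimality.

The mass properties are statements about null sets, so it is enough to follow them through the
approximations. The propagators do not change types, and a collision adds masses: sums of integers
are integers, and a translate of a Lebesgue-null set is null. Coagulation is local in position, so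
the absolutely continuous case needs the joint law of position and mass. Diffusion over any positive
time supplies it from absolute continuity of the mass alone.

Duhamel's formula rests on the law of the bridge built from the Schauder series. Its
finite-dimensional laws are identified through characteristic functions. They yield the Markov
property and the reversibility of the bridge, because expectations of `exp(-∫ c)` depend on
finite-dimensional laws only; continuity of paths is never used. -/

/-! ### The covariance of the Brownian bridge -/

/-- The projection of `ℝ` onto `[0, 1]`. -/
def clamp (u : ℝ) : ℝ := max 0 (min 1 u)

/-- The covariance of the standard Brownian bridge, extended by `0` outside of `[0, 1]²`. -/
def bridgeCov (u v : ℝ) : ℝ := min (clamp u) (clamp v) - clamp u * clamp v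

lemma clamp_of_mem {u : ℝ} (h0 : 0 ≤ u) (h1 : u ≤ 1) : clamp u = u := by
  simp [clamp, h0, h1]

lemma clamp_nonneg (u : ℝ) : 0 ≤ clamp u := le_max_left _ _

lemma clamp_le_one (u : ℝ) : clamp u ≤ 1 := max_le zero_le_one (min_le_left _ _)

lemma clamp_of_nonpos {u : ℝ} (h : u ≤ 0) : clamp u = 0 := by
  simp [clamp, h]

lemma clamp_of_one_le {u : ℝ} (h : 1 ≤ u) : clamp u = 1 := by
  simp [clamp, h]

lemma bridgeCov_of_mem {u v : ℝ} (hu0 : 0 ≤ u) (hu1 : u ≤ 1) (hv0 : 0 ≤ v) (hv1 : v ≤ 1) :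
    bridgeCov u v = min u v - u * v := by
  rw [bridgeCov, clamp_of_mem hu0 hu1, clamp_of_mem hv0 hv1]

lemma bridgeCov_comm (u v : ℝ) : bridgeCov u v = bridgeCov v u := by
  rw [bridgeCov, bridgeCov, min_comm, mul_comm]

lemma bridgeCov_of_not_mem {u v : ℝ} (h : u ≤ 0 ∨ 1 ≤ u) : bridgeCov u v = 0 := by
  rcases h with h | h
  · simp [bridgeCov, clamp_of_nonpos h, clamp_nonneg]
  · simp [bridgeCov, clamp_of_one_le h, clamp_le_one]

lemma abs_bridgeCov_le_one (u v : ℝ) : |bridgeCov u v| ≤ 1 := by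
  have h1 := clamp_nonneg u
  have h2 := clamp_le_one u
  have h3 := clamp_nonneg v
  have h4 := clamp_le_one v
  rw [bridgeCov, abs_le]
  constructor
  · rcases min_choice (clamp u) (clamp v) with h | h <;> rw [h] <;> nlinarith
  · have := min_le_left (clamp u) (clamp v)
    nlinarith [mul_nonneg h1 h3]

/-- Together with `bridgeCov_split` this is the Markov property at the level of covariances:
subtracting `(1 - v)` times the value at `u` leaves a remainder uncorrelated with that value, whose
covariance is `1 - u` times that of a bridge in the variable `v`. -/
lemma bridgeCov_split_right {u v : ℝ} (hu0 : 0 < u) (hu1 : u < 1) (hv0 : 0 ≤ v) (hv1 : v ≤ 1) :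
    bridgeCov u (u + (1 - u) * v) = (1 - v) * bridgeCov u u := by
  have h1 : u ≤ u + (1 - u) * v := by nlinarith
  have h2 : u + (1 - u) * v ≤ 1 := by nlinarith
  rw [bridgeCov_of_mem hu0.le hu1.le (hu0.le.trans h1) h2,
    bridgeCov_of_mem hu0.le hu1.le hu0.le hu1.le, min_eq_left h1, min_self]
  ring

lemma bridgeCov_split {u v v' : ℝ} (hu0 : 0 < u) (hu1 : u < 1) (hv0 : 0 ≤ v) (hv1 : v ≤ 1)
    (hv0' : 0 ≤ v') (hv1' : v' ≤ 1) :
    bridgeCov (u + (1 - u) * v) (u + (1 - u) * v') =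
      (1 - u) * bridgeCov v v' + (1 - v) * (1 - v') * bridgeCov u u := by
  have h1 : u ≤ u + (1 - u) * v := by nlinarith
  have h2 : u + (1 - u) * v ≤ 1 := by nlinarith
  have h3 : u ≤ u + (1 - u) * v' := by nlinarith
  have h4 : u + (1 - u) * v' ≤ 1 := by nlinarith
  rw [bridgeCov_of_mem (hu0.le.trans h1) h2 (hu0.le.trans h3) h4,
    bridgeCov_of_mem hv0 hv1 hv0' hv1', bridgeCov_of_mem hu0.le hu1.le hu0.le hu1.le, min_self]
  rcases le_total v v' with h | h
  · rw [min_eq_left h, min_eq_left (by nlinarith)]; ring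
  · rw [min_eq_right h, min_eq_right (by nlinarith)]; ring

lemma bridgeCov_reverse (u v : ℝ) : bridgeCov (1 - u) (1 - v) = bridgeCov u v := by
  have h : ∀ u, clamp (1 - u) = 1 - clamp u := fun u => by
    rcases le_total u 0 with h | h
    · rw [clamp_of_nonpos h, clamp_of_one_le (by linarith)]; ring
    · rcases le_total u 1 with h' | h'
      · rw [clamp_of_mem h h', clamp_of_mem (by linarith) (by linarith)]
      · rw [clamp_of_one_le h', clamp_of_nonpos (by linarith)]; ring
  rw [bridgeCov, bridgeCov, h, h]
  rcases le_total (clamp u) (clamp v) with h | h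
  · rw [min_eq_left h, min_eq_right (by linarith)]; ring
  · rw [min_eq_right h, min_eq_left (by linarith)]; ring

/-! ### Self-similarity of the covariance and convergence of the Schauder expansion -/

lemma schauder_zero_zero (u : ℝ) : schauder 0 0 u = min (clamp u) (1 - clamp u) := by
  have h2 : (2 : ℝ) ^ (-1 : ℝ) = 1 / 2 := by
    rw [Real.rpow_neg_one]; norm_num
  simp only [schauder, Nat.cast_zero, zero_div, neg_zero, zero_sub, zero_add, pow_one, mul_zero, h2]
  rcases le_total u 0 with h | h
  · rw [clamp_of_nonpos h, max_eq_left]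
    · simp
    · rw [abs_of_nonpos (by linarith)]; linarith
  rcases le_total 1 u with h1 | h1
  · rw [clamp_of_one_le h1, max_eq_left]
    · simp
    · rw [abs_of_nonneg (by linarith)]; linarith
  rw [clamp_of_mem h h1]
  rcases le_total u (1 / 2) with h' | h'
  · rw [abs_of_nonpos (by linarith), max_eq_right (by linarith), min_eq_left (by linarith)]
    ring
  · rw [abs_of_nonneg (by linarith), max_eq_right (by linarith), min_eq_right (by linarith)]
    ring

/-- Midpoint displacement: given its value at `1/2`, a bridge consists of two independent bridges on
the two halves, scaled by `2^{-1/2}`. Because the covariance is extended by zero, a half that does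
not contain both points contributes nothing, and one formula covers all positions. -/
lemma bridgeCov_recursion (u v : ℝ) : bridgeCov u v = schauder 0 0 u * schauder 0 0 v +
    (1 / 2) * bridgeCov (2 * u) (2 * v) + (1 / 2) * bridgeCov (2 * u - 1) (2 * v - 1) := by
  -- Each point lies in the left or the right half; in the other half its rescaled position is
  -- clamped to an endpoint.
  have key : ∀ u, (clamp u ≤ 1 / 2 ∧ clamp (2 * u) = 2 * clamp u ∧ clamp (2 * u - 1) = 0) ∨
      (1 / 2 ≤ clamp u ∧ clamp (2 * u) = 1 ∧ clamp (2 * u - 1) = 2 * clamp u - 1) := fun u => by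
    rcases le_total u 0 with h | h
    · left
      rw [clamp_of_nonpos h, clamp_of_nonpos (by linarith), clamp_of_nonpos (by linarith)]
      norm_num
    rcases le_total 1 u with h1 | h1
    · right
      rw [clamp_of_one_le h1, clamp_of_one_le (by linarith), clamp_of_one_le (by linarith)]
      norm_num
    rw [clamp_of_mem h h1]
    rcases le_total u (1 / 2) with h' | h'
    · left
      rw [clamp_of_mem (by linarith) (by linarith), clamp_of_nonpos (by linarith)]
      simpa using h'
    · right
      rw [clamp_of_one_le (by linarith), clamp_of_mem (by linarith) (by linarith)]
      simpa using h'
  rw [schauder_zero_zero, schauder_zero_zero]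
  simp only [bridgeCov]
  have hu := clamp_nonneg u
  have hu' := clamp_le_one u
  have hv := clamp_nonneg v
  have hv' := clamp_le_one v
  rcases key u with ⟨h1, h2, h3⟩ | ⟨h1, h2, h3⟩ <;> rcases key v with ⟨k1, k2, k3⟩ | ⟨k1, k2, k3⟩ <;>
    rw [h2, h3, k2, k3]
  · rw [min_eq_left (show clamp u ≤ 1 - clamp u by linarith),
      min_eq_left (show clamp v ≤ 1 - clamp v by linarith)]
    rcases le_total (clamp u) (clamp v) with h | h
    · rw [min_eq_left h, min_eq_left (by linarith)]; simp; ring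
    · rw [min_eq_right h, min_eq_right (by linarith)]; simp; ring
  · rw [min_eq_left (show clamp u ≤ 1 - clamp u by linarith),
      min_eq_right (show 1 - clamp v ≤ clamp v by linarith),
      min_eq_left (show clamp u ≤ clamp v by linarith),
      min_eq_left (show 2 * clamp u ≤ 1 by linarith),
      min_eq_left (show 0 ≤ 2 * clamp v - 1 by linarith)]
    ring
  · rw [min_eq_right (show 1 - clamp u ≤ clamp u by linarith),
      min_eq_left (show clamp v ≤ 1 - clamp v by linarith),
      min_eq_right (show clamp v ≤ clamp u by linarith),
      min_eq_right (show 2 * clamp v ≤ 1 by linarith),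
      min_eq_right (show 0 ≤ 2 * clamp u - 1 by linarith)]
    ring
  · rw [min_eq_right (show 1 - clamp u ≤ clamp u by linarith),
      min_eq_right (show 1 - clamp v ≤ clamp v by linarith)]
    rcases le_total (clamp u) (clamp v) with h | h
    · rw [min_eq_left h, min_eq_left (show 2 * clamp u - 1 ≤ 2 * clamp v - 1 by linarith)]
      simp; ring
    · rw [min_eq_right h, min_eq_right (show 2 * clamp v - 1 ≤ 2 * clamp u - 1 by linarith)]
      simp; ring

/-- The covariance of the partial sums of Lévy's series. -/
def schauderCov (N : ℕ) (u v : ℝ) : ℝ :=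
  ∑ n ∈ Finset.range N, ∑ k ∈ Finset.range (2 ^ n), schauder n k u * schauder n k v

lemma two_rpow_succ (n : ℕ) : (2 : ℝ) ^ (-(((n + 1 : ℕ) : ℝ) / 2) - 1) =
    (2 : ℝ) ^ (-(1 / 2) : ℝ) * (2 : ℝ) ^ (-((n : ℝ) / 2) - 1) := by
  rw [← Real.rpow_add two_pos]
  congr 1
  push_cast
  ring

/-- The tents of level `n + 1` are two shrunken copies of level `n`: indices `k < 2^n` fill the left
half, indices `2^n + k` the right half. This gives `schauderCov` the same recursion as `bridgeCov`.
-/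
lemma schauder_succ_left (n k : ℕ) (u : ℝ) :
    schauder (n + 1) k u = (2 : ℝ) ^ (-(1 / 2) : ℝ) * schauder n k (2 * u) := by
  rw [schauder, schauder, two_rpow_succ, mul_assoc]
  congr 5
  ring

lemma schauder_succ_right (n k : ℕ) (u : ℝ) :
    schauder (n + 1) (2 ^ n + k) u = (2 : ℝ) ^ (-(1 / 2) : ℝ) * schauder n k (2 * u - 1) := by
  rw [schauder, schauder, two_rpow_succ, mul_assoc]
  congr 5
  push_cast
  ring

lemma schauder_eq_zero {n k : ℕ} (hk : k < 2 ^ n) {u : ℝ} (hu : u ≤ 0 ∨ 1 ≤ u) :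
    schauder n k u = 0 := by
  have hk' : (k : ℝ) + 1 ≤ 2 ^ n := by exact_mod_cast hk
  have hk0 : (0 : ℝ) ≤ k := Nat.cast_nonneg k
  have h2 : (0 : ℝ) < 2 ^ (n + 1) := by positivity
  have h3 : (2 : ℝ) ^ (n + 1) = 2 * 2 ^ n := by ring
  rw [schauder, max_eq_left, mul_zero]
  rcases hu with hu | hu
  · have : (2 : ℝ) ^ (n + 1) * u ≤ 0 := mul_nonpos_of_nonneg_of_nonpos h2.le hu
    rw [abs_of_nonpos (by linarith)]
    linarith
  · have : (2 : ℝ) ^ (n + 1) * 1 ≤ 2 ^ (n + 1) * u := mul_le_mul_of_nonneg_left hu h2.le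
    rw [abs_of_nonneg (by linarith)]
    linarith

lemma schauderCov_succ (N : ℕ) (u v : ℝ) : schauderCov (N + 1) u v =
    schauder 0 0 u * schauder 0 0 v + (1 / 2) * schauderCov N (2 * u) (2 * v) +
      (1 / 2) * schauderCov N (2 * u - 1) (2 * v - 1) := by
  have h2 : (2 : ℝ) ^ (-(1 / 2) : ℝ) * (2 : ℝ) ^ (-(1 / 2) : ℝ) = 1 / 2 := by
    rw [← Real.rpow_add two_pos]; norm_num [Real.rpow_neg_one]
  rw [schauderCov, Finset.sum_range_succ']
  simp only [pow_zero, Finset.range_one, Finset.sum_singleton]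
  rw [add_comm, add_assoc]
  congr 1
  rw [schauderCov, schauderCov, Finset.mul_sum, Finset.mul_sum, ← Finset.sum_add_distrib]
  refine Finset.sum_congr rfl fun n _ => ?_
  rw [pow_succ, mul_two, Finset.sum_range_add, Finset.mul_sum, Finset.mul_sum, ← h2]
  congr 1 <;> refine Finset.sum_congr rfl fun k _ => ?_
  · rw [schauder_succ_left, schauder_succ_left]; ring
  · rw [schauder_succ_right, schauder_succ_right]; ring

lemma schauderCov_of_not_mem (N : ℕ) {u v : ℝ} (h : u ≤ 0 ∨ 1 ≤ u) : schauderCov N u v = 0 :=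
  Finset.sum_eq_zero fun n _ => Finset.sum_eq_zero fun k hk => by
    rw [schauder_eq_zero (Finset.mem_range.1 hk) h, zero_mul]

/-- The two sides satisfy the same recursion, so the error at step `N + 1` is half the sum of two
errors at step `N`. One of `2u` and `2u - 1` always lies outside `(0, 1)`, where both covariances
vanish, so only one error survives and it is halved. -/
lemma abs_bridgeCov_sub_schauderCov_le (N : ℕ) (u v : ℝ) :
    |bridgeCov u v - schauderCov N u v| ≤ (1 / 2) ^ N := by
  induction N generalizing u v with
  | zero => simpa [schauderCov] using abs_bridgeCov_le_one u v
  | succ N ih =>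
    rw [bridgeCov_recursion, schauderCov_succ]
    have h1 := ih (2 * u) (2 * v)
    have h2 := ih (2 * u - 1) (2 * v - 1)
    rw [abs_le] at h1 h2 ⊢
    have h3 : ((1 : ℝ) / 2) ^ (N + 1) = (1 / 2) ^ N * (1 / 2) := pow_succ _ _
    rcases le_total (2 * u) 1 with h | h
    · have e1 : bridgeCov (2 * u - 1) (2 * v - 1) = 0 := bridgeCov_of_not_mem (.inl (by linarith))
      have e2 : schauderCov N (2 * u - 1) (2 * v - 1) = 0 :=
        schauderCov_of_not_mem N (.inl (by linarith))
      rw [e1, e2, h3]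
      constructor <;> linarith
    · have e1 : bridgeCov (2 * u) (2 * v) = 0 := bridgeCov_of_not_mem (.inr h)
      have e2 : schauderCov N (2 * u) (2 * v) = 0 := schauderCov_of_not_mem N (.inr h)
      rw [e1, e2, h3]
      constructor <;> linarith

lemma tendsto_schauderCov (u v : ℝ) :
    Tendsto (fun N => schauderCov N u v) atTop (𝓝 (bridgeCov u v)) := by
  rw [tendsto_iff_norm_sub_tendsto_zero]
  refine squeeze_zero (fun _ => norm_nonneg _) (fun N => ?_)
    (tendsto_pow_atTop_nhds_zero_of_lt_one (r := (1 / 2 : ℝ)) (by norm_num) (by norm_num))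
  rw [norm_sub_rev]
  exact abs_bridgeCov_sub_schauderCov_le N u v

variable {d : ℕ}

/-! ### The law of the Brownian bridge -/

lemma schauder_nonneg (n k : ℕ) (r : ℝ) : 0 ≤ schauder n k r :=
  mul_nonneg (Real.rpow_nonneg zero_le_two _) (le_max_left _ _)

lemma schauder_le (n k : ℕ) (r : ℝ) : schauder n k r ≤ (2 : ℝ) ^ (-((n : ℝ) / 2) - 1) :=
  mul_le_of_le_one_right (Real.rpow_nonneg zero_le_two _)
    (max_le zero_le_one (sub_le_self _ (abs_nonneg _)))

/-- Tents of the same level have disjoint interiors, so at most one of them is nonzero at `r`,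
namely that of index `⌊2^n r⌋`. The sum over a level is thus no larger than a single tent. -/
lemma sum_schauder_le (n m : ℕ) (r : ℝ) :
    ∑ k ∈ Finset.range m, schauder n k r ≤ (2 : ℝ) ^ (-((n : ℝ) / 2) - 1) := by
  have key : ∀ k : ℕ, (k : ℤ) ≠ ⌊2 ^ n * r⌋ → schauder n k r = 0 := fun k hk => by
    rw [schauder, max_eq_left, mul_zero]
    have h3 : (2 : ℝ) ^ (n + 1) * r = 2 * (2 ^ n * r) := by ring
    rw [h3]
    rcases lt_or_gt_of_ne hk with h | h
    · have : ((k : ℤ) : ℝ) + 1 ≤ 2 ^ n * r := by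
        have h1 : ((k : ℤ) + 1 : ℤ) ≤ ⌊2 ^ n * r⌋ := h
        simpa using Int.le_floor.1 h1
      simp only [Int.cast_natCast] at this
      rw [abs_of_nonneg (by linarith)]
      linarith
    · have : 2 ^ n * r < ((k : ℤ) : ℝ) := Int.floor_lt.1 h
      simp only [Int.cast_natCast] at this
      rw [abs_of_nonpos (by linarith)]
      linarith
  by_cases h : ∃ k₀ ∈ Finset.range m, (k₀ : ℤ) = ⌊2 ^ n * r⌋
  · obtain ⟨k₀, h₀, hk₀⟩ := h
    rw [Finset.sum_eq_single_of_mem k₀ h₀ fun k _ hk => key k fun h' => hk (by omega)]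
    exact schauder_le n k₀ r
  · push Not at h
    rw [Finset.sum_eq_zero fun k hk => key k (h k hk)]
    exact Real.rpow_nonneg zero_le_two _

lemma measurable_schauder (n k : ℕ) : Measurable (schauder n k) := by
  unfold schauder
  fun_prop

lemma measurable_bridge :
    Measurable fun p : ℝ × BridgeSpace d => bridge p.1 p.2 := by
  unfold bridge
  refine (WithLp.measurable_toLp 2 _).comp (measurable_pi_lambda _ fun i => ?_)
  refine Measurable.tsum fun n => Finset.measurable_sum _ fun k _ => ?_
  exact ((measurable_pi_apply _).comp measurable_snd).mul
    ((measurable_schauder n k).comp measurable_fst)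

lemma measurable_bridge_right (r : ℝ) : Measurable fun ω : BridgeSpace d => bridge r ω :=
  measurable_bridge.comp measurable_prodMk_left

instance : IsProbabilityMeasure (bridgeMeasure d) := by
  unfold bridgeMeasure; infer_instance

lemma lintegral_enorm_coefficient (e : ℕ × ℕ × Fin d) :
    ∫⁻ ω, ‖ω e‖ₑ ∂bridgeMeasure d = ∫⁻ x, ‖x‖ₑ ∂gaussianReal 0 1 :=
  (measurePreserving_eval_infinitePi (fun _ : ℕ × ℕ × Fin d => gaussianReal 0 1) e).lintegral_comp
    (f := fun x : ℝ => ‖x‖ₑ) measurable_enorm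

lemma lintegral_enorm_gaussianReal_ne_top : ∫⁻ x, ‖x‖ₑ ∂gaussianReal 0 1 ≠ ∞ := by
  have h : MemLp id 1 (gaussianReal 0 1) := memLp_id_gaussianReal 1
  rw [memLp_one_iff_integrable] at h
  exact h.2.ne

/-- First moments suffice: at a fixed time, level `n` has mean absolute value at most a constant
times `2^{-n/2}`, which is summable. The exceptional null set may depend on `r`, which is harmless
for finite-dimensional laws. -/
lemma ae_summable_bridge (r : ℝ) (j : Fin d) : ∀ᵐ ω ∂bridgeMeasure d,
    Summable fun n : ℕ => ∑ k ∈ Finset.range (2 ^ n), ω (n, k, j) * schauder n k r := by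
  set C := ∫⁻ x, ‖x‖ₑ ∂gaussianReal 0 1 with hC
  have hm : ∀ n : ℕ, Measurable fun ω : BridgeSpace d =>
      ‖∑ k ∈ Finset.range (2 ^ n), ω (n, k, j) * schauder n k r‖ₑ := fun n => by fun_prop
  have h1 : ∀ n : ℕ, ∫⁻ ω : BridgeSpace d,
      ‖∑ k ∈ Finset.range (2 ^ n), ω (n, k, j) * schauder n k r‖ₑ ∂bridgeMeasure d ≤
      C * ENNReal.ofReal ((2 : ℝ) ^ (-((n : ℝ) / 2) - 1)) := fun n => by
    calc _ ≤ ∫⁻ ω : BridgeSpace d, ∑ k ∈ Finset.range (2 ^ n),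
          ‖ω (n, k, j)‖ₑ * ENNReal.ofReal (schauder n k r) ∂bridgeMeasure d := by
          refine lintegral_mono fun ω => (enorm_sum_le _ _).trans (Finset.sum_le_sum fun k _ => ?_)
          rw [enorm_mul, Real.enorm_of_nonneg (schauder_nonneg n k r)]
      _ = ∑ k ∈ Finset.range (2 ^ n), C * ENNReal.ofReal (schauder n k r) := by
          rw [lintegral_finsetSum _ fun k _ => by fun_prop]
          refine Finset.sum_congr rfl fun k _ => ?_
          rw [lintegral_mul_const _ (by fun_prop), lintegral_enorm_coefficient]
      _ ≤ _ := by
          rw [← Finset.mul_sum, ← ENNReal.ofReal_sum_of_nonneg fun k _ => schauder_nonneg n k r]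
          gcongr
          exact sum_schauder_le n _ r
  have h2 : ∫⁻ ω : BridgeSpace d, ∑' n : ℕ,
      ‖∑ k ∈ Finset.range (2 ^ n), ω (n, k, j) * schauder n k r‖ₑ ∂bridgeMeasure d ≠ ∞ := by
    rw [lintegral_tsum fun n => (hm n).aemeasurable]
    refine ne_top_of_le_ne_top ?_ (ENNReal.tsum_le_tsum h1)
    rw [ENNReal.tsum_mul_left]
    refine ENNReal.mul_ne_top lintegral_enorm_gaussianReal_ne_top ?_
    have hs : Summable fun n : ℕ => (2 : ℝ) ^ (-((n : ℝ) / 2) - 1) := by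
      have : ∀ n : ℕ, (2 : ℝ) ^ (-((n : ℝ) / 2) - 1) = ((2 : ℝ) ^ (-(1 / 2) : ℝ)) ^ n * 2⁻¹ :=
        fun n => by
          rw [← Real.rpow_natCast, ← Real.rpow_mul zero_le_two, ← Real.rpow_neg_one,
            ← Real.rpow_add two_pos]
          congr 1; ring
      simp_rw [this]
      refine (summable_geometric_of_lt_one (by positivity) ?_).mul_right _
      exact Real.rpow_lt_one_of_one_lt_of_neg one_lt_two (by norm_num)
    rw [← ENNReal.ofReal_tsum_of_nonneg (fun n => by positivity) hs]
    exact ENNReal.ofReal_ne_top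
  filter_upwards [ae_lt_top (Measurable.tsum hm) h2] with ω hω
  refine Summable.of_norm ?_
  have := ENNReal.summable_toReal hω.ne
  simpa using this

lemma integral_cexp_sum_coefficients (F : Finset (ℕ × ℕ × Fin d)) (a : ℕ × ℕ × Fin d → ℝ) :
    ∫ ω : BridgeSpace d, Complex.exp (Complex.I * ((∑ e ∈ F, a e * ω e : ℝ) : ℂ))
      ∂bridgeMeasure d = Complex.exp (-(1 / 2) * ((∑ e ∈ F, a e ^ 2 : ℝ) : ℂ)) := by
  have h := integral_restrict_infinitePi (fun _ : ℕ × ℕ × Fin d => gaussianReal 0 1) (s := F)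
    (f := fun y : F → ℝ => ∏ e : F, Complex.exp (Complex.I * ((a e * y e : ℝ) : ℂ)))
    (Measurable.aestronglyMeasurable (by fun_prop))
  rw [integral_fintype_prod_eq_prod (fun (e : F) (x : ℝ) =>
    Complex.exp (Complex.I * ((a e * x : ℝ) : ℂ)))] at h
  rw [bridgeMeasure]
  convert h using 2
  · funext ω
    rw [← Complex.exp_sum, ← Finset.mul_sum, ← Complex.ofReal_sum]
    congr 3
    rw [← Finset.sum_coe_sort F]
    rfl
  · have h1 : ∀ e : F, ∫ x, Complex.exp (Complex.I * ((a e * x : ℝ) : ℂ)) ∂gaussianReal 0 1 =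
        Complex.exp (-(1 / 2) * ((a e ^ 2 : ℝ) : ℂ)) := fun e => by
      have := charFun_gaussianReal (μ := 0) (v := 1) (a e)
      rw [charFun_apply] at this
      convert this using 2
      · funext x
        congr 1
        simp only [RCLike.inner_apply, conj_trivial]
        rw [mul_comm]
      · push_cast
        simp
        ring
    simp_rw [h1]
    rw [← Complex.exp_sum, ← Finset.mul_sum, ← Complex.ofReal_sum, ← Finset.sum_coe_sort F]

/-- The characteristic function of the finite-dimensional laws of the Brownian bridge. -/
lemma integral_cexp_bridge {ι : Type*} [Fintype ι] (r : ι → ℝ) (ξ : ι → Space d) :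
    ∫ ω, Complex.exp (Complex.I * ((∑ i, inner ℝ (ξ i) (bridge (r i) ω) : ℝ) : ℂ))
      ∂bridgeMeasure d =
    Complex.exp (-(1 / 2) * ((∑ i, ∑ l, inner ℝ (ξ i) (ξ l) * bridgeCov (r i) (r l) : ℝ) : ℂ)) := by
  classical
  let emb : (Σ _ : ℕ, ℕ × Fin d) ↪ ℕ × ℕ × Fin d :=
    ⟨fun p => (p.1, p.2), fun p q h => by
      obtain ⟨p1, p2⟩ := p
      obtain ⟨q1, q2⟩ := q
      simp only [Prod.mk.injEq] at h
      obtain ⟨rfl, rfl⟩ := h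
      rfl⟩
  let F : ℕ → Finset (ℕ × ℕ × Fin d) := fun N =>
    ((Finset.range N).sigma fun n => Finset.range (2 ^ n) ×ˢ Finset.univ).map emb
  have hF : ∀ (N : ℕ) (g : ℕ × ℕ × Fin d → ℝ), ∑ e ∈ F N, g e =
      ∑ n ∈ Finset.range N, ∑ k ∈ Finset.range (2 ^ n), ∑ j, g (n, k, j) := fun N g => by
    simp only [F, Finset.sum_map, Finset.sum_sigma, Finset.sum_product]
    rfl
  -- The coefficient of the Gaussian variable `ω e` in the linear combination `∑ ⟨ξ_i, b(r_i)⟩`. The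
  -- variance of the partial sums is then `∑ a_e²`, which regroups into the quadratic form with
  -- matrix `schauderCov`.
  let a : ℕ × ℕ × Fin d → ℝ := fun e => ∑ i, ξ i e.2.2 * schauder e.1 e.2.1 (r i)
  have hlim : ∀ᵐ ω ∂bridgeMeasure d, Tendsto (fun N => ∑ e ∈ F N, a e * ω e) atTop
      (𝓝 (∑ i, inner ℝ (ξ i) (bridge (r i) ω))) := by
    have h : ∀ᵐ ω ∂bridgeMeasure d, ∀ (i : ι) (j : Fin d), Summable fun n : ℕ =>
        ∑ k ∈ Finset.range (2 ^ n), ω (n, k, j) * schauder n k (r i) := by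
      rw [ae_all_iff]; intro i
      rw [ae_all_iff]; intro j
      exact ae_summable_bridge _ _
    filter_upwards [h] with ω hω
    have e1 : ∀ N, ∑ e ∈ F N, a e * ω e = ∑ i, ∑ j, (∑ n ∈ Finset.range N,
        ∑ k ∈ Finset.range (2 ^ n), ω (n, k, j) * schauder n k (r i)) * ξ i j := fun N => by
      rw [hF]
      simp only [a, Finset.sum_mul]
      have : ∀ n ∈ Finset.range N, ∑ k ∈ Finset.range (2 ^ n), ∑ j, ∑ i,
          ξ i j * schauder n k (r i) * ω (n, k, j) = ∑ i, ∑ j, ∑ k ∈ Finset.range (2 ^ n),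
          ω (n, k, j) * schauder n k (r i) * ξ i j := fun n _ => by
        rw [Finset.sum_comm]
        simp_rw [Finset.sum_comm (s := Finset.range (2 ^ n)) (t := (Finset.univ : Finset ι))]
        rw [Finset.sum_comm]
        refine Finset.sum_congr rfl fun i _ => Finset.sum_congr rfl fun j _ =>
          Finset.sum_congr rfl fun k _ => by ring
      rw [Finset.sum_congr rfl this, Finset.sum_comm]
      refine Finset.sum_congr rfl fun i _ => Finset.sum_comm
    simp_rw [e1]
    refine tendsto_finsetSum _ fun i _ => ?_
    simp only [PiLp.inner_apply, RCLike.inner_apply, conj_trivial]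
    refine tendsto_finsetSum _ fun j _ => Tendsto.mul_const _ ?_
    exact (hω i j).hasSum.tendsto_sum_nat
  have h1 : Tendsto (fun N => ∫ ω : BridgeSpace d,
      Complex.exp (Complex.I * ((∑ e ∈ F N, a e * ω e : ℝ) : ℂ)) ∂bridgeMeasure d) atTop
      (𝓝 (∫ ω, Complex.exp (Complex.I * ((∑ i, inner ℝ (ξ i) (bridge (r i) ω) : ℝ) : ℂ))
        ∂bridgeMeasure d)) := by
    refine tendsto_integral_of_dominated_convergence (fun _ => 1) (fun N => ?_)
      (integrable_const _) (fun N => ae_of_all _ fun ω => ?_) ?_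
    · exact Measurable.aestronglyMeasurable (by fun_prop)
    · rw [mul_comm, Complex.norm_exp_ofReal_mul_I]
    · filter_upwards [hlim] with ω hω
      refine (Complex.continuous_exp.tendsto _).comp (Tendsto.const_mul _ ?_)
      exact (Complex.continuous_ofReal.tendsto _).comp hω
  simp_rw [integral_cexp_sum_coefficients] at h1
  refine tendsto_nhds_unique h1 ?_
  refine (Complex.continuous_exp.tendsto _).comp (Tendsto.const_mul _ ?_)
  refine (Complex.continuous_ofReal.tendsto _).comp ?_
  have e2 : ∀ N, ∑ e ∈ F N, a e ^ 2 =
      ∑ i, ∑ l, inner ℝ (ξ i) (ξ l) * schauderCov N (r i) (r l) := fun N => by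
    rw [hF]
    simp only [a, sq, schauderCov, Finset.mul_sum, PiLp.inner_apply,
      RCLike.inner_apply, conj_trivial, Finset.sum_mul]
    have : ∀ n ∈ Finset.range N, ∀ k ∈ Finset.range (2 ^ n), ∑ j : Fin d, ∑ i, ∑ l,
        ξ l j * schauder n k (r l) * (ξ i j * schauder n k (r i)) = ∑ i, ∑ l, ∑ j : Fin d,
          ξ l j * ξ i j * (schauder n k (r i) * schauder n k (r l)) := fun n _ k _ => by
      rw [Finset.sum_comm]
      refine Finset.sum_congr rfl fun i _ => ?_
      rw [Finset.sum_comm]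
      refine Finset.sum_congr rfl fun l _ => Finset.sum_congr rfl fun j _ => by ring
    rw [Finset.sum_congr rfl fun n hn => Finset.sum_congr rfl (this n hn)]
    have e3 : ∀ n, ∑ k ∈ Finset.range (2 ^ n), ∑ i, ∑ l, ∑ j : Fin d,
        ξ l j * ξ i j * (schauder n k (r i) * schauder n k (r l)) = ∑ i, ∑ l,
        ∑ k ∈ Finset.range (2 ^ n), ∑ j : Fin d,
          ξ l j * ξ i j * (schauder n k (r i) * schauder n k (r l)) := fun n => by
      rw [Finset.sum_comm]
      exact Finset.sum_congr rfl fun i _ => Finset.sum_comm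
    rw [Finset.sum_congr rfl fun n _ => e3 n, Finset.sum_comm]
    exact Finset.sum_congr rfl fun i _ => Finset.sum_comm
  simp_rw [e2]
  refine tendsto_finsetSum _ fun i _ => tendsto_finsetSum _ fun l _ => Tendsto.const_mul _ ?_
  exact tendsto_schauderCov _ _

/-! ### Comparison of finite-dimensional laws: splitting and reversing a bridge -/

lemma map_eq_of_integral_cexp_eq {Ω Ω' ι : Type*} [MeasurableSpace Ω] [MeasurableSpace Ω']
    [Fintype ι] {P : Measure Ω} {P' : Measure Ω'} [IsFiniteMeasure P] [IsFiniteMeasure P']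
    {X : Ω → ι → Space d} {X' : Ω' → ι → Space d} (hX : Measurable X) (hX' : Measurable X')
    (h : ∀ ξ : ι → Space d,
      ∫ ω, Complex.exp (Complex.I * ((∑ i, inner ℝ (ξ i) (X ω i) : ℝ) : ℂ)) ∂P =
      ∫ ω, Complex.exp (Complex.I * ((∑ i, inner ℝ (ξ i) (X' ω i) : ℝ) : ℂ)) ∂P') :
    P.map X = P'.map X' := by
  -- The plain product carries the supremum norm; the `ℓ²` product is an inner product space, where
  -- the characteristic function determines a finite measure.
  let e := MeasurableEquiv.toLp 2 (ι → Space d)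
  have key : (P.map X).map e = (P'.map X').map e := by
    rw [Measure.map_map e.measurable hX, Measure.map_map e.measurable hX']
    refine Measure.ext_of_charFun (E := PiLp 2 fun _ : ι => Space d) ?_
    funext t
    rw [charFun_apply, charFun_apply,
      integral_map (e.measurable.comp hX).aemeasurable
        (Measurable.aestronglyMeasurable (by fun_prop)),
      integral_map (e.measurable.comp hX').aemeasurable
        (Measurable.aestronglyMeasurable (by fun_prop))]
    have := h fun i => t i
    simp_rw [mul_comm Complex.I, real_inner_comm (_ : Space d) (t _)] at this
    exact this
  exact e.map_measurableEquiv_injective key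

/-- The value at `v` of the rescaled remainder, after time `u`, of a bridge `b`. -/
def bridgeTail (u v : ℝ) (ω : BridgeSpace d) : Space d :=
  (√(1 - u))⁻¹ • (bridge (u + (1 - u) * v) ω - (1 - v) • bridge u ω)

lemma measurable_bridgeTail (u v : ℝ) : Measurable fun ω : BridgeSpace d => bridgeTail u v ω := by
  unfold bridgeTail
  have h1 := measurable_bridge_right (d := d) (u + (1 - u) * v)
  have h2 := measurable_bridge_right (d := d) u
  fun_prop

/-- The value at `u` and the rescaled remainder after `u` are jointly Gaussian and uncorrelated,
hence independent, and the remainder has the covariance of a bridge. The computation checks that the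
two characteristic functions have the same quadratic form. -/
lemma map_bridge_bridgeTail {ι : Type*} [Fintype ι] {u : ℝ} (hu0 : 0 < u) (hu1 : u < 1)
    (v : ι → ℝ) (hv : ∀ i, v i ∈ Icc (0 : ℝ) 1) :
    (bridgeMeasure d).map (fun ω => (bridge u ω, fun i => bridgeTail u (v i) ω)) =
      ((bridgeMeasure d).prod (bridgeMeasure d)).map
        (fun p => (bridge u p.1, fun i => bridge (v i) p.2)) := by
  have hb := fun r => measurable_bridge_right (d := d) r
  have ht := fun r => measurable_bridgeTail (d := d) u r
  -- The value at `u` is treated as one more coordinate, indexed by `none`, so that the law of the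
  -- pair becomes a finite-dimensional law.
  let f : Space d × (ι → Space d) → Option ι → Space d := fun p o => o.elim p.1 p.2
  let g : (Option ι → Space d) → Space d × (ι → Space d) := fun q => (q none, fun i => q (some i))
  have hg : Measurable g := by fun_prop
  have hgf : ∀ p, g (f p) = p := fun p => rfl
  have key : (bridgeMeasure d).map (fun ω => f (bridge u ω, fun i => bridgeTail u (v i) ω)) =
      ((bridgeMeasure d).prod (bridgeMeasure d)).map
        (fun p => f (bridge u p.1, fun i => bridge (v i) p.2)) := by
    refine map_eq_of_integral_cexp_eq ?_ ?_ fun ξ => ?_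
    · refine measurable_pi_lambda _ fun o => ?_
      cases o with
      | none => exact hb u
      | some i => exact ht (v i)
    · refine measurable_pi_lambda _ fun o => ?_
      cases o with
      | none => exact (hb u).comp measurable_fst
      | some i => exact (hb (v i)).comp measurable_snd
    · have hs : 0 < 1 - u := by linarith
      -- Expanding the tails turns the pairing with `ξ` into a pairing with bridge values only: the
      -- value at `u + (1 - u) v_i` is paired with `η i`, and the value at `u` with `ξ none - A`,
      -- where `A` collects the subtracted multiples.
      let η : ι → Space d := fun i => (√(1 - u))⁻¹ • ξ (some i)
      let A : Space d := ∑ i, (1 - v i) • η i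
      have e1 : ∀ ω : BridgeSpace d,
          ∑ o, inner ℝ (ξ o) (f (bridge u ω, fun i => bridgeTail u (v i) ω) o) =
          ∑ o : Option ι, inner ℝ (o.elim (ξ none - A) η : Space d)
            (bridge (o.elim u fun i => u + (1 - u) * v i) ω) := fun ω => by
        rw [Fintype.sum_option, Fintype.sum_option]
        simp only [f, Option.elim, bridgeTail, A, η, inner_sub_left, sum_inner,
          real_inner_smul_left, real_inner_smul_right, inner_sub_right, mul_sub,
          Finset.sum_sub_distrib]
        rw [sub_add_eq_add_sub, add_sub_assoc]
        congr 2
        exact Finset.sum_congr rfl fun i _ => by ring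
      simp_rw [e1]
      rw [integral_cexp_bridge (fun o : Option ι => o.elim u fun i => u + (1 - u) * v i)
        (fun o => o.elim (ξ none - A) η)]
      have e2 : ∀ p : BridgeSpace d × BridgeSpace d, Complex.exp (Complex.I * ((∑ o, inner ℝ (ξ o)
          (f (bridge u p.1, fun i => bridge (v i) p.2) o) : ℝ) : ℂ)) =
          Complex.exp (Complex.I * ((∑ _ : Unit, inner ℝ (ξ none) (bridge u p.1) : ℝ) : ℂ)) *
          Complex.exp (Complex.I * ((∑ i, inner ℝ (ξ (some i)) (bridge (v i) p.2) : ℝ) : ℂ)) :=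
        fun p => by
          rw [Fintype.sum_option, ← Complex.exp_add, ← mul_add, ← Complex.ofReal_add]
          simp [f]
      simp_rw [e2]
      rw [integral_prod_mul (fun ω : BridgeSpace d =>
          Complex.exp (Complex.I * ((∑ _ : Unit, inner ℝ (ξ none) (bridge u ω) : ℝ) : ℂ)))
        (fun ω : BridgeSpace d =>
          Complex.exp (Complex.I * ((∑ i, inner ℝ (ξ (some i)) (bridge (v i) ω) : ℝ) : ℂ))),
        integral_cexp_bridge (fun _ : Unit => u) (fun _ : Unit => ξ none),
        integral_cexp_bridge v fun i => ξ (some i), ← Complex.exp_add, ← mul_add,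
        ← Complex.ofReal_add]
      congr 3
      simp only [Fintype.sum_option, Option.elim, Finset.univ_unique, Finset.sum_singleton]
      have h1 : ∀ i, bridgeCov u (u + (1 - u) * v i) = (1 - v i) * bridgeCov u u := fun i =>
        bridgeCov_split_right hu0 hu1 (hv i).1 (hv i).2
      have h2 : ∀ i l, bridgeCov (u + (1 - u) * v i) (u + (1 - u) * v l) =
          (1 - u) * bridgeCov (v i) (v l) + (1 - v i) * (1 - v l) * bridgeCov u u := fun i l =>
        bridgeCov_split hu0 hu1 (hv i).1 (hv i).2 (hv l).1 (hv l).2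
      have h3 : ∑ i, inner ℝ (ξ none - A) (η i) * bridgeCov u (u + (1 - u) * v i) =
          inner ℝ (ξ none - A) A * bridgeCov u u := by
        simp only [A, inner_sum, real_inner_smul_right, Finset.sum_mul, h1]
        exact Finset.sum_congr rfl fun i _ => by ring
      have h4 : ∀ i, inner ℝ (η i) (ξ none - A) * bridgeCov (u + (1 - u) * v i) u =
          inner ℝ (ξ none - A) (η i) * bridgeCov u (u + (1 - u) * v i) := fun i => by
        rw [real_inner_comm, bridgeCov_comm]
      have h5 : ∑ i, ∑ l, inner ℝ (η i) (η l) *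
          bridgeCov (u + (1 - u) * v i) (u + (1 - u) * v l) =
          ∑ i, ∑ l, inner ℝ (ξ (some i)) (ξ (some l)) * bridgeCov (v i) (v l) +
            inner ℝ A A * bridgeCov u u := by
        simp only [A, inner_sum, sum_inner, real_inner_smul_right, real_inner_smul_left,
          Finset.sum_mul, ← Finset.sum_add_distrib]
        rw [Finset.sum_comm]
        refine Finset.sum_congr rfl fun i _ => Finset.sum_congr rfl fun l _ => ?_
        have hη : inner ℝ (η l) (η i) * (1 - u) = inner ℝ (ξ (some l)) (ξ (some i)) := by
          simp only [η, real_inner_smul_right, real_inner_smul_left]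
          have : (√(1 - u))⁻¹ * (√(1 - u))⁻¹ * (1 - u) = 1 := by
            rw [← mul_inv, Real.mul_self_sqrt hs.le, inv_mul_cancel₀ hs.ne']
          linear_combination (inner ℝ (ξ (some l)) (ξ (some i))) * this
        rw [h2, real_inner_comm (ξ (some l)) (ξ (some i)), ← hη, bridgeCov_comm (v l)]
        ring
      rw [Finset.sum_add_distrib, h5, Finset.sum_congr rfl fun i _ => h4 i, h3]
      simp only [inner_sub_left, inner_sub_right]
      rw [real_inner_comm (ξ none) A]
      ring
  have := congrArg (Measure.map g) key
  rw [Measure.map_map hg, Measure.map_map hg] at this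
  · exact this
  · refine measurable_pi_lambda _ fun o => ?_
    cases o with
    | none => exact (hb u).comp measurable_fst
    | some i => exact (hb (v i)).comp measurable_snd
  · refine measurable_pi_lambda _ fun o => ?_
    cases o with
    | none => exact hb u
    | some i => exact ht (v i)

lemma map_bridge_reverse {ι : Type*} [Fintype ι] (v : ι → ℝ) :
    (bridgeMeasure d).map (fun ω i => bridge (1 - v i) ω) =
      (bridgeMeasure d).map (fun ω i => bridge (v i) ω) := by
  have hb := fun r => measurable_bridge_right (d := d) r
  refine map_eq_of_integral_cexp_eq (measurable_pi_lambda _ fun i => hb _)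
    (measurable_pi_lambda _ fun i => hb _) fun ξ => ?_
  rw [integral_cexp_bridge, integral_cexp_bridge]
  simp_rw [bridgeCov_reverse]

/-! ### Gaussian densities -/

lemma heatKernel_nonneg {t : ℝ} (ht : 0 < t) (x x' : Space d) : 0 ≤ heatKernel t x x' :=
  mul_nonneg (Real.rpow_nonneg (by positivity) _) (Real.exp_nonneg _)

lemma heatKernel_symm (t : ℝ) (x x' : Space d) : heatKernel t x x' = heatKernel t x' x := by
  rw [heatKernel, heatKernel, norm_sub_rev]

lemma measurable_heatKernel :
    Measurable fun p : ℝ × Space d × Space d => heatKernel p.1 p.2.1 p.2.2 := by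
  unfold heatKernel
  fun_prop

lemma integral_cexp_mul_heatKernel {θ : ℝ} (hθ : 0 < θ) (m ξ : Space d) :
    ∫ z, Complex.exp ((inner ℝ z ξ : ℝ) * Complex.I) * (heatKernel θ m z : ℂ) =
      Complex.exp ((inner ℝ m ξ : ℝ) * Complex.I - θ * ‖ξ‖ ^ 2 / 2) := by
  rw [← integral_add_left_eq_self _ m]
  have hb : 0 < (((1 / (2 * θ) : ℝ) : ℂ)).re := by
    rw [Complex.ofReal_re]; positivity
  have h := GaussianFourier.integral_cexp_neg_mul_sq_norm_add hb Complex.I ξ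
  have hθ' : (θ : ℂ) ≠ 0 := by exact_mod_cast hθ.ne'
  have hpos : (0 : ℝ) < 2 * Real.pi * θ := by positivity
  have hq : ((Real.pi : ℂ) / ((1 / (2 * θ) : ℝ) : ℂ)) = ((2 * Real.pi * θ : ℝ) : ℂ) := by
    push_cast; field_simp
  rw [hq, finrank_euclideanSpace, Fintype.card_fin] at h
  have hc : ((2 * Real.pi * θ : ℝ) : ℂ) ^ ((d : ℂ) / 2) =
      (((2 * Real.pi * θ) ^ ((d : ℝ) / 2) : ℝ) : ℂ) := by
    rw [Complex.ofReal_cpow hpos.le]; push_cast; rfl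
  rw [hc] at h
  have e : ∀ z : Space d, Complex.exp ((inner ℝ (m + z) ξ : ℝ) * Complex.I) *
      (heatKernel θ m (m + z) : ℂ) = (Complex.exp ((inner ℝ m ξ : ℝ) * Complex.I) *
      (((2 * Real.pi * θ) ^ (-((d : ℝ) / 2)) : ℝ) : ℂ)) *
      Complex.exp (-((1 / (2 * θ) : ℝ) : ℂ) * ‖z‖ ^ 2 + Complex.I * (inner ℝ ξ z : ℝ)) := fun z => by
    rw [heatKernel, inner_add_left, real_inner_comm z ξ]
    have : m - (m + z) = -z := by abel
    rw [this, norm_neg, Complex.ofReal_mul, Complex.ofReal_exp, Complex.exp_add, Complex.ofReal_add,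
      add_mul, Complex.exp_add]
    have e3 : ((-(‖z‖ ^ 2 / (2 * θ)) : ℝ) : ℂ) = -((1 / (2 * θ) : ℝ) : ℂ) * (‖z‖ : ℂ) ^ 2 := by
      push_cast; field_simp
    rw [e3, mul_comm Complex.I]
    ring
  simp_rw [e]
  rw [integral_const_mul, h, mul_assoc, ← mul_assoc (((2 * Real.pi * θ) ^ (-((d : ℝ) / 2)) : ℝ) : ℂ),
    ← Complex.ofReal_mul, ← Real.rpow_add hpos, neg_add_cancel, Real.rpow_zero, Complex.ofReal_one,
    one_mul, ← Complex.exp_add]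
  congr 1
  rw [Complex.I_sq]
  push_cast
  field_simp
  ring

/-- Without integrability the Bochner integral would take its default value `0`, whereas the Fourier
transform at frequency `0` is `1`. -/
lemma integrable_heatKernel {θ : ℝ} (hθ : 0 < θ) (m : Space d) :
    Integrable (fun z => heatKernel θ m z) := by
  have hb : (0 : ℝ) < 1 / (2 * θ) := by positivity
  by_contra h
  have h1 := integral_cexp_mul_heatKernel hθ m 0
  simp only [inner_zero_right, Complex.ofReal_zero, zero_mul, Complex.exp_zero, one_mul, norm_zero,
    ne_eq, OfNat.ofNat_ne_zero, not_false_eq_true, zero_pow, mul_zero, zero_div, sub_self] at h1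
  rw [integral_complex_ofReal, integral_undef h] at h1
  simp at h1

lemma lintegral_heatKernel {θ : ℝ} (hθ : 0 < θ) (m : Space d) :
    ∫⁻ z, ENNReal.ofReal (heatKernel θ m z) = 1 := by
  have h1 := integral_cexp_mul_heatKernel hθ m 0
  simp only [inner_zero_right, Complex.ofReal_zero, zero_mul, Complex.exp_zero, one_mul, norm_zero,
    ne_eq, OfNat.ofNat_ne_zero, not_false_eq_true, zero_pow, mul_zero, zero_div, sub_self] at h1
  rw [integral_complex_ofReal] at h1
  rw [← ofReal_integral_eq_lintegral_ofReal (integrable_heatKernel hθ m)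
    (ae_of_all _ fun z => heatKernel_nonneg hθ m z)]
  have : ∫ z, heatKernel θ m z = 1 := by exact_mod_cast h1
  rw [this, ENNReal.ofReal_one]

/-- Completing the square in `z`. The second factor on the right is the conditional density of the
position after time `α`, given both endpoints, so this is the disintegration of Brownian motion into
bridges. -/
lemma heatKernel_mul_heatKernel {α β : ℝ} (hα : 0 < α) (hβ : 0 < β) (x x' z : Space d) :
    heatKernel α x z * heatKernel β z x' =
      heatKernel (α + β) x x' *
        heatKernel (α * β / (α + β)) (x + (α / (α + β)) • (x' - x)) z := by
  have hab : 0 < α + β := by positivity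
  simp only [heatKernel]
  rw [mul_mul_mul_comm ((2 * Real.pi * α) ^ (-((d : ℝ) / 2))),
    mul_mul_mul_comm ((2 * Real.pi * (α + β)) ^ (-((d : ℝ) / 2))), ← Real.exp_add, ← Real.exp_add,
    ← Real.mul_rpow (by positivity) (by positivity), ← Real.mul_rpow (by positivity) (by positivity)]
  congr 2
  · field_simp
  · have h1 : x - x' = (x - z) + (z - x') := by abel
    have h2 : x + (α / (α + β)) • (x' - x) - z =
        (β / (α + β)) • (x - z) - (α / (α + β)) • (z - x') := by
      have : x' - x = -((x - z) + (z - x')) := by abel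
      have h3 : β / (α + β) = 1 - α / (α + β) := by field_simp; ring
      rw [this, h3]
      module
    rw [h1, h2]
    generalize x - z = p
    generalize z - x' = q
    rw [norm_add_sq_real, norm_sub_sq_real, norm_smul, norm_smul, real_inner_smul_left,
      real_inner_smul_right, mul_pow, mul_pow, Real.norm_eq_abs, Real.norm_eq_abs, sq_abs, sq_abs]
    field_simp
    ring

lemma isFiniteMeasure_withDensity_heatKernel {θ : ℝ} (hθ : 0 < θ) (m : Space d) :
    IsFiniteMeasure (volume.withDensity fun z => ENNReal.ofReal (heatKernel θ m z)) :=
  ⟨by rw [withDensity_apply _ MeasurableSet.univ, Measure.restrict_univ, lintegral_heatKernel hθ]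
      exact ENNReal.one_lt_top⟩

/-- The law of the Brownian bridge at an intermediate time. -/
lemma map_bridgePath_eq_withDensity {a s r t : ℝ} (ha : 0 < a) (hsr : s < r) (hrt : r < t)
    (x x' : Space d) :
    (bridgeMeasure d).map (fun ω => bridgePath a s t x x' ω r) =
      volume.withDensity fun z => ENNReal.ofReal
        (heatKernel (a * (r - s) * (a * (t - r)) / (a * (r - s) + a * (t - r)))
          (x + ((a * (r - s)) / (a * (r - s) + a * (t - r))) • (x' - x)) z) := by
  have h1 : 0 < r - s := by linarith
  have h2 : 0 < t - r := by linarith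
  have h3 : 0 < t - s := by linarith
  have hsum : a * (r - s) + a * (t - r) = a * (t - s) := by ring
  have hu : a * (r - s) / (a * (r - s) + a * (t - r)) = (r - s) / (t - s) := by
    rw [hsum]; field_simp
  rw [hu]
  set u := (r - s) / (t - s) with hu'
  have hu0 : 0 < u := by positivity
  have hu1 : u < 1 := by rw [hu', div_lt_one h3]; linarith
  have hθ : a * (r - s) * (a * (t - r)) / (a * (r - s) + a * (t - r)) =
      a * (t - s) * (u * (1 - u)) := by
    rw [hsum, hu']; field_simp; ring
  rw [hθ]
  set θ := a * (t - s) * (u * (1 - u)) with hθ'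
  have hθ0 : 0 < θ := by
    have : 0 < 1 - u := by linarith
    positivity
  have := isFiniteMeasure_withDensity_heatKernel hθ0 (x + u • (x' - x))
  have hm : Measurable fun ω : BridgeSpace d => bridgePath a s t x x' ω r := by
    unfold bridgePath
    have := measurable_bridge_right (d := d) ((r - s) / (t - s))
    fun_prop
  refine Measure.ext_of_charFun ?_
  funext ξ
  rw [charFun_apply, charFun_apply, integral_map hm.aemeasurable
    (Measurable.aestronglyMeasurable (by fun_prop))]
  have hk : Measurable fun z => ENNReal.ofReal (heatKernel θ (x + u • (x' - x)) z) :=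
    (measurable_heatKernel.comp (measurable_const.prodMk
      (measurable_const.prodMk measurable_id))).ennreal_ofReal
  rw [integral_withDensity_eq_integral_toReal_smul hk (ae_of_all _ fun _ => ENNReal.ofReal_lt_top)]
  have e1 : ∀ z, (ENNReal.ofReal (heatKernel θ (x + u • (x' - x)) z)).toReal •
      Complex.exp ((inner ℝ z ξ : ℝ) * Complex.I) = Complex.exp ((inner ℝ z ξ : ℝ) * Complex.I) *
        (heatKernel θ (x + u • (x' - x)) z : ℂ) := fun z => by
    rw [ENNReal.toReal_ofReal (heatKernel_nonneg hθ0 _ _), Complex.real_smul, mul_comm]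
  simp_rw [e1]
  rw [integral_cexp_mul_heatKernel hθ0]
  have e2 : ∀ ω : BridgeSpace d, Complex.exp ((inner ℝ (bridgePath a s t x x' ω r) ξ : ℝ) *
      Complex.I) = Complex.exp ((inner ℝ (x + u • (x' - x)) ξ : ℝ) * Complex.I) *
      Complex.exp (Complex.I * ((∑ _ : Unit, inner ℝ (√(a * (t - s)) • ξ) (bridge u ω) : ℝ) : ℂ)) :=
    fun ω => by
      rw [← Complex.exp_add, bridgePath, ← hu', inner_add_left, Complex.ofReal_add, add_mul,
        Finset.sum_const, Finset.card_univ, Fintype.card_unit, one_smul, mul_comm Complex.I,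
        real_inner_smul_left, real_inner_smul_left, real_inner_comm ξ (bridge u ω)]
  simp_rw [e2]
  rw [integral_const_mul, integral_cexp_bridge (fun _ : Unit => u) fun _ => √(a * (t - s)) • ξ,
    ← Complex.exp_add]
  congr 1
  rw [bridgeCov_of_mem hu0.le hu1.le hu0.le hu1.le, min_self]
  simp only [Finset.univ_unique, Finset.sum_singleton, real_inner_self_eq_norm_sq, norm_smul,
    Real.norm_eq_abs, mul_pow, sq_abs]
  rw [Real.sq_sqrt (by positivity), hθ']
  push_cast
  ring

/-! ### The function `u ↦ exp(-u)` -/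

/-- The extended exponential has continuity at `∞` built in; this is how `expNeg` inherits it. -/
lemma expNeg_eq_exp (u : ℝ≥0∞) : expNeg u = EReal.exp (-(u : EReal)) := by
  rcases eq_or_ne u ∞ with rfl | hu
  · simp [expNeg]
  · lift u to NNReal using hu
    rw [expNeg, if_neg ENNReal.coe_ne_top, ENNReal.coe_toReal]
    have : ((u : ℝ≥0∞) : EReal) = ((u : ℝ) : EReal) := rfl
    rw [this, ← EReal.coe_neg, EReal.exp_coe]

lemma continuous_expNeg : Continuous expNeg := by
  have : expNeg = fun u : ℝ≥0∞ => EReal.exp (-(u : EReal)) := funext expNeg_eq_exp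
  rw [this]
  exact ENNReal.continuous_exp.comp (continuous_neg.comp continuous_coe_ennreal_ereal)

lemma measurable_expNeg : Measurable expNeg := continuous_expNeg.measurable

lemma expNeg_of_ne_top {u : ℝ≥0∞} (hu : u ≠ ∞) :
    expNeg u = ENNReal.ofReal (Real.exp (-u.toReal)) := if_neg hu

lemma expNeg_le_one (u : ℝ≥0∞) : expNeg u ≤ 1 := by
  rw [expNeg]
  split_ifs
  · exact zero_le_one
  · rw [← ENNReal.ofReal_one]
    exact ENNReal.ofReal_le_ofReal (Real.exp_le_one_iff.2 (neg_nonpos.2 ENNReal.toReal_nonneg))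

lemma expNeg_ne_zero {u : ℝ≥0∞} (hu : u ≠ ∞) : expNeg u ≠ 0 := by
  rw [expNeg_of_ne_top hu]
  exact (ENNReal.ofReal_pos.2 (Real.exp_pos _)).ne'

lemma expNeg_ne_top (u : ℝ≥0∞) : expNeg u ≠ ∞ := ne_top_of_le_ne_top ENNReal.one_ne_top
  (expNeg_le_one u)

lemma expNeg_add (u v : ℝ≥0∞) : expNeg (u + v) = expNeg u * expNeg v := by
  rcases eq_or_ne u ∞ with rfl | hu
  · simp [expNeg]
  rcases eq_or_ne v ∞ with rfl | hv
  · simp [expNeg]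
  rw [expNeg_of_ne_top hu, expNeg_of_ne_top hv, expNeg_of_ne_top (ENNReal.add_ne_top.2 ⟨hu, hv⟩),
    ENNReal.toReal_add hu hv, neg_add, Real.exp_add, ENNReal.ofReal_mul (Real.exp_nonneg _)]

/-! ### Exponential functionals of processes with the same finite-dimensional laws -/

section Functional

variable {T Ω Ω' : Type*} [MeasurableSpace T] [MeasurableSpace Ω] [MeasurableSpace Ω']
  {P : Measure Ω} {P' : Measure Ω'} {l : Measure T} {U : T → Ω → ℝ≥0∞} {U' : T → Ω' → ℝ≥0∞}

/-- The `n`-th power of a time integral is an integral over `n` independent times. By Fubini, every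
moment of `∫ f` is a mixture of expectations that involve only `n`-dimensional laws; expanding
`exp(-x)` in powers then reaches the exponential functional. -/
lemma integral_pow_eq_integral_integral_prod [IsFiniteMeasure P] [IsFiniteMeasure l]
    {f : T → Ω → ℝ} (hf : Measurable (Function.uncurry f)) {C : ℝ} (hC : ∀ s ω, ‖f s ω‖ ≤ C)
    (n : ℕ) : ∫ ω, (∫ s, f s ω ∂l) ^ n ∂P =
      ∫ s : Fin n → T, ∫ ω, ∏ i, f (s i) ω ∂P ∂Measure.pi fun _ => l := by
  have h1 : ∀ ω, (∫ s, f s ω ∂l) ^ n = ∫ s : Fin n → T, ∏ i, f (s i) ω ∂Measure.pi fun _ => l :=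
    fun ω => by
      have := integral_fintype_prod_eq_pow (ι := Fin n) (μ := l) (fun s => f s ω)
      rw [Fintype.card_fin] at this
      exact this.symm
  simp_rw [h1]
  refine integral_integral_swap ?_
  refine Integrable.of_bound (Measurable.aestronglyMeasurable ?_) (C ^ n) (ae_of_all _ fun p => ?_)
  · refine Finset.measurable_prod _ fun i _ => ?_
    exact hf.comp (f := fun p : Ω × (Fin n → T) => (p.2 i, p.1)) (by fun_prop)
  · change ‖∏ i, f (p.2 i) p.1‖ ≤ C ^ n
    rw [norm_prod]
    calc _ ≤ ∏ _i : Fin n, C := Finset.prod_le_prod (fun _ _ => norm_nonneg _) fun i _ => hC _ _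
      _ = C ^ n := by simp

lemma hasSum_integral_exp_neg [IsFiniteMeasure P] {X : Ω → ℝ} (hX : Measurable X) {C : ℝ}
    (hC : ∀ ω, ‖X ω‖ ≤ C) :
    HasSum (fun n : ℕ => (-1) ^ n / n.factorial * ∫ ω, X ω ^ n ∂P) (∫ ω, Real.exp (-X ω) ∂P) := by
  have hi : ∀ n : ℕ, Integrable (fun ω => X ω ^ n) P := fun n =>
    Integrable.of_bound (hX.pow_const n).aestronglyMeasurable (C ^ n) (ae_of_all _ fun ω => by
      rw [norm_pow]; exact pow_le_pow_left₀ (norm_nonneg _) (hC ω) n)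
  have h := hasSum_integral_of_summable_integral_norm (μ := P)
    (F := fun (n : ℕ) ω => (-1) ^ n / n.factorial * X ω ^ n) (fun n => (hi n).const_mul _) ?_
  · simp_rw [integral_const_mul] at h
    have e : ∀ ω, Real.exp (-X ω) = ∑' n : ℕ, (-1) ^ n / n.factorial * X ω ^ n := fun ω => ?_
    · simp_rw [e]
      exact h
    rw [Real.exp_eq_exp_ℝ, NormedSpace.exp_eq_tsum_div]
    refine tsum_congr fun n => ?_
    rw [neg_pow]
    ring
  · have hs := (Real.summable_pow_div_factorial C).mul_right (P.real univ)
    refine Summable.of_nonneg_of_le (fun n => integral_nonneg fun _ => norm_nonneg _)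
      (fun n => ?_) hs
    calc ∫ ω, ‖(-1) ^ n / (n.factorial : ℝ) * X ω ^ n‖ ∂P ≤ ∫ _, C ^ n / n.factorial ∂P := by
          refine integral_mono ((hi n).const_mul _).norm (integrable_const _) fun ω => ?_
          simp only [norm_mul, norm_div, norm_pow, norm_neg, norm_one, one_pow, one_div,
            RCLike.norm_natCast]
          rw [inv_mul_eq_div]
          gcongr
          exact hC ω
      _ = _ := by rw [integral_const, smul_eq_mul, mul_comm]

lemma hasSum_toReal_lintegral_expNeg [IsFiniteMeasure P] [IsFiniteMeasure l]
    (hU : Measurable (Function.uncurry U)) {N : NNReal} (hN : ∀ s ω, U s ω ≤ N) :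
    HasSum (fun n : ℕ => (-1) ^ n / n.factorial *
      ∫ s : Fin n → T, ∫ ω, ∏ i, (U (s i) ω).toReal ∂P ∂Measure.pi fun _ => l)
      (∫⁻ ω, expNeg (∫⁻ s, U s ω ∂l) ∂P).toReal := by
  have hb : ∀ {u : ℝ≥0∞}, u ≤ N → ‖u.toReal‖ ≤ N := fun {u} hu => by
    rw [Real.norm_of_nonneg ENNReal.toReal_nonneg]
    simpa using ENNReal.toReal_mono ENNReal.coe_ne_top hu
  have hX : Measurable fun ω => ∫ s, (U s ω).toReal ∂l :=
    (StronglyMeasurable.integral_prod_right (f := fun ω s => (U s ω).toReal)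
      (hU.comp measurable_swap).ennreal_toReal.stronglyMeasurable).measurable
  have h1 : ∀ ω, ‖∫ s, (U s ω).toReal ∂l‖ ≤ N * l.real univ := fun ω =>
    norm_integral_le_of_norm_le_const (ae_of_all _ fun s => hb (hN s ω))
  have h2 := hasSum_integral_exp_neg (P := P) hX h1
  simp_rw [integral_pow_eq_integral_integral_prod (P := P) (l := l)
    (f := fun s ω => (U s ω).toReal) hU.ennreal_toReal fun s ω => hb (hN s ω)] at h2
  convert h2 using 1
  rw [integral_eq_lintegral_of_nonneg_ae (ae_of_all _ fun _ => Real.exp_nonneg _)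
    (Measurable.aestronglyMeasurable (by fun_prop))]
  congr 1
  refine lintegral_congr fun ω => ?_
  have hlt : ∫⁻ s, U s ω ∂l ≠ ∞ := by
    refine ne_top_of_le_ne_top ?_ (lintegral_mono fun s => hN s ω)
    rw [lintegral_const]
    exact ENNReal.mul_ne_top ENNReal.coe_ne_top (measure_ne_top _ _)
  rw [expNeg_of_ne_top hlt, integral_toReal]
  · exact (hU.comp measurable_prodMk_right).aemeasurable
  · exact ae_of_all _ fun s => (hN s ω).trans_lt ENNReal.coe_lt_top

lemma lintegral_expNeg_ne_top [IsFiniteMeasure P] (F : Ω → ℝ≥0∞) :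
    ∫⁻ ω, expNeg (F ω) ∂P ≠ ∞ := by
  refine ne_top_of_le_ne_top (measure_ne_top P univ) ?_
  calc _ ≤ ∫⁻ _, 1 ∂P := lintegral_mono fun _ => expNeg_le_one _
    _ = _ := lintegral_one

/-- Exponential functionals of bounded processes are determined by the finite-dimensional laws. -/
lemma lintegral_expNeg_eq_of_bounded [IsFiniteMeasure P] [IsFiniteMeasure P'] [IsFiniteMeasure l]
    (hU : Measurable (Function.uncurry U)) (hU' : Measurable (Function.uncurry U')) {N : NNReal}
    (hN : ∀ s ω, U s ω ≤ N) (hN' : ∀ s ω, U' s ω ≤ N) {I : Set T} (hI : ∀ᵐ s ∂l, s ∈ I)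
    (h : ∀ (n : ℕ) (s : Fin n → T), (∀ i, s i ∈ I) →
      P.map (fun ω i => U (s i) ω) = P'.map (fun ω i => U' (s i) ω)) :
    ∫⁻ ω, expNeg (∫⁻ s, U s ω ∂l) ∂P = ∫⁻ ω, expNeg (∫⁻ s, U' s ω ∂l) ∂P' := by
  have h1 := hasSum_toReal_lintegral_expNeg (P := P) (l := l) hU hN
  have h2 := hasSum_toReal_lintegral_expNeg (P := P') (l := l) hU' hN'
  have h3 : ∀ n : ℕ, ∫ s : Fin n → T, ∫ ω, ∏ i, (U (s i) ω).toReal ∂P ∂(Measure.pi fun _ => l) =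
      ∫ s : Fin n → T, ∫ ω, ∏ i, (U' (s i) ω).toReal ∂P' ∂(Measure.pi fun _ => l) := fun n => by
    have hI' : ∀ᵐ s : Fin n → T ∂(Measure.pi fun _ => l), ∀ i, s i ∈ I :=
      ae_all_iff.2 fun i => Measure.tendsto_eval_ae_ae.eventually hI
    refine integral_congr_ae ?_
    filter_upwards [hI'] with s hs
    have hm : AEStronglyMeasurable (fun y : Fin n → ℝ≥0∞ => ∏ i, (y i).toReal)
        (P.map fun ω i => U (s i) ω) := Measurable.aestronglyMeasurable
      (Finset.measurable_prod _ fun i _ => (measurable_pi_apply i).ennreal_toReal)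
    have e1 := integral_map (μ := P) (φ := fun ω i => U (s i) ω)
      (measurable_pi_lambda _ fun i => hU.comp measurable_prodMk_left).aemeasurable hm
    rw [h n s hs] at hm
    have e2 := integral_map (μ := P') (φ := fun ω i => U' (s i) ω)
      (measurable_pi_lambda _ fun i => hU'.comp measurable_prodMk_left).aemeasurable hm
    rw [← e1, ← e2, h n s hs]
  simp_rw [h3] at h1
  exact (ENNReal.toReal_eq_toReal_iff' (lintegral_expNeg_ne_top _) (lintegral_expNeg_ne_top _)).1 (h1.unique h2)

/-- Removes the boundedness assumption of the power series argument: the truncated exponents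
increase to the true one, possibly to `∞`, and dominated convergence with bound `1` handles the
expectation. -/
lemma tendsto_lintegral_expNeg_min [IsFiniteMeasure P] [IsFiniteMeasure l]
    (hU : Measurable (Function.uncurry U)) :
    Tendsto (fun N : ℕ => ∫⁻ ω, expNeg (∫⁻ s, min (U s ω) ((N : NNReal) : ℝ≥0∞) ∂l) ∂P) atTop
      (𝓝 (∫⁻ ω, expNeg (∫⁻ s, U s ω ∂l) ∂P)) := by
  refine tendsto_lintegral_of_dominated_convergence (fun _ => 1) (fun N => ?_)
    (fun N => ae_of_all _ fun ω => expNeg_le_one _) ?_ (ae_of_all _ fun ω => ?_)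
  · refine measurable_expNeg.comp ?_
    exact Measurable.lintegral_prod_right' (f := fun p : Ω × T =>
      min (U p.2 p.1) ((N : NNReal) : ℝ≥0∞)) ((hU.comp measurable_swap).min measurable_const)
  · rw [lintegral_one]; exact measure_ne_top _ _
  · refine (continuous_expNeg.tendsto _).comp ?_
    refine lintegral_tendsto_of_tendsto_of_monotone (fun N => ?_) (ae_of_all _ fun s => ?_)
      (ae_of_all _ fun s => ?_)
    · exact ((hU.comp measurable_prodMk_right).min measurable_const).aemeasurable
    · intro N N' hNN'
      exact min_le_min_left _ (by exact_mod_cast hNN')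
    · have : Tendsto (fun N : ℕ => min (U s ω) ((N : NNReal) : ℝ≥0∞)) atTop
          (𝓝 (min (U s ω) ∞)) := by
        refine tendsto_const_nhds.min ?_
        simpa using ENNReal.tendsto_nat_nhds_top
      simpa using this

/-- Exponential functionals of processes are determined by the finite-dimensional laws. -/
lemma lintegral_expNeg_eq [IsFiniteMeasure P] [IsFiniteMeasure P'] [IsFiniteMeasure l]
    (hU : Measurable (Function.uncurry U)) (hU' : Measurable (Function.uncurry U'))
    {I : Set T} (hI : ∀ᵐ s ∂l, s ∈ I)
    (h : ∀ (n : ℕ) (s : Fin n → T), (∀ i, s i ∈ I) →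
      P.map (fun ω i => U (s i) ω) = P'.map (fun ω i => U' (s i) ω)) :
    ∫⁻ ω, expNeg (∫⁻ s, U s ω ∂l) ∂P = ∫⁻ ω, expNeg (∫⁻ s, U' s ω ∂l) ∂P' := by
  refine tendsto_nhds_unique (tendsto_lintegral_expNeg_min hU) ?_
  refine (tendsto_lintegral_expNeg_min hU').congr fun N => ?_
  refine (lintegral_expNeg_eq_of_bounded (hU.min measurable_const) (hU'.min measurable_const)
    (N := N) (fun _ _ => min_le_right _ _) (fun _ _ => min_le_right _ _) hI fun n s hs => ?_).symm
  have hm : Measurable fun (y : Fin n → ℝ≥0∞) i => min (y i) ((N : NNReal) : ℝ≥0∞) := by fun_prop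
  have e1 := Measure.map_map (μ := P) (f := fun ω i => U (s i) ω) hm
    (measurable_pi_lambda _ fun i => hU.comp measurable_prodMk_left)
  have e2 := Measure.map_map (μ := P') (f := fun ω i => U' (s i) ω) hm
    (measurable_pi_lambda _ fun i => hU'.comp measurable_prodMk_left)
  rw [h n s hs, e2] at e1
  exact e1.symm

end Functional

/-! ### Exponentials of integrals -/

/-- The Lipschitz bound needed to pass absolute continuity from a nonpositive primitive to its
exponential. -/
lemma abs_exp_sub_exp_le {x y : ℝ} (hx : x ≤ 0) (hy : y ≤ 0) :
    |Real.exp x - Real.exp y| ≤ |x - y| := by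
  have key : ∀ {x y : ℝ}, y ≤ x → x ≤ 0 → |Real.exp x - Real.exp y| ≤ |x - y| := fun {x y} h hx => by
    rw [abs_of_nonneg (sub_nonneg.2 (Real.exp_le_exp.2 h)), abs_of_nonneg (sub_nonneg.2 h)]
    have h1 : Real.exp y = Real.exp x * Real.exp (y - x) := by rw [← Real.exp_add]; congr 1; ring
    have h2 := Real.add_one_le_exp (y - x)
    have h3 : Real.exp x ≤ 1 := Real.exp_le_one_iff.2 hx
    have h4 := Real.exp_pos x
    rw [h1]
    nlinarith
  rcases le_total y x with h | h
  · exact key h hx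
  · rw [abs_sub_comm, abs_sub_comm x]
    exact key h hy

/-- For Poisson points of intensity `g` on `(s, t)`: either there is none, or the last one falls at
some `r`. Analytically it is the fundamental theorem of calculus for `r ↦ exp(-∫_r^t g)`. As `g` is
merely integrable, this function is absolutely continuous and differentiable only almost everywhere.
-/
lemma expNeg_lintegral_add_lintegral {g : ℝ → ℝ≥0∞} (hg : Measurable g) {s t : ℝ} (hst : s ≤ t)
    (hfin : ∫⁻ r in Ioo s t, g r ≠ ∞) :
    expNeg (∫⁻ r in Ioo s t, g r) +
      ∫⁻ r in Ioo s t, g r * expNeg (∫⁻ q in Ioo r t, g q) = 1 := by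
  let f : ℝ → ℝ := fun r => (g r).toReal
  have hfm : Measurable f := hg.ennreal_toReal
  have hae : ∀ᵐ r ∂volume.restrict (Ioo s t), g r < ∞ := ae_lt_top hg hfin
  have hsub : ∀ {r}, r ∈ Icc s t → ∫⁻ q in Ioo r t, g q ≠ ∞ := fun {r} hr =>
    ne_top_of_le_ne_top hfin (lintegral_mono_set (Ioo_subset_Ioo_left hr.1))
  have hint : IntervalIntegrable f volume s t := by
    rw [intervalIntegrable_iff_integrableOn_Ioo_of_le hst]
    exact integrable_toReal_of_lintegral_ne_top hg.aemeasurable hfin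
  -- With base point `t`, `H` is minus the remaining exponent: nonpositive on `[s, t]`, zero at `t`,
  -- with derivative `f` almost everywhere.
  let H : ℝ → ℝ := fun r => ∫ q in t..r, f q
  have hH : ∀ r ∈ Icc s t, H r = -(∫⁻ q in Ioo r t, g q).toReal := fun r hr => by
    simp only [H]
    rw [intervalIntegral.integral_symm, intervalIntegral.integral_of_le hr.2,
      integral_Ioc_eq_integral_Ioo, integral_toReal hg.aemeasurable]
    exact ae_lt_top hg (hsub hr)
  have hH0 : ∀ r ∈ Icc s t, H r ≤ 0 := fun r hr => by
    rw [hH r hr]; exact neg_nonpos.2 ENNReal.toReal_nonneg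
  have hexp : ∀ r ∈ Icc s t, expNeg (∫⁻ q in Ioo r t, g q) = ENNReal.ofReal (Real.exp (H r)) :=
    fun r hr => by rw [expNeg_of_ne_top (hsub hr), hH r hr]
  have hHac : AbsolutelyContinuousOnInterval H s t :=
    hint.absolutelyContinuousOnInterval_intervalIntegral right_mem_uIcc
  have hac : AbsolutelyContinuousOnInterval (fun r => Real.exp (H r)) s t := by
    refine squeeze_zero' (Eventually.of_forall fun E => Finset.sum_nonneg fun _ _ => dist_nonneg)
      ?_ hHac
    refine (eventually_principal.2 fun E hE => ?_).filter_mono inf_le_right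
    refine Finset.sum_le_sum fun i hi => ?_
    have := hE.1 i hi
    rw [uIcc_of_le hst] at this
    exact abs_exp_sub_exp_le (hH0 _ this.1) (hH0 _ this.2)
  have hftc := hac.integral_deriv_eq_sub
  have hderiv : ∀ᵐ r, r ∈ uIcc s t → deriv (fun r => Real.exp (H r)) r = f r * Real.exp (H r) := by
    filter_upwards [hint.ae_hasDerivAt_integral] with r hr hrm
    rw [(hr hrm t right_mem_uIcc).exp.deriv, mul_comm]
  rw [intervalIntegral.integral_congr_ae (hderiv.mono fun r h hr => h (uIoc_subset_uIcc hr)),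
    intervalIntegral.integral_of_le hst, integral_Ioc_eq_integral_Ioo] at hftc
  have hHt : H t = 0 := intervalIntegral.integral_same
  rw [hHt, Real.exp_zero] at hftc
  have hHm : ∀ r ∈ Ioo s t, g r < ∞ →
      g r * expNeg (∫⁻ q in Ioo r t, g q) = ENNReal.ofReal (f r * Real.exp (H r)) :=
    fun r hr hlt => by
      rw [hexp r (Ioo_subset_Icc_self hr), ENNReal.ofReal_mul ENNReal.toReal_nonneg,
        ENNReal.ofReal_toReal hlt.ne]
  have hle : ∀ r ∈ Ioo s t, ‖f r * Real.exp (H r)‖ ≤ ‖f r‖ := fun r hr => by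
    rw [norm_mul, Real.norm_of_nonneg (Real.exp_nonneg _)]
    exact mul_le_of_le_one_right (norm_nonneg _)
      (Real.exp_le_one_iff.2 (hH0 r (Ioo_subset_Icc_self hr)))
  have hint' : Integrable (fun r => f r * Real.exp (H r)) (volume.restrict (Ioo s t)) := by
    have hfi : Integrable f (volume.restrict (Ioo s t)) :=
      (intervalIntegrable_iff_integrableOn_Ioo_of_le hst).1 hint
    refine hfi.mono ?_ (ae_restrict_of_forall_mem measurableSet_Ioo hle)
    refine hfm.aestronglyMeasurable.mul (Real.continuous_exp.comp_aestronglyMeasurable ?_)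
    have hsub' : Ioo s t ⊆ uIcc s t := by
      rw [uIcc_of_le hst]; exact Ioo_subset_Icc_self
    exact (hHac.continuousOn.mono hsub').aestronglyMeasurable measurableSet_Ioo
  have hlin : ∫⁻ r in Ioo s t, g r * expNeg (∫⁻ q in Ioo r t, g q) =
      ENNReal.ofReal (1 - Real.exp (H s)) := by
    rw [← hftc, ofReal_integral_eq_lintegral_ofReal hint' (ae_of_all _ fun r =>
      mul_nonneg ENNReal.toReal_nonneg (Real.exp_nonneg _))]
    refine lintegral_congr_ae ?_
    filter_upwards [hae, ae_restrict_mem measurableSet_Ioo] with r h1 h2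
    exact hHm r h2 h1
  rw [hlin, hexp s (left_mem_Icc.2 hst), ← ENNReal.ofReal_add (Real.exp_nonneg _)
    (sub_nonneg.2 (Real.exp_le_one_iff.2 (hH0 s (left_mem_Icc.2 hst))))]
  simp

/-- Grönwall's lemma with an integrable coefficient. -/
lemma eq_zero_of_le_lintegral {g f : ℝ → ℝ≥0∞} (hg : Measurable g) {t₀ : ℝ}
    (hfin : ∫⁻ r in Ioo 0 t₀, g r ≠ ∞) {C : ℝ≥0∞} (hC : C ≠ ∞)
    (hf : ∀ t ∈ Icc 0 t₀, f t ≤ C) (h : ∀ t ∈ Icc 0 t₀, f t ≤ ∫⁻ s in Ioo 0 t, g s * f s) :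
    ∀ t ∈ Icc 0 t₀, f t = 0 := by
  have hB : ∀ t ∈ Icc 0 t₀, ∫⁻ r in Ioo 0 t, 2 * g r ≠ ∞ := fun t ht => by
    rw [lintegral_const_mul _ hg]
    exact ENNReal.mul_ne_top (by simp) (ne_top_of_le_ne_top hfin
      (lintegral_mono_set (Ioo_subset_Ioo_right ht.2)))
  -- Bielecki's weighted supremum. Doubling `g` in the exponent makes the integral operator a
  -- contraction with constant `1/2`, so `S ≤ S / 2` with `S` finite forces `S = 0`. The function
  -- `f` need not be measurable.
  let S : ℝ≥0∞ := ⨆ t ∈ Icc 0 t₀, f t * expNeg (∫⁻ r in Ioo 0 t, 2 * g r)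
  have hS : ∀ t ∈ Icc 0 t₀, f t * expNeg (∫⁻ r in Ioo 0 t, 2 * g r) ≤ S := fun t ht =>
    le_iSup₂ (f := fun t (_ : t ∈ Icc 0 t₀) => f t * expNeg (∫⁻ r in Ioo 0 t, 2 * g r)) t ht
  have hSC : S ≤ C := iSup₂_le fun t ht =>
    (mul_le_mul' (hf t ht) (expNeg_le_one _)).trans (mul_one C).le
  have hS2 : S ≤ 2⁻¹ * S := iSup₂_le fun t ht => by
    have hsplit : ∀ s ∈ Ioo 0 t, expNeg (∫⁻ r in Ioo 0 t, 2 * g r) =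
        expNeg (∫⁻ r in Ioo 0 s, 2 * g r) * expNeg (∫⁻ r in Ioo s t, 2 * g r) := fun s hs => by
      rw [← expNeg_add]
      congr 1
      rw [← Ioo_union_Ico_eq_Ioo hs.1 hs.2.le, lintegral_union measurableSet_Ico]
      · congr 1
        exact setLIntegral_congr Ioo_ae_eq_Ico.symm
      · exact Set.disjoint_left.2 fun x hx hx' => not_lt.2 hx'.1 hx.2
    have hid := expNeg_lintegral_add_lintegral (hg.const_mul 2) ht.1 (hB t ht)
    calc f t * expNeg (∫⁻ r in Ioo 0 t, 2 * g r)
        ≤ (∫⁻ s in Ioo 0 t, g s * f s) * expNeg (∫⁻ r in Ioo 0 t, 2 * g r) :=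
          mul_le_mul_left (h t ht) _
      _ = ∫⁻ s in Ioo 0 t, g s * f s * expNeg (∫⁻ r in Ioo 0 t, 2 * g r) :=
          (lintegral_mul_const' _ _ (expNeg_ne_top _)).symm
      _ ≤ ∫⁻ s in Ioo 0 t, 2⁻¹ * S * (2 * g s * expNeg (∫⁻ r in Ioo s t, 2 * g r)) := by
          refine setLIntegral_mono' measurableSet_Ioo fun s hs => ?_
          have h1 := hS s ⟨hs.1.le, hs.2.le.trans ht.2⟩
          rw [hsplit s hs]
          calc _ = g s * (f s * expNeg (∫⁻ r in Ioo 0 s, 2 * g r)) *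
                expNeg (∫⁻ r in Ioo s t, 2 * g r) := by ring
            _ ≤ g s * S * expNeg (∫⁻ r in Ioo s t, 2 * g r) := by gcongr
            _ = (2⁻¹ * 2) * (g s * S * expNeg (∫⁻ r in Ioo s t, 2 * g r)) := by
                rw [ENNReal.inv_mul_cancel (by simp) (by simp), one_mul]
            _ = _ := by ring
      _ = 2⁻¹ * S * ∫⁻ s in Ioo 0 t, 2 * g s * expNeg (∫⁻ r in Ioo s t, 2 * g r) :=
          lintegral_const_mul' _ _ (ENNReal.mul_ne_top (by simp) (ne_top_of_le_ne_top hC hSC))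
      _ ≤ 2⁻¹ * S * 1 := by gcongr; rw [← hid]; exact le_add_self
      _ = 2⁻¹ * S := mul_one _
  have hS0 : S = 0 := by
    by_contra h0
    have hST : S ≠ ∞ := ne_top_of_le_ne_top hC hSC
    have : 2⁻¹ * S < 1 * S := ENNReal.mul_lt_mul_left h0 hST (by simp)
    rw [one_mul] at this
    exact absurd hS2 (not_le.2 this)
  intro t ht
  have := hS t ht
  rw [hS0, nonpos_iff_eq_zero, mul_eq_zero] at this
  exact this.resolve_right (expNeg_ne_zero (hB t ht))

/-! ### The transition density of a Brownian motion killed at a given rate -/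

/-- The transition density of `½ a Δ - c`, given by the Feynman-Kac formula. -/
def bridgeKernel (a : ℝ) (c : ℝ → Space d → ℝ≥0∞) (s t : ℝ) (x x' : Space d) : ℝ≥0∞ :=
  ENNReal.ofReal (heatKernel (a * (t - s)) x x') *
    ∫⁻ ω, expNeg (∫⁻ τ in Ioo s t, c τ (bridgePath a s t x x' ω τ)) ∂bridgeMeasure d

lemma measurable_bridgePath_comp {X : Type*} [MeasurableSpace X] {a s t τ : X → ℝ}
    {x x' : X → Space d} {ω : X → BridgeSpace d} (ha : Measurable a) (hs : Measurable s)
    (ht : Measurable t) (hτ : Measurable τ) (hx : Measurable x) (hx' : Measurable x')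
    (hω : Measurable ω) :
    Measurable fun p => bridgePath (a p) (s p) (t p) (x p) (x' p) (ω p) (τ p) := by
  unfold bridgePath
  have h1 : Measurable fun p => (τ p - s p) / (t p - s p) := (hτ.sub hs).div (ht.sub hs)
  have h2 : Measurable fun p => bridge ((τ p - s p) / (t p - s p)) (ω p) :=
    measurable_bridge.comp (h1.prodMk hω)
  exact (hx.add (h1.smul (hx'.sub hx))).add ((ha.mul (ht.sub hs)).sqrt.smul h2)

lemma measurable_heatKernel_comp {X : Type*} [MeasurableSpace X] {t : X → ℝ}
    {x x' : X → Space d} (ht : Measurable t) (hx : Measurable x) (hx' : Measurable x') :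
    Measurable fun p => ENNReal.ofReal (heatKernel (t p) (x p) (x' p)) :=
  (measurable_heatKernel.comp (ht.prodMk (hx.prodMk hx'))).ennreal_ofReal

lemma measurable_setLIntegral_Ioo {X : Type*} [MeasurableSpace X] {s t : X → ℝ}
    {f : X → ℝ → ℝ≥0∞} (hs : Measurable s) (ht : Measurable t)
    (hf : Measurable (Function.uncurry f)) :
    Measurable fun p => ∫⁻ τ in Ioo (s p) (t p), f p τ := by
  have e : ∀ p, ∫⁻ τ in Ioo (s p) (t p), f p τ =
      ∫⁻ τ, {q : X × ℝ | s q.1 < q.2 ∧ q.2 < t q.1}.indicator (Function.uncurry f) (p, τ) :=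
    fun p => by
      rw [← lintegral_indicator measurableSet_Ioo]
      rfl
  simp_rw [e]
  refine Measurable.lintegral_prod_right' (f := {q : X × ℝ | s q.1 < q.2 ∧ q.2 < t q.1}.indicator
    (Function.uncurry f)) (hf.indicator ?_)
  exact (measurableSet_lt (hs.comp measurable_fst) measurable_snd).inter
    (measurableSet_lt measurable_snd (ht.comp measurable_fst))

lemma setLIntegral_Ioo_comp_sub_left (F : ℝ → ℝ≥0∞) (σ s t : ℝ) :
    ∫⁻ r in Ioo s t, F (σ - r) = ∫⁻ r in Ioo (σ - t) (σ - s), F r := by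
  have h := (Measure.measurePreserving_sub_left (volume : Measure ℝ) σ).setLIntegral_comp_preimage_emb
    (MeasurableEquiv.subLeft σ).measurableEmbedding F (Ioo (σ - t) (σ - s))
  simpa using h

section Markov

variable {a s r t : ℝ} {x x' : Space d} {c : ℝ → Space d → ℝ≥0∞}

lemma bridgePath_eq_bridgePath_tail (ha : 0 < a) (hsr : s < r) (hrt : r < t) (x x' : Space d)
    (ω : BridgeSpace d) {τ : ℝ} :
    bridgePath a s t x x' ω τ = bridgePath a s t x x' ω r +
      ((τ - r) / (t - r)) • (x' - bridgePath a s t x x' ω r) +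
      √(a * (t - r)) • bridgeTail ((r - s) / (t - s)) ((τ - r) / (t - r)) ω := by
  have h1 : 0 < r - s := by linarith
  have h2 : 0 < t - r := by linarith
  have h3 : 0 < t - s := by linarith
  have hu : 1 - (r - s) / (t - s) = (t - r) / (t - s) := by field_simp; ring
  have hv : 1 - (τ - r) / (t - r) = (t - τ) / (t - r) := by field_simp; ring
  have hτ : (r - s) / (t - s) + (1 - (r - s) / (t - s)) * ((τ - r) / (t - r)) =
      (τ - s) / (t - s) := by rw [hu]; field_simp; ring
  -- The normalization inside `bridgeTail` converts the diffusive scale of `[r, t]` back to that of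
  -- `[s, t]`. The rest is affine algebra in the position.
  have hsq : √(a * (t - r)) * (√((t - r) / (t - s)))⁻¹ = √(a * (t - s)) := by
    rw [← Real.sqrt_inv, ← Real.sqrt_mul (by positivity)]
    congr 1
    field_simp
  simp only [bridgeTail, hτ, bridgePath]
  rw [hu, hv, smul_smul, hsq]
  have e1 : (τ - s) / (t - s) = (r - s) / (t - s) + (1 - (r - s) / (t - s)) * ((τ - r) / (t - r)) :=
    hτ.symm
  have e2 : (t - τ) / (t - r) = 1 - (τ - r) / (t - r) := hv.symm
  rw [e2]
  generalize bridge ((τ - s) / (t - s)) ω = b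
  rw [e1]
  module

lemma isProbabilityMeasure_map_bridgePath (a s t r : ℝ) (x x' : Space d) :
    IsProbabilityMeasure ((bridgeMeasure d).map fun ω => bridgePath a s t x x' ω r) :=
  Measure.isProbabilityMeasure_map (measurable_bridgePath_comp measurable_const measurable_const
    measurable_const measurable_const measurable_const measurable_const measurable_id).aemeasurable

/-- The Markov property at time `r`, tested on events of the position at `r`. After `r` the path is
a bridge from its current position, driven by the tail, which can be replaced by an independent
bridge on a product space. The two killing functionals agree because their finite-dimensional laws
do, under the measures restricted to the event. -/
lemma setLIntegral_expNeg_bridgePath (ha : 0 < a) (hsr : s < r) (hrt : r < t)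
    (hc : Measurable (Function.uncurry c)) {B : Set (Space d)} (hB : MeasurableSet B) :
    ∫⁻ ω in {ω | bridgePath a s t x x' ω r ∈ B},
      expNeg (∫⁻ τ in Ioo r t, c τ (bridgePath a s t x x' ω τ)) ∂bridgeMeasure d =
    ∫⁻ z in B, ∫⁻ ω, expNeg (∫⁻ τ in Ioo r t, c τ (bridgePath a r t z x' ω τ)) ∂bridgeMeasure d
      ∂((bridgeMeasure d).map fun ω => bridgePath a s t x x' ω r) := by
  set P := bridgeMeasure d
  have h1 : 0 < r - s := by linarith
  have h2 : 0 < t - r := by linarith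
  have h3 : 0 < t - s := by linarith
  set u := (r - s) / (t - s) with hu
  have hu0 : 0 < u := by positivity
  have hu1 : u < 1 := by rw [hu, div_lt_one h3]; linarith
  have hW : Measurable fun ω : BridgeSpace d => bridgePath a s t x x' ω r :=
    measurable_bridgePath_comp measurable_const measurable_const measurable_const measurable_const
      measurable_const measurable_const measurable_id
  have hA : MeasurableSet {ω : BridgeSpace d | bridgePath a s t x x' ω r ∈ B} := hW hB
  let U : ℝ → BridgeSpace d → ℝ≥0∞ := fun τ ω => c τ (bridgePath a s t x x' ω τ)
  let U' : ℝ → BridgeSpace d × BridgeSpace d → ℝ≥0∞ := fun τ p =>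
    c τ (bridgePath a r t (bridgePath a s t x x' p.1 r) x' p.2 τ)
  have hU : Measurable (Function.uncurry U) :=
    hc.comp (measurable_fst.prodMk (measurable_bridgePath_comp measurable_const measurable_const
      measurable_const measurable_fst measurable_const measurable_const measurable_snd))
  have hU' : Measurable (Function.uncurry U') :=
    hc.comp (measurable_fst.prodMk (measurable_bridgePath_comp measurable_const measurable_const
      measurable_const measurable_fst (hW.comp measurable_snd.fst) measurable_const
      measurable_snd.snd))
  have key := lintegral_expNeg_eq (P := P.restrict {ω | bridgePath a s t x x' ω r ∈ B})
    (P' := (P.prod P).restrict ({ω | bridgePath a s t x x' ω r ∈ B} ×ˢ univ))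
    (l := volume.restrict (Ioo r t)) hU hU' (I := Ioo r t) (ae_restrict_mem measurableSet_Ioo) ?_
  · rw [← Measure.prod_restrict, Measure.restrict_univ, lintegral_prod] at key
    · refine key.trans ?_
      rw [setLIntegral_map hB _ hW]
      · rfl
      · refine Measurable.lintegral_prod_right' (f := fun p : Space d × BridgeSpace d =>
          expNeg (∫⁻ τ in Ioo r t, c τ (bridgePath a r t p.1 x' p.2 τ))) ?_
        refine measurable_expNeg.comp (measurable_setLIntegral_Ioo measurable_const
          measurable_const ?_)
        exact hc.comp (measurable_snd.prodMk (measurable_bridgePath_comp measurable_const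
          measurable_const measurable_const measurable_snd measurable_fst.fst measurable_const
          measurable_fst.snd))
    · exact (measurable_expNeg.comp (measurable_setLIntegral_Ioo measurable_const
        measurable_const (f := fun p τ => U' τ p) (hU'.comp measurable_swap))).aemeasurable
  · intro n τ hτ
    let mean : Space d → Space d := fun b => x + u • (x' - x) + √(a * (t - s)) • b
    have hmean : Measurable mean := by fun_prop
    -- One measurable map produces the rates at the times `τ i` from the pair (value at `u`, later
    -- values), whether these come from the tail of the same bridge or from an independent bridge.
    -- Pushing the equality of laws `hlaw` forward by it gives the claim.
    let Φ : Space d × (Fin n → Space d) → Fin n → ℝ≥0∞ := fun q i =>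
      c (τ i) (mean q.1 + ((τ i - r) / (t - r)) • (x' - mean q.1) + √(a * (t - r)) • q.2 i)
    have hΦ : Measurable Φ := by
      refine measurable_pi_lambda _ fun i => hc.comp (measurable_const.prodMk ?_)
      have : Measurable fun q : Space d × (Fin n → Space d) => mean q.1 := hmean.comp measurable_fst
      fun_prop
    have hB' : MeasurableSet ((mean ⁻¹' B) ×ˢ (univ : Set (Fin n → Space d))) :=
      (hmean hB).prod MeasurableSet.univ
    have hv : ∀ i, (τ i - r) / (t - r) ∈ Icc (0 : ℝ) 1 := fun i =>
      ⟨div_nonneg (by linarith [(hτ i).1]) h2.le, (div_le_one h2).2 (by linarith [(hτ i).2])⟩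
    have hlaw := map_bridge_bridgeTail (d := d) hu0 hu1 (fun i => (τ i - r) / (t - r)) hv
    have hf : Measurable fun ω : BridgeSpace d =>
        (bridge u ω, fun i => bridgeTail u ((τ i - r) / (t - r)) ω) :=
      (measurable_bridge_right u).prodMk (measurable_pi_lambda _ fun i => measurable_bridgeTail _ _)
    have hf' : Measurable fun p : BridgeSpace d × BridgeSpace d =>
        (bridge u p.1, fun i => bridge ((τ i - r) / (t - r)) p.2) :=
      ((measurable_bridge_right u).comp measurable_fst).prodMk
        (measurable_pi_lambda _ fun i => (measurable_bridge_right _).comp measurable_snd)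
    have e := congrArg (fun m : Measure (Space d × (Fin n → Space d)) =>
      (m.restrict ((mean ⁻¹' B) ×ˢ univ)).map Φ) hlaw
    simp only [Measure.restrict_map hf hB', Measure.restrict_map hf' hB', Measure.map_map hΦ hf,
      Measure.map_map hΦ hf'] at e
    have e1 : (fun (ω : BridgeSpace d) i => U (τ i) ω) =
        Φ ∘ fun ω => (bridge u ω, fun i => bridgeTail u ((τ i - r) / (t - r)) ω) := by
      funext ω i
      simp only [U, Φ, Function.comp, mean]
      rw [bridgePath_eq_bridgePath_tail ha hsr hrt]
      rfl
    have e2 : {ω : BridgeSpace d | bridgePath a s t x x' ω r ∈ B} ×ˢ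
        (univ : Set (BridgeSpace d)) = (fun p : BridgeSpace d × BridgeSpace d =>
        (bridge u p.1, fun i => bridge ((τ i - r) / (t - r)) p.2)) ⁻¹'
          (mean ⁻¹' B) ×ˢ (univ : Set (Fin n → Space d)) := by
      ext p
      simp only [mem_ofPred_eq, mem_preimage, mem_prod, mem_univ, and_true]
      rfl
    have e3 : {ω : BridgeSpace d | bridgePath a s t x x' ω r ∈ B} = (fun ω : BridgeSpace d =>
        (bridge u ω, fun i => bridgeTail u ((τ i - r) / (t - r)) ω)) ⁻¹'
          (mean ⁻¹' B) ×ˢ (univ : Set (Fin n → Space d)) := by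
      ext p
      simp only [mem_ofPred_eq, mem_preimage, mem_prod, mem_univ, and_true]
      rfl
    rw [e1, e2, e3]
    exact e

/-- The Markov property of the Brownian bridge. -/
lemma lintegral_bridgePath_mul_expNeg (ha : 0 < a) (hsr : s < r) (hrt : r < t)
    (hc : Measurable (Function.uncurry c)) {g : Space d → ℝ≥0∞} (hg : Measurable g) :
    ENNReal.ofReal (heatKernel (a * (t - s)) x x') *
      ∫⁻ ω, g (bridgePath a s t x x' ω r) *
        expNeg (∫⁻ τ in Ioo r t, c τ (bridgePath a s t x x' ω τ)) ∂bridgeMeasure d =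
    ∫⁻ z, ENNReal.ofReal (heatKernel (a * (r - s)) x z) * (g z * bridgeKernel a c r t z x') := by
  have hW : Measurable fun ω : BridgeSpace d => bridgePath a s t x x' ω r :=
    measurable_bridgePath_comp measurable_const measurable_const measurable_const measurable_const
      measurable_const measurable_const measurable_id
  have hF : Measurable fun ω : BridgeSpace d =>
      expNeg (∫⁻ τ in Ioo r t, c τ (bridgePath a s t x x' ω τ)) := by
    refine measurable_expNeg.comp (measurable_setLIntegral_Ioo measurable_const
      measurable_const ?_)
    exact hc.comp (measurable_snd.prodMk (measurable_bridgePath_comp measurable_const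
      measurable_const measurable_const measurable_snd measurable_const measurable_const
      measurable_fst))
  have hG : Measurable fun z : Space d =>
      ∫⁻ ω, expNeg (∫⁻ τ in Ioo r t, c τ (bridgePath a r t z x' ω τ)) ∂bridgeMeasure d := by
    refine Measurable.lintegral_prod_right' (f := fun p : Space d × BridgeSpace d =>
      expNeg (∫⁻ τ in Ioo r t, c τ (bridgePath a r t p.1 x' p.2 τ))) ?_
    refine measurable_expNeg.comp (measurable_setLIntegral_Ioo measurable_const
      measurable_const ?_)
    exact hc.comp (measurable_snd.prodMk (measurable_bridgePath_comp measurable_const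
      measurable_const measurable_const measurable_snd measurable_fst.fst measurable_const
      measurable_fst.snd))
  -- The identity on events becomes an equality of measures on positions, against which an arbitrary
  -- `g` can be integrated.
  have hmeas : ((bridgeMeasure d).withDensity fun ω =>
      expNeg (∫⁻ τ in Ioo r t, c τ (bridgePath a s t x x' ω τ))).map
        (fun ω => bridgePath a s t x x' ω r) =
      ((bridgeMeasure d).map fun ω => bridgePath a s t x x' ω r).withDensity fun z =>
        ∫⁻ ω, expNeg (∫⁻ τ in Ioo r t, c τ (bridgePath a r t z x' ω τ)) ∂bridgeMeasure d := by
    ext B hB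
    rw [Measure.map_apply hW hB, withDensity_apply _ (hW hB), withDensity_apply _ hB]
    exact setLIntegral_expNeg_bridgePath ha hsr hrt hc hB
  have hgW : Measurable fun ω : BridgeSpace d => g (bridgePath a s t x x' ω r) := hg.comp hW
  have e1 := congrArg (fun m => ∫⁻ z, g z ∂m) hmeas
  rw [lintegral_map hg hW, lintegral_withDensity_eq_lintegral_mul _ hF hgW,
    lintegral_withDensity_eq_lintegral_mul _ hG hg,
    map_bridgePath_eq_withDensity ha hsr hrt, lintegral_withDensity_eq_lintegral_mul _
      (measurable_heatKernel_comp measurable_const measurable_const measurable_id')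
      (hG.mul hg)] at e1
  have h1 : 0 < a * (r - s) := mul_pos ha (by linarith)
  have h2 : 0 < a * (t - r) := mul_pos ha (by linarith)
  have hs : a * (r - s) + a * (t - r) = a * (t - s) := by ring
  calc _ = ENNReal.ofReal (heatKernel (a * (t - s)) x x') *
        ∫⁻ ω, ((fun ω => expNeg (∫⁻ τ in Ioo r t, c τ (bridgePath a s t x x' ω τ))) *
          fun ω => g (bridgePath a s t x x' ω r)) ω ∂bridgeMeasure d := by
        congr 1
        exact lintegral_congr fun ω => mul_comm _ _
    _ = _ := by
        rw [e1, ← lintegral_const_mul' _ _ ENNReal.ofReal_ne_top]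
        refine lintegral_congr fun z => ?_
        simp only [Pi.mul_apply, bridgeKernel]
        -- The endpoint density times the bridge density at `r` is the product of the two heat
        -- kernels; the second of them is the prefactor of `bridgeKernel` on `[r, t]`.
        have e2 := heatKernel_mul_heatKernel h1 h2 x x' z
        rw [← mul_assoc, ← ENNReal.ofReal_mul (heatKernel_nonneg (by linarith) _ _), ← hs, ← e2,
          ENNReal.ofReal_mul (heatKernel_nonneg h1 _ _)]
        ring

lemma measurable_bridgeKernel_comp {X : Type*} [MeasurableSpace X] {a s t : X → ℝ}
    {x x' : X → Space d} {c : X → ℝ → Space d → ℝ≥0∞} (ha : Measurable a) (hs : Measurable s)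
    (ht : Measurable t) (hx : Measurable x) (hx' : Measurable x')
    (hc : Measurable fun p : X × ℝ × Space d => c p.1 p.2.1 p.2.2) :
    Measurable fun p => bridgeKernel (a p) (c p) (s p) (t p) (x p) (x' p) := by
  unfold bridgeKernel
  refine (measurable_heatKernel_comp (ha.mul (ht.sub hs)) hx hx').mul ?_
  refine Measurable.lintegral_prod_right' (f := fun q : X × BridgeSpace d => expNeg
    (∫⁻ τ in Ioo (s q.1) (t q.1), c q.1 τ
      (bridgePath (a q.1) (s q.1) (t q.1) (x q.1) (x' q.1) q.2 τ))) ?_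
  refine measurable_expNeg.comp (measurable_setLIntegral_Ioo (hs.comp measurable_fst)
    (ht.comp measurable_fst) ?_)
  refine hc.comp (measurable_fst.fst.prodMk (measurable_snd.prodMk ?_))
  exact measurable_bridgePath_comp (ha.comp measurable_fst.fst) (hs.comp measurable_fst.fst)
    (ht.comp measurable_fst.fst) measurable_snd (hx.comp measurable_fst.fst)
    (hx'.comp measurable_fst.fst) measurable_fst.snd

/-- The expected exponent is at most `∫ β`. At each interior time the bridge has a density, so it
does not see the null set of positions where the bound on `c` may fail. -/
lemma ae_lintegral_bridgePath_lt_top (ha : 0 < a) (hc : Measurable (Function.uncurry c))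
    {β : ℝ → ℝ≥0∞} (hβ : ∫⁻ τ in Ioo s t, β τ ≠ ∞)
    (hcβ : ∀ᵐ τ ∂volume.restrict (Ioo s t), ∀ᵐ z, c τ z ≤ β τ) (x x' : Space d) :
    ∀ᵐ ω ∂bridgeMeasure d, ∫⁻ τ in Ioo s t, c τ (bridgePath a s t x x' ω τ) < ∞ := by
  have hm : Measurable fun p : BridgeSpace d × ℝ => c p.2 (bridgePath a s t x x' p.1 p.2) :=
    hc.comp (measurable_snd.prodMk (measurable_bridgePath_comp measurable_const
      measurable_const measurable_const measurable_snd measurable_const measurable_const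
      measurable_fst))
  refine ae_lt_top (Measurable.lintegral_prod_right' hm) ?_
  refine ne_top_of_le_ne_top hβ ?_
  rw [lintegral_lintegral_swap hm.aemeasurable]
  refine lintegral_mono_ae ?_
  filter_upwards [hcβ, ae_restrict_mem measurableSet_Ioo] with τ hτ hmem
  have hW : Measurable fun ω : BridgeSpace d => bridgePath a s t x x' ω τ :=
    measurable_bridgePath_comp measurable_const measurable_const measurable_const measurable_const
      measurable_const measurable_const measurable_id
  have hcτ : Measurable (c τ) := hc.comp measurable_prodMk_left
  have := isProbabilityMeasure_map_bridgePath a s t τ x x'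
  calc ∫⁻ ω, c τ (bridgePath a s t x x' ω τ) ∂bridgeMeasure d
      = ∫⁻ z, c τ z ∂((bridgeMeasure d).map fun ω => bridgePath a s t x x' ω τ) :=
        (lintegral_map hcτ hW).symm
    _ ≤ ∫⁻ _, β τ ∂((bridgeMeasure d).map fun ω => bridgePath a s t x x' ω τ) := by
        refine lintegral_mono_ae ?_
        rw [map_bridgePath_eq_withDensity ha hmem.1 hmem.2]
        exact (withDensity_absolutelyContinuous _ _).ae_le hτ
    _ = β τ := by rw [lintegral_const, measure_univ, mul_one]

/-- Duhamel's formula: perturbation of the heat kernel by killing after an intermediate time. -/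
lemma heatKernel_eq_bridgeKernel_add (ha : 0 < a) (hst : s < t)
    (hc : Measurable (Function.uncurry c)) {β : ℝ → ℝ≥0∞} (hβ : ∫⁻ τ in Ioo s t, β τ ≠ ∞)
    (hcβ : ∀ᵐ τ ∂volume.restrict (Ioo s t), ∀ᵐ z, c τ z ≤ β τ) (x x' : Space d) :
    ENNReal.ofReal (heatKernel (a * (t - s)) x x') = bridgeKernel a c s t x x' +
      ∫⁻ r in Ioo s t, ∫⁻ z, ENNReal.ofReal (heatKernel (a * (r - s)) x z) *
        (c r z * bridgeKernel a c r t z x') := by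
  have hm : Measurable fun p : BridgeSpace d × ℝ => c p.2 (bridgePath a s t x x' p.1 p.2) :=
    hc.comp (measurable_snd.prodMk (measurable_bridgePath_comp measurable_const
      measurable_const measurable_const measurable_snd measurable_const measurable_const
      measurable_fst))
  have hm1 : Measurable fun p : BridgeSpace d × ℝ => c p.2 (bridgePath a s t x x' p.1 p.2) *
      expNeg (∫⁻ τ in Ioo p.2 t, c τ (bridgePath a s t x x' p.1 τ)) := by
    refine hm.mul (measurable_expNeg.comp (measurable_setLIntegral_Ioo measurable_snd
      measurable_const ?_))
    exact hm.comp (measurable_fst.fst.prodMk measurable_snd)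
  have hm2 : Measurable fun ω : BridgeSpace d =>
      expNeg (∫⁻ τ in Ioo s t, c τ (bridgePath a s t x x' ω τ)) :=
    measurable_expNeg.comp (measurable_setLIntegral_Ioo measurable_const measurable_const hm)
  -- The decomposition by the last killing point holds along almost every path and is averaged.
  -- Multiplying by the heat kernel and applying the Markov property at `r` then gives the formula.
  have h1 : ∫⁻ ω, (expNeg (∫⁻ τ in Ioo s t, c τ (bridgePath a s t x x' ω τ)) +
      ∫⁻ r in Ioo s t, c r (bridgePath a s t x x' ω r) *
        expNeg (∫⁻ τ in Ioo r t, c τ (bridgePath a s t x x' ω τ))) ∂bridgeMeasure d = 1 := by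
    rw [← measure_univ (μ := bridgeMeasure d), ← lintegral_one]
    refine lintegral_congr_ae ?_
    filter_upwards [ae_lintegral_bridgePath_lt_top ha hc hβ hcβ x x'] with ω hω
    exact expNeg_lintegral_add_lintegral (hm.comp measurable_prodMk_left) hst.le hω.ne
  rw [lintegral_add_left hm2, lintegral_lintegral_swap hm1.aemeasurable] at h1
  rw [← mul_one (ENNReal.ofReal _), ← h1, mul_add]
  congr 1
  rw [← lintegral_const_mul' _ _ ENNReal.ofReal_ne_top]
  refine setLIntegral_congr_fun measurableSet_Ioo fun r hr => ?_
  exact lintegral_bridgePath_mul_expNeg ha hr.1 hr.2 hc (hc.comp measurable_prodMk_left)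

/-- Time reversal of the Brownian bridge. -/
lemma bridgeKernel_reverse (hst : s < t) (hc : Measurable (Function.uncurry c)) (σ : ℝ)
    (x x' : Space d) :
    bridgeKernel a (fun τ => c (σ - τ)) (σ - t) (σ - s) x' x = bridgeKernel a c s t x x' := by
  have hts : 0 < t - s := by linarith
  have e0 : σ - s - (σ - t) = t - s := by ring
  rw [bridgeKernel, bridgeKernel, e0, heatKernel_symm]
  congr 1
  -- Both exponents are time integrals of the same function of a standard bridge, read at `1 - v` in
  -- one case and at `v` in the other, so the symmetry of the bridge law under `v ↦ 1 - v` applies.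
  let f : ℝ → Space d → ℝ≥0∞ := fun τ b =>
    c τ (x + ((τ - s) / (t - s)) • (x' - x) + √(a * (t - s)) • b)
  have hf : ∀ τ, Measurable (f τ) := fun τ => by
    refine hc.comp (measurable_const.prodMk ?_)
    fun_prop
  have e1 : ∀ ω : BridgeSpace d, ∫⁻ τ in Ioo (σ - t) (σ - s),
      c (σ - τ) (bridgePath a (σ - t) (σ - s) x' x ω τ) =
      ∫⁻ τ in Ioo s t, f τ (bridge (1 - (τ - s) / (t - s)) ω) := fun ω => by
    rw [← setLIntegral_Ioo_comp_sub_left]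
    refine lintegral_congr fun τ => ?_
    simp only [f, bridgePath, e0, sub_sub_cancel]
    have h1 : (σ - τ - (σ - t)) / (t - s) = 1 - (τ - s) / (t - s) := by field_simp; ring
    rw [h1]
    congr 2
    module
  have e2 : ∀ ω : BridgeSpace d, ∫⁻ τ in Ioo s t, c τ (bridgePath a s t x x' ω τ) =
      ∫⁻ τ in Ioo s t, f τ (bridge ((τ - s) / (t - s)) ω) := fun ω => rfl
  simp_rw [e1, e2]
  have hb : ∀ {v : ℝ → ℝ}, Measurable v → Measurable (Function.uncurry fun (τ : ℝ)
      (ω : BridgeSpace d) => f τ (bridge (v τ) ω)) := fun {v} hv => by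
    refine hc.comp (measurable_fst.prodMk ?_)
    have : Measurable fun p : ℝ × BridgeSpace d => bridge (v p.1) p.2 :=
      measurable_bridge.comp ((hv.comp measurable_fst).prodMk measurable_snd)
    fun_prop
  refine lintegral_expNeg_eq (hb (by fun_prop)) (hb (by fun_prop)) (I := univ)
    (ae_of_all _ fun _ => mem_univ _) fun n τ _ => ?_
  have hF : Measurable fun (q : Fin n → Space d) i => f (τ i) (q i) :=
    measurable_pi_lambda _ fun i => (hf _).comp (measurable_pi_apply i)
  have e := congrArg (Measure.map fun (q : Fin n → Space d) i => f (τ i) (q i))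
    (map_bridge_reverse (d := d) fun i => (τ i - s) / (t - s))
  rwa [Measure.map_map hF (measurable_pi_lambda _ fun i => measurable_bridge_right _),
    Measure.map_map hF (measurable_pi_lambda _ fun i => measurable_bridge_right _)] at e

/-- Duhamel's formula: perturbation of the heat kernel by killing up to an intermediate time. -/
lemma heatKernel_eq_bridgeKernel_add' (ha : 0 < a) (hst : s < t)
    (hc : Measurable (Function.uncurry c)) {β : ℝ → ℝ≥0∞} (hβ : ∫⁻ τ in Ioo s t, β τ ≠ ∞)
    (hcβ : ∀ᵐ τ ∂volume.restrict (Ioo s t), ∀ᵐ z, c τ z ≤ β τ) (x x' : Space d) :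
    ENNReal.ofReal (heatKernel (a * (t - s)) x x') = bridgeKernel a c s t x x' +
      ∫⁻ r in Ioo s t, ∫⁻ z, bridgeKernel a c s r x z *
        (c r z * ENNReal.ofReal (heatKernel (a * (t - r)) z x')) := by
  -- The first Duhamel formula is applied to the rate reflected in the midpoint of `[s, t]`, with
  -- the endpoints exchanged. Reversal turns the last killing point into the first.
  have hc' : Measurable (Function.uncurry fun τ => c (s + t - τ)) :=
    hc.comp (f := fun p : ℝ × Space d => (s + t - p.1, p.2)) (by fun_prop)
  have hβ' : ∫⁻ τ in Ioo s t, β (s + t - τ) ≠ ∞ := by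
    rw [setLIntegral_Ioo_comp_sub_left]; simpa using hβ
  have hcβ' : ∀ᵐ τ ∂volume.restrict (Ioo s t), ∀ᵐ z, c (s + t - τ) z ≤ β (s + t - τ) := by
    rw [ae_restrict_iff' measurableSet_Ioo] at hcβ ⊢
    have := (Measure.measurePreserving_sub_left (volume : Measure ℝ)
      (s + t)).quasiMeasurePreserving.ae hcβ
    filter_upwards [this] with τ hτ hmem
    exact hτ ⟨by linarith [hmem.2], by linarith [hmem.1]⟩
  have h := heatKernel_eq_bridgeKernel_add ha hst hc' hβ' hcβ' x' x
  rw [heatKernel_symm]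
  refine h.trans ?_
  congr 1
  · have := bridgeKernel_reverse (a := a) hst hc (s + t) x x'
    simpa using this
  · have e := setLIntegral_Ioo_comp_sub_left (fun r => ∫⁻ z, bridgeKernel a c s r x z *
        (c r z * ENNReal.ofReal (heatKernel (a * (t - r)) z x'))) (s + t) s t
    rw [add_sub_cancel_right, add_sub_cancel_left] at e
    rw [← e]
    refine setLIntegral_congr_fun measurableSet_Ioo fun r hr => lintegral_congr fun z => ?_
    have h1 := bridgeKernel_reverse (a := a) (s := s) (t := s + t - r) (by linarith [hr.2]) hc
      (s + t) x z
    rw [sub_sub_cancel, add_sub_cancel_left] at h1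
    rw [h1, heatKernel_symm]
    have h2 : t - (s + t - r) = r - s := by ring
    rw [h2]
    ring

end Markov

variable {E : Type*} [MeasurableSpace E]

/-! ### Elementary consequences of the standing assumptions -/

namespace Model

variable (M : Model d E)

lemma measurable_φ_comp_m : Measurable fun y => M.φ (M.m y) := by
  -- Nothing is known about `φ` off `(0, ∞)`, so measurability is obtained by factoring through the
  -- half-line.
  have h : Measurable ((Ioi (0 : ℝ)).domRestrict M.φ) :=
    (continuousOn_iff_continuous_domRestrict.1 M.continuousOn_φ).measurable
  exact h.comp (f := fun y => ⟨M.m y, M.m_pos y⟩) M.measurable_m.subtype_mk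

lemma measurable_w : Measurable M.w :=
  ((M.measurable_a.pow_const _).mul M.measurable_φ_comp_m).ennreal_ofReal

lemma exists_one_le_mul_w : ∃ C : ℝ≥0∞, C ≠ ∞ ∧ ∀ y, 1 ≤ C * M.w y := by
  obtain ⟨ε, hε, h⟩ := M.w_pos
  refine ⟨(ENNReal.ofReal ε)⁻¹, by simpa using hε, fun y => ?_⟩
  rw [← ENNReal.inv_mul_cancel (a := ENNReal.ofReal ε) (by simpa using hε) ENNReal.ofReal_ne_top]
  gcongr
  exact ENNReal.ofReal_le_ofReal (h y)

lemma w_ne_top (y : E) : M.w y ≠ ∞ := ENNReal.ofReal_ne_top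

lemma K_univ_le (y y' : E) : M.K (y, y') univ ≤ M.w y * M.w y' := by
  refine (M.K_le y y').trans ?_
  rw [ENNReal.ofReal_mul (mul_nonneg (Real.rpow_nonneg (M.a_pos y).le _)
    (M.φ_pos _ (M.m_pos y)).le)]
  rfl

lemma isFiniteMeasure_K (q : E × E) : IsFiniteMeasure (M.K q) :=
  ⟨(M.K_univ_le q.1 q.2).trans_lt (ENNReal.mul_lt_top (M.w_ne_top _).lt_top (M.w_ne_top _).lt_top)⟩

instance : IsSFiniteKernel M.K := isSFiniteKernel_of_finite _ M.isFiniteMeasure_K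

/-- The hypothesis says that `φ(r) / r` is nonincreasing. Using it with factors `(r + r') / r` and
`(r + r') / r'` and adding, with weights `r` and `r'`, gives subadditivity. -/
lemma φ_add_le {r r' : ℝ} (hr : 0 < r) (hr' : 0 < r') : M.φ (r + r') ≤ M.φ r + M.φ r' := by
  have h1 := M.φ_sublinear ((r + r') / r) r (by rw [le_div_iff₀ hr]; linarith) hr
  have h2 := M.φ_sublinear ((r + r') / r') r' (by rw [le_div_iff₀ hr']; linarith) hr'
  rw [div_mul_cancel₀ _ hr.ne'] at h1
  rw [div_mul_cancel₀ _ hr'.ne'] at h2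
  have h3 : r * M.φ (r + r') ≤ (r + r') * M.φ r := by
    calc _ ≤ r * ((r + r') / r * M.φ r) := by gcongr
      _ = _ := by field_simp
  have h4 : r' * M.φ (r + r') ≤ (r + r') * M.φ r' := by
    calc _ ≤ r' * ((r + r') / r' * M.φ r') := by gcongr
      _ = _ := by field_simp
  have h5 : (r + r') * M.φ (r + r') ≤ (r + r') * (M.φ r + M.φ r') := by linarith
  exact le_of_mul_le_mul_left h5 (by positivity)

/-- By symmetry of `K` the diffusivity of the product is below those of both parents, so each term
of `φ(m(y)) + φ(m(y'))` can be paired with the diffusivity of its own parent. This is the only way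
the monotonicity of `a` and the sublinearity of `φ` enter. -/
lemma w_le_add (y y' : E) : ∀ᵐ z ∂M.K (y, y'), M.w z ≤ M.w y + M.w y' := by
  have h := M.a_decreasing y' y
  rw [M.K_symm] at h
  filter_upwards [M.K_mass y y', M.a_decreasing y y', h] with z hm ha ha'
  have hd : (0 : ℝ) ≤ (d : ℝ) / 2 := by positivity
  have p1 := (M.φ_pos _ (M.m_pos y)).le
  have p2 := (M.φ_pos _ (M.m_pos y')).le
  rw [w, w, w, ← ENNReal.ofReal_add (mul_nonneg (Real.rpow_nonneg (M.a_pos y).le _) p1)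
    (mul_nonneg (Real.rpow_nonneg (M.a_pos y').le _) p2), hm]
  refine ENNReal.ofReal_le_ofReal ?_
  calc M.a z ^ ((d : ℝ) / 2) * M.φ (M.m y + M.m y')
      ≤ M.a z ^ ((d : ℝ) / 2) * (M.φ (M.m y) + M.φ (M.m y')) :=
        mul_le_mul_of_nonneg_left (M.φ_add_le (M.m_pos y) (M.m_pos y'))
          (Real.rpow_nonneg (M.a_pos z).le _)
    _ = M.a z ^ ((d : ℝ) / 2) * M.φ (M.m y) + M.a z ^ ((d : ℝ) / 2) * M.φ (M.m y') := mul_add _ _ _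
    _ ≤ _ := add_le_add
        (mul_le_mul_of_nonneg_right (Real.rpow_le_rpow (M.a_pos z).le ha hd) p1)
        (mul_le_mul_of_nonneg_right (Real.rpow_le_rpow (M.a_pos z).le ha' hd) p2)

end Model

/-! ### Coagulation as a kernel in time -/

lemma measurable_lossRate (M : Model d E) (κ : Kernel (ℝ × Space d) E) [IsSFiniteKernel κ] :
    Measurable fun p : ℝ × Space d × E => lossRate M κ p.1 p.2.1 p.2.2 := by
  let κ' : Kernel (ℝ × Space d × E) E := κ.comap (fun p => (p.1, p.2.1)) (by fun_prop)
  have h : Measurable (Function.uncurry fun (p : ℝ × Space d × E) (y' : E) =>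
      M.K (p.2.2, y') univ) :=
    (M.K.measurable_coe MeasurableSet.univ).comp (f := fun q : (ℝ × Space d × E) × E =>
      (q.1.2.2, q.2)) (by fun_prop)
  exact Measurable.lintegral_kernel_prod_right (κ := κ') h

/-- The measures `κ_s(x, dy) dx`, as a kernel in `s`. -/
def spaceTime (κ : Kernel (ℝ × Space d) E) : Kernel ℝ (Space d × E) :=
  Kernel.const ℝ (volume : Measure (Space d)) ⊗ₖ κ

/-- The measures `K⁺(μ_s)`, as a kernel in `s`. -/
def gainKernel (M : Model d E) (κ : Kernel (ℝ × Space d) E) : Kernel ℝ (Space d × E) :=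
  Kernel.const ℝ ((2⁻¹ : ℝ≥0∞) • (volume : Measure (Space d))) ⊗ₖ (M.K ∘ₖ (κ ×ₖ κ))

instance (κ : Kernel (ℝ × Space d) E) : IsSFiniteKernel (spaceTime κ) := by
  unfold spaceTime; infer_instance

instance (M : Model d E) (κ : Kernel (ℝ × Space d) E) : IsSFiniteKernel (gainKernel M κ) := by
  unfold gainKernel; infer_instance

lemma spaceTime_apply (κ : Kernel (ℝ × Space d) E) [IsSFiniteKernel κ] (s : ℝ) :
    spaceTime κ s = volume ⊗ₘ κ.sectR s := by
  rw [spaceTime, Kernel.compProd_apply_eq_compProd_sectR, Kernel.const_apply]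

lemma Kplus_eq_gainKernel (M : Model d E) (κ : Kernel (ℝ × Space d) E) [IsSFiniteKernel κ]
    (s : ℝ) : Kplus M κ s = gainKernel M κ s := by
  rw [Kplus, gainKernel, Kernel.compProd_apply_eq_compProd_sectR, Kernel.const_apply,
    Measure.compProd_smul_left]
  congr 2
  ext x A hA
  rw [Kernel.sectR_apply, Kernel.comp_apply, Kernel.comp_apply, Kernel.prod_apply,
    Kernel.prod_apply, Kernel.sectR_apply]

lemma lintegral_spaceTime (κ : Kernel (ℝ × Space d) E) [IsSFiniteKernel κ] (s : ℝ)
    {F : Space d × E → ℝ≥0∞} (hF : Measurable F) :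
    ∫⁻ p, F p ∂spaceTime κ s = ∫⁻ x, ∫⁻ y, F (x, y) ∂κ (s, x) := by
  rw [spaceTime_apply, Measure.lintegral_compProd hF]
  rfl

lemma Kminus_eq (M : Model d E) (κ : Kernel (ℝ × Space d) E) [IsSFiniteKernel κ] (s : ℝ) :
    Kminus M κ s = (spaceTime κ s).withDensity fun q => lossRate M κ s q.1 q.2 := by
  rw [Kminus, spaceTime_apply]

lemma measurable_lossRate_right (M : Model d E) (κ : Kernel (ℝ × Space d) E) [IsSFiniteKernel κ]
    (s : ℝ) : Measurable fun q : Space d × E => lossRate M κ s q.1 q.2 :=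
  (measurable_lossRate M κ).comp measurable_prodMk_left

lemma lintegral_Kminus (M : Model d E) (κ : Kernel (ℝ × Space d) E) [IsSFiniteKernel κ] (s : ℝ)
    {F : Space d × E → ℝ≥0∞} (hF : Measurable F) :
    ∫⁻ p, F p ∂Kminus M κ s = ∫⁻ p, lossRate M κ s p.1 p.2 * F p ∂spaceTime κ s := by
  rw [Kminus_eq, lintegral_withDensity_eq_lintegral_mul _ (measurable_lossRate_right M κ s) hF]
  rfl

lemma lintegral_gainKernel (M : Model d E) (κ : Kernel (ℝ × Space d) E) [IsSFiniteKernel κ] (s : ℝ)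
    {F : Space d × E → ℝ≥0∞} (hF : Measurable F) :
    ∫⁻ p, F p ∂gainKernel M κ s = 2⁻¹ * ∫⁻ x, ∫⁻ y, ∫⁻ y', ∫⁻ z, F (x, z) ∂M.K (y, y')
      ∂κ (s, x) ∂κ (s, x) := by
  rw [gainKernel, Kernel.compProd_apply_eq_compProd_sectR, Measure.lintegral_compProd hF,
    Kernel.const_apply, lintegral_smul_measure, smul_eq_mul]
  congr 1
  refine lintegral_congr fun x => ?_
  have h1 : Measurable fun z => F (x, z) := hF.comp measurable_prodMk_left
  rw [Kernel.sectR_apply, Kernel.lintegral_comp _ _ _ h1, Kernel.prod_apply, lintegral_prod]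
  exact (Measurable.lintegral_kernel_prod_right (κ := M.K) (f := fun _ z => F (x, z))
    (h1.comp measurable_snd)).aemeasurable

/-! ### The action of the propagators on functions -/

/-- The heat semigroup on functions: `(x, y) ↦ ∫ p(a(y) h, x, x') F(x', y) dx'`. -/
def heatFun (M : Model d E) (h : ℝ) (F : Space d × E → ℝ≥0∞) (q : Space d × E) : ℝ≥0∞ :=
  ∫⁻ x', ENNReal.ofReal (heatKernel (M.a q.2 * h) q.1 x') * F (x', q.2)

/-- The propagator on functions: `(x, y) ↦ ∫ p_y(s, x; t, x') F(x', y) dx'`. -/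
def killFun (M : Model d E) (c : ℝ → Space d → E → ℝ≥0∞) (s t : ℝ) (F : Space d × E → ℝ≥0∞)
    (q : Space d × E) : ℝ≥0∞ :=
  ∫⁻ x', killedKernel M c s t q.1 q.2 x' * F (x', q.2)

lemma killedKernel_eq (M : Model d E) (c : ℝ → Space d → E → ℝ≥0∞) (s t : ℝ) (x : Space d) (y : E)
    (x' : Space d) : killedKernel M c s t x y x' =
      bridgeKernel (M.a y) (fun τ z => c τ z y) s t x x' := rfl

section

variable (M : Model d E) {c : ℝ → Space d → E → ℝ≥0∞}

lemma measurable_killedKernel_comp (hc : Measurable fun p : ℝ × Space d × E => c p.1 p.2.1 p.2.2)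
    {X : Type*} [MeasurableSpace X] {s t : X → ℝ} {x x' : X → Space d} {y : X → E}
    (hs : Measurable s) (ht : Measurable t) (hx : Measurable x) (hy : Measurable y)
    (hx' : Measurable x') :
    Measurable fun p => killedKernel M c (s p) (t p) (x p) (y p) (x' p) := by
  simp_rw [killedKernel_eq]
  refine measurable_bridgeKernel_comp (M.measurable_a.comp hy) hs ht hx hx' ?_
  exact hc.comp (f := fun p : X × ℝ × Space d => (p.2.1, p.2.2, y p.1)) (by fun_prop)

lemma measurable_heatFun_comp {X : Type*} [MeasurableSpace X] {h : X → ℝ} {q : X → Space d × E}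
    {F : X → Space d × E → ℝ≥0∞} (hh : Measurable h) (hq : Measurable q)
    (hF : Measurable (Function.uncurry F)) :
    Measurable fun p => heatFun M (h p) (F p) (q p) := by
  unfold heatFun
  refine Measurable.lintegral_prod_right' (f := fun r : X × Space d =>
    ENNReal.ofReal (heatKernel (M.a (q r.1).2 * h r.1) (q r.1).1 r.2) * F r.1 (r.2, (q r.1).2)) ?_
  refine (measurable_heatKernel_comp ?_ ?_ ?_).mul
    (hF.comp (f := fun r : X × Space d => (r.1, r.2, (q r.1).2)) (by fun_prop))
  · exact (M.measurable_a.comp (hq.snd.comp measurable_fst)).mul (hh.comp measurable_fst)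
  · exact hq.fst.comp measurable_fst
  · exact measurable_snd

lemma measurable_killFun_comp (hc : Measurable fun p : ℝ × Space d × E => c p.1 p.2.1 p.2.2)
    {X : Type*} [MeasurableSpace X] {s t : X → ℝ} {q : X → Space d × E}
    {F : X → Space d × E → ℝ≥0∞} (hs : Measurable s) (ht : Measurable t) (hq : Measurable q)
    (hF : Measurable (Function.uncurry F)) :
    Measurable fun p => killFun M c (s p) (t p) (F p) (q p) := by
  unfold killFun
  refine Measurable.lintegral_prod_right' (f := fun r : X × Space d =>
    killedKernel M c (s r.1) (t r.1) (q r.1).1 (q r.1).2 r.2 * F r.1 (r.2, (q r.1).2)) ?_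
  refine (measurable_killedKernel_comp M hc (hs.comp measurable_fst) (ht.comp measurable_fst)
    (hq.fst.comp measurable_fst) (hq.snd.comp measurable_fst) measurable_snd).mul
    (hF.comp (f := fun r : X × Space d => (r.1, r.2, (q r.1).2)) (by fun_prop))

lemma lintegral_heat (t : ℝ) (μ : Measure (Space d × E)) {F : Space d × E → ℝ≥0∞}
    (hF : Measurable F) : ∫⁻ p, F p ∂heat M t μ = ∫⁻ q, heatFun M t F q ∂μ := by
  have h1 : Measurable fun q : (Space d × E) × Space d =>
      ENNReal.ofReal (heatKernel (M.a q.1.2 * t) q.1.1 q.2) :=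
    measurable_heatKernel_comp ((M.measurable_a.comp measurable_fst.snd).mul_const t)
      measurable_fst.fst measurable_snd
  have h2 : Measurable fun q : (Space d × E) × Space d => (q.2, q.1.2) := by fun_prop
  have h3 : Measurable fun q : (Space d × E) × Space d => F (q.2, q.1.2) := hF.comp h2
  rw [heat, lintegral_map hF h2, lintegral_withDensity_eq_lintegral_mul _ h1 h3,
    lintegral_prod _ (h1.mul h3).aemeasurable]
  rfl

lemma lintegral_propagate (hc : Measurable fun p : ℝ × Space d × E => c p.1 p.2.1 p.2.2) {s t : ℝ}
    (hst : s < t) (μ : Measure (Space d × E)) {F : Space d × E → ℝ≥0∞} (hF : Measurable F) :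
    ∫⁻ p, F p ∂propagate M c s t μ = ∫⁻ q, killFun M c s t F q ∂μ := by
  have h1 : Measurable fun q : (Space d × E) × Space d => killedKernel M c s t q.1.1 q.1.2 q.2 :=
    measurable_killedKernel_comp M hc measurable_const measurable_const measurable_fst.fst
      measurable_fst.snd measurable_snd
  have h2 : Measurable fun q : (Space d × E) × Space d => (q.2, q.1.2) := by fun_prop
  have h3 : Measurable fun q : (Space d × E) × Space d => F (q.2, q.1.2) := hF.comp h2
  rw [propagate, if_pos hst, lintegral_map hF h2,
    lintegral_withDensity_eq_lintegral_mul _ h1 h3,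
    lintegral_prod _ (h1.mul h3).aemeasurable]
  rfl

/-- A loss rate which, for each type, is dominated on `(0, t₀)` by an integrable function of
time. -/
def IntegrableRate (c : ℝ → Space d → E → ℝ≥0∞) (t₀ : ℝ) : Prop :=
  ∀ y, ∃ β : ℝ → ℝ≥0∞, ∫⁻ τ in Ioo 0 t₀, β τ ≠ ∞ ∧
    ∀ᵐ τ ∂volume.restrict (Ioo 0 t₀), ∀ᵐ z, c τ z y ≤ β τ

lemma IntegrableRate.mono {Y : Type*} {c : ℝ → Space d → Y → ℝ≥0∞} {t₀ : ℝ} (h : IntegrableRate c t₀) {s t : ℝ} (hs : 0 ≤ s) (ht : t ≤ t₀)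
    (y : Y) : ∃ β : ℝ → ℝ≥0∞, ∫⁻ τ in Ioo s t, β τ ≠ ∞ ∧
      ∀ᵐ τ ∂volume.restrict (Ioo s t), ∀ᵐ z, c τ z y ≤ β τ := by
  obtain ⟨β, h1, h2⟩ := h y
  have hsub : Ioo s t ⊆ Ioo 0 t₀ := Ioo_subset_Ioo hs ht
  exact ⟨β, ne_top_of_le_ne_top h1 (lintegral_mono_set hsub), ae_restrict_of_ae_restrict_of_subset
    hsub h2⟩

/-- Tonelli's theorem for an integral over a time and two positions. -/
lemma lintegral_lintegral_lintegral_mul {X Y Z : Type*} [MeasurableSpace X] [MeasurableSpace Y]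
    [MeasurableSpace Z] (μ : Measure X) (ν : Measure Y) (ρ : Measure Z) [SFinite μ] [SFinite ν]
    [SFinite ρ] {g : X → Y → Z → ℝ≥0∞} (hg : Measurable fun p : X × Y × Z => g p.1 p.2.1 p.2.2)
    {f : X → ℝ≥0∞} (hf : Measurable f) :
    ∫⁻ x, (∫⁻ y, ∫⁻ z, g x y z ∂ρ ∂ν) * f x ∂μ = ∫⁻ y, ∫⁻ z, ∫⁻ x, g x y z * f x ∂μ ∂ρ ∂ν := by
  have h1 : Measurable fun p : (X × Y) × Z => g p.1.1 p.1.2 p.2 :=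
    hg.comp (f := fun p : (X × Y) × Z => (p.1.1, p.1.2, p.2)) (by fun_prop)
  have h2 : Measurable fun p : X × Y => ∫⁻ z, g p.1 p.2 z ∂ρ := h1.lintegral_prod_right'
  have e1 : ∀ x, (∫⁻ y, ∫⁻ z, g x y z ∂ρ ∂ν) * f x = ∫⁻ y, (∫⁻ z, g x y z ∂ρ) * f x ∂ν := fun x => by
    have h3 : Measurable fun y => ∫⁻ z, g x y z ∂ρ := h2.comp measurable_prodMk_left
    rw [lintegral_mul_const _ h3]
  have e2 : ∀ x y, (∫⁻ z, g x y z ∂ρ) * f x = ∫⁻ z, g x y z * f x ∂ρ := fun x y => by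
    have h3 : Measurable fun z => g x y z :=
      hg.comp (f := fun z => (x, y, z)) (by fun_prop)
    rw [lintegral_mul_const _ h3]
  simp_rw [e1, e2]
  have h4 : Measurable fun p : (X × Y) × Z => g p.1.1 p.1.2 p.2 * f p.1.1 :=
    h1.mul (hf.comp measurable_fst.fst)
  rw [lintegral_lintegral_swap (f := fun x y => ∫⁻ z, g x y z * f x ∂ρ)
    h4.lintegral_prod_right'.aemeasurable]
  refine lintegral_congr fun y => lintegral_lintegral_swap ?_
  exact (h4.comp (f := fun p : X × Z => ((p.1, y), p.2)) (by fun_prop)).aemeasurable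

/-- Free motion decomposed at the last killing point: heat flow up to `r`, survival afterwards. This
form converts the mild equation, whose terms carry the free heat flow, into propagator form. -/
lemma heatFun_eq_killFun_add (hc : Measurable fun p : ℝ × Space d × E => c p.1 p.2.1 p.2.2)
    {t₀ : ℝ} (hc₀ : IntegrableRate c t₀) {s t : ℝ} (hs : 0 ≤ s) (hst : s < t) (ht : t ≤ t₀)
    {F : Space d × E → ℝ≥0∞} (hF : Measurable F) (q : Space d × E) :
    heatFun M (t - s) F q = killFun M c s t F q +
      ∫⁻ r in Ioo s t, heatFun M (r - s) (fun p => c r p.1 p.2 * killFun M c r t F p) q := by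
  obtain ⟨x, y⟩ := q
  obtain ⟨β, hβ, hcβ⟩ := hc₀.mono hs ht y
  have hcy : Measurable (Function.uncurry fun τ z => c τ z y) :=
    hc.comp (f := fun p : ℝ × Space d => (p.1, p.2, y)) (by fun_prop)
  have key := heatKernel_eq_bridgeKernel_add (M.a_pos y) hst hcy hβ hcβ x
  have hFy : Measurable fun x' => F (x', y) := hF.comp measurable_prodMk_right
  have hk : Measurable fun x' => killedKernel M c s t x y x' :=
    measurable_killedKernel_comp M hc measurable_const measurable_const measurable_const
      measurable_const measurable_id'
  have hm : Measurable fun p : Space d × ℝ × Space d =>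
      ENNReal.ofReal (heatKernel (M.a y * (p.2.1 - s)) x p.2.2) *
      (c p.2.1 p.2.2 y * bridgeKernel (M.a y) (fun τ z => c τ z y) p.2.1 t p.2.2 p.1) := by
    refine (measurable_heatKernel_comp (by fun_prop) measurable_const measurable_snd.snd).mul
      ((hc.comp (f := fun p : Space d × ℝ × Space d => (p.2.1, p.2.2, y)) (by fun_prop)).mul ?_)
    exact measurable_killedKernel_comp M hc measurable_snd.fst measurable_const measurable_snd.snd
      measurable_const measurable_fst
  simp only [heatFun, killFun]
  simp_rw [key, add_mul]
  have hkF : Measurable fun x' =>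
      bridgeKernel (M.a y) (fun τ z => c τ z y) s t x x' * F (x', y) := hk.mul hFy
  simp_rw [killedKernel_eq]
  rw [lintegral_add_left hkF]
  congr 1
  rw [lintegral_lintegral_lintegral_mul _ _ _ hm hFy]
  refine lintegral_congr fun r => lintegral_congr fun z => ?_
  have hQ : Measurable fun x' =>
      bridgeKernel (M.a y) (fun τ z => c τ z y) r t z x' * F (x', y) :=
    (measurable_killedKernel_comp M hc measurable_const measurable_const measurable_const
      measurable_const measurable_id').mul hFy
  simp_rw [mul_assoc]
  rw [lintegral_const_mul _ (hQ.const_mul _), lintegral_const_mul _ hQ]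

/-- Free motion decomposed at the first killing point: survival up to `r`, heat flow afterwards.
This form serves the weight balance, where the heat flow acts on a function of the type alone and
leaves it fixed. -/
lemma heatFun_eq_killFun_add' (hc : Measurable fun p : ℝ × Space d × E => c p.1 p.2.1 p.2.2)
    {t₀ : ℝ} (hc₀ : IntegrableRate c t₀) {s t : ℝ} (hs : 0 ≤ s) (hst : s < t) (ht : t ≤ t₀)
    {F : Space d × E → ℝ≥0∞} (hF : Measurable F) (q : Space d × E) :
    heatFun M (t - s) F q = killFun M c s t F q +
      ∫⁻ r in Ioo s t, killFun M c s r (fun p => c r p.1 p.2 * heatFun M (t - r) F p) q := by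
  obtain ⟨x, y⟩ := q
  obtain ⟨β, hβ, hcβ⟩ := hc₀.mono hs ht y
  have hcy : Measurable (Function.uncurry fun τ z => c τ z y) :=
    hc.comp (f := fun p : ℝ × Space d => (p.1, p.2, y)) (by fun_prop)
  have key := heatKernel_eq_bridgeKernel_add' (M.a_pos y) hst hcy hβ hcβ x
  have hFy : Measurable fun x' => F (x', y) := hF.comp measurable_prodMk_right
  have hk : Measurable fun x' => killedKernel M c s t x y x' :=
    measurable_killedKernel_comp M hc measurable_const measurable_const measurable_const
      measurable_const measurable_id'
  have hm : Measurable fun p : Space d × ℝ × Space d =>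
      bridgeKernel (M.a y) (fun τ z => c τ z y) s p.2.1 x p.2.2 *
      (c p.2.1 p.2.2 y * ENNReal.ofReal (heatKernel (M.a y * (t - p.2.1)) p.2.2 p.1)) := by
    refine (measurable_killedKernel_comp M hc measurable_const measurable_snd.fst measurable_const
      measurable_const measurable_snd.snd).mul
      ((hc.comp (f := fun p : Space d × ℝ × Space d => (p.2.1, p.2.2, y)) (by fun_prop)).mul ?_)
    exact measurable_heatKernel_comp (by fun_prop) measurable_snd.snd measurable_fst
  simp only [heatFun, killFun]
  simp_rw [key, add_mul]
  have hkF : Measurable fun x' =>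
      bridgeKernel (M.a y) (fun τ z => c τ z y) s t x x' * F (x', y) := hk.mul hFy
  simp_rw [killedKernel_eq]
  rw [lintegral_add_left hkF]
  congr 1
  rw [lintegral_lintegral_lintegral_mul _ _ _ hm hFy]
  refine lintegral_congr fun r => lintegral_congr fun z => ?_
  have hh : Measurable fun x' =>
      ENNReal.ofReal (heatKernel (M.a y * (t - r)) z x') * F (x', y) :=
    (measurable_heatKernel_comp measurable_const measurable_const measurable_id').mul hFy
  simp_rw [mul_assoc]
  rw [lintegral_const_mul _ (hh.const_mul _), lintegral_const_mul _ hh]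

lemma heatFun_comp_snd {h : ℝ} (hh : 0 < h) (f : E → ℝ≥0∞) (q : Space d × E) :
    heatFun M h (fun p => f p.2) q = f q.2 := by
  change ∫⁻ x', ENNReal.ofReal (heatKernel (M.a q.2 * h) q.1 x') * f q.2 = f q.2
  rw [lintegral_mul_const _ (measurable_heatKernel_comp measurable_const measurable_const
    measurable_id'), lintegral_heatKernel (mul_pos (M.a_pos _) hh), one_mul]

lemma heatFun_le_one {h : ℝ} (hh : 0 < h) {F : Space d × E → ℝ≥0∞} (hF : ∀ p, F p ≤ 1)
    (q : Space d × E) : heatFun M h F q ≤ 1 := by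
  rw [← heatFun_comp_snd M hh (fun _ => 1) q]
  exact lintegral_mono fun _ => mul_le_mul_right (hF _) _

end

/-! ### Integration over a triangle -/

lemma lintegral_triangle_swap {h : ℝ → ℝ → ℝ≥0∞} (hh : Measurable (Function.uncurry h)) (t : ℝ) :
    ∫⁻ r in Ioo 0 t, ∫⁻ s in Ioo 0 r, h r s = ∫⁻ s in Ioo 0 t, ∫⁻ r in Ioo s t, h r s := by
  let D : Set (ℝ × ℝ) := {p | 0 < p.2 ∧ p.2 < p.1 ∧ p.1 < t}
  have hD : MeasurableSet D := (measurableSet_lt measurable_const measurable_snd).inter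
    ((measurableSet_lt measurable_snd measurable_fst).inter
      (measurableSet_lt measurable_fst measurable_const))
  have e1 : ∫⁻ r in Ioo 0 t, ∫⁻ s in Ioo 0 r, h r s =
      ∫⁻ r, ∫⁻ s, D.indicator (Function.uncurry h) (r, s) := by
    rw [← lintegral_indicator measurableSet_Ioo]
    refine lintegral_congr fun r => ?_
    by_cases hr : r ∈ Ioo 0 t
    · rw [indicator_of_mem hr, ← lintegral_indicator measurableSet_Ioo]
      refine lintegral_congr fun s => ?_
      by_cases hs : s ∈ Ioo 0 r
      · rw [indicator_of_mem hs, indicator_of_mem (show (r, s) ∈ D from ⟨hs.1, hs.2, hr.2⟩)]; rfl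
      · rw [indicator_of_notMem hs, indicator_of_notMem fun h' : (r, s) ∈ D => hs ⟨h'.1, h'.2.1⟩]
    · rw [indicator_of_notMem hr]
      refine (lintegral_eq_zero_of_ae_eq_zero (ae_of_all _ fun s => ?_)).symm
      exact indicator_of_notMem (fun h' : (r, s) ∈ D => hr ⟨h'.1.trans h'.2.1, h'.2.2⟩) _
  have e2 : ∫⁻ s in Ioo 0 t, ∫⁻ r in Ioo s t, h r s =
      ∫⁻ s, ∫⁻ r, D.indicator (Function.uncurry h) (r, s) := by
    rw [← lintegral_indicator measurableSet_Ioo]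
    refine lintegral_congr fun s => ?_
    by_cases hs : s ∈ Ioo 0 t
    · rw [indicator_of_mem hs, ← lintegral_indicator measurableSet_Ioo]
      refine lintegral_congr fun r => ?_
      by_cases hr : r ∈ Ioo s t
      · rw [indicator_of_mem hr, indicator_of_mem (show (r, s) ∈ D from ⟨hs.1, hr.1, hr.2⟩)]; rfl
      · rw [indicator_of_notMem hr, indicator_of_notMem fun h' : (r, s) ∈ D => hr ⟨h'.2.1, h'.2.2⟩]
    · rw [indicator_of_notMem hs]
      refine (lintegral_eq_zero_of_ae_eq_zero (ae_of_all _ fun r => ?_)).symm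
      exact indicator_of_notMem (fun h' : (r, s) ∈ D => hs ⟨h'.1, h'.2.1.trans h'.2.2⟩) _
  rw [e1, e2]
  exact lintegral_lintegral_swap (f := fun r s => D.indicator (Function.uncurry h) (r, s))
    (hh.indicator hD).aemeasurable

lemma lintegral_triangle_swap_kernel {X : Type*} [MeasurableSpace X] (η : Kernel ℝ X)
    [IsSFiniteKernel η] {G : ℝ → ℝ → X → ℝ≥0∞}
    (hG : Measurable fun p : ℝ × ℝ × X => G p.1 p.2.1 p.2.2) (t : ℝ) :
    ∫⁻ r in Ioo 0 t, ∫⁻ s in Ioo 0 r, ∫⁻ p, G r s p ∂η s =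
      ∫⁻ s in Ioo 0 t, ∫⁻ p, (∫⁻ r in Ioo s t, G r s p) ∂η s := by
  have h1 : Measurable (Function.uncurry fun r s => ∫⁻ p, G r s p ∂η s) := by
    refine Measurable.lintegral_kernel_prod_right (κ := η.comap (fun p : ℝ × ℝ => p.2)
      measurable_snd) (f := fun (p : ℝ × ℝ) x => G p.1 p.2 x) ?_
    exact hG.comp (f := fun q : (ℝ × ℝ) × X => (q.1.1, q.1.2, q.2)) (by fun_prop)
  rw [lintegral_triangle_swap h1]
  refine lintegral_congr fun s => lintegral_lintegral_swap ?_
  exact (hG.comp (f := fun q : ℝ × X => (q.1, s, q.2)) (by fun_prop)).aemeasurable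

/-! ### Densities of processes -/

/-- Two kernels of finite measures with the same integrals over a `σ`-finite measure agree almost
everywhere. -/
lemma ae_eq_of_setLIntegral_eq {X : Type*} [MeasurableSpace X] [StandardBorelSpace E]
    {μ : Measure X} [SigmaFinite μ] {f g : Kernel X E} (hf : ∀ x, IsFiniteMeasure (f x))
    (h : ∀ (B : Set X) (A : Set E), MeasurableSet B → MeasurableSet A →
      ∫⁻ x in B, f x A ∂μ = ∫⁻ x in B, g x A ∂μ) : ∀ᵐ x ∂μ, f x = g x := by
  let C := generateSetAlgebra (MeasurableSpace.countableGeneratingSet E)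
  have hC : C.Countable := countable_generateSetAlgebra
    MeasurableSpace.countable_countableGeneratingSet
  have hgen : ‹MeasurableSpace E› = MeasurableSpace.generateFrom C := by
    rw [generateFrom_generateSetAlgebra_eq, MeasurableSpace.generateFrom_countableGeneratingSet]
  have hCm : ∀ A ∈ C, MeasurableSet A := fun A hA => by
    rw [hgen]; exact MeasurableSpace.measurableSet_generateFrom hA
  have key : ∀ A, MeasurableSet A → ∀ᵐ x ∂μ, f x A = g x A := fun A hA =>
    ae_eq_of_forall_setLIntegral_eq_of_sigmaFinite (f.measurable_coe hA) (g.measurable_coe hA)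
      fun B hB _ => h B A hB hA
  have h1 : ∀ᵐ x ∂μ, ∀ A ∈ C, f x A = g x A := (ae_ball_iff hC).2 fun A hA => key A (hCm A hA)
  filter_upwards [h1, key univ MeasurableSet.univ] with x hx hu
  have := hf x
  exact ext_of_generate_finite C hgen
    (isSetAlgebra_generateSetAlgebra.isSetRing.isSetSemiring.isPiSystem) hx hu

section Density

variable {T : ℝ≥0∞} {μ ν : ℝ → Measure (Space d × E)} {κ κ' : Kernel (ℝ × Space d) E}

lemma IsDensity.isSFiniteKernel (h : IsDensity T μ κ) : IsSFiniteKernel κ :=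
  isSFiniteKernel_of_finite κ h.finite

lemma IsDensity.eq_spaceTime (h : IsDensity T μ κ) (hμ : IsProcess T μ) {t : ℝ}
    (ht : t ∈ timeDomain T) : μ t = spaceTime κ t := by
  have := h.isSFiniteKernel
  have := hμ.finite t ht
  refine Measure.ext_prod fun {B A} hB hA => ?_
  rw [h.eq_lintegral t ht B A hB hA, ← lintegral_indicator_one (hB.prod hA),
    lintegral_spaceTime κ t (measurable_one.indicator (hB.prod hA)), ← lintegral_indicator hB]
  refine lintegral_congr fun x => ?_
  by_cases hx : x ∈ B
  · rw [indicator_of_mem hx, ← lintegral_indicator_one hA]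
    refine lintegral_congr fun y => ?_
    by_cases hy : y ∈ A <;> simp [indicator, hx, hy]
  · rw [indicator_of_notMem hx]
    simp [indicator, hx]

/-- A family of measures which lies below a process is itself a process if it is measurable. -/
lemma IsProcess.of_le (hμ : IsProcess T μ) (hle : ∀ t ∈ timeDomain T, ν t ≤ μ t)
    (hν : ∀ S : Set (Space d × E), MeasurableSet S → Measurable fun t : timeDomain T => ν t S) :
    IsProcess T ν where
  finite t ht := by
    have := hμ.finite t ht
    exact isFiniteMeasure_of_le (μ t) (hle t ht)
  absolutelyContinuous t ht :=
    ((Measure.map_mono (hle t ht) measurable_fst).absolutelyContinuous).trans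
      (hμ.absolutelyContinuous t ht)
  measurable B A hB hA := hν _ (hB.prod hA)

lemma IsProcess.measurable_apply (hμ : IsProcess T μ) {S : Set (Space d × E)}
    (hS : MeasurableSet S) : Measurable fun t : timeDomain T => μ t S := by
  have hfin : ∀ t : timeDomain T, IsFiniteMeasure (μ t) := fun t => hμ.finite t t.2
  have hmeas : Measurable fun t : timeDomain T => μ t := by
    refine Measurable.measure_of_isPiSystem generateFrom_prod.symm isPiSystem_prod ?_ ?_
    · rintro _ ⟨B, hB, A, hA, rfl⟩
      exact hμ.measurable B A hB hA
    · rw [← univ_prod_univ]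
      exact hμ.measurable _ _ MeasurableSet.univ MeasurableSet.univ
  exact Measure.measurable_measure.1 hmeas S hS

/-- The difference `μ - ν` is again a process and so has its own density. By almost everywhere
uniqueness, the density of `μ` is that of `ν` plus that of the difference. -/
lemma IsDensity.ae_le [StandardBorelSpace E] (hν : IsProcess T ν) (hμ : IsProcess T μ)
    (hκ : IsDensity T ν κ) (hκ' : IsDensity T μ κ') (hle : ∀ t ∈ timeDomain T, ν t ≤ μ t) {t : ℝ}
    (ht : t ∈ timeDomain T) : ∀ᵐ x, κ (t, x) ≤ κ' (t, x) := by
  have := hκ.isSFiniteKernel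
  have := hκ'.isSFiniteKernel
  have hsub : ∀ s ∈ timeDomain T, ∀ S, MeasurableSet S → (μ s - ν s) S = μ s S - ν s S :=
    fun s hs S hS => by
      have := hν.finite s hs
      exact Measure.sub_apply hS (hle s hs)
  have hδ : IsProcess T fun s => μ s - ν s := by
    refine hμ.of_le (fun s _ => Measure.sub_le) fun S hS => ?_
    simp_rw [hsub _ (Subtype.coe_prop _) S hS]
    exact (hμ.measurable_apply hS).sub (hν.measurable_apply hS)
  obtain ⟨κδ, hκδ⟩ := exists_isDensity hδ
  have := hκδ.isSFiniteKernel
  have key : ∀ᵐ x, κ'.sectR t x = (κ.sectR t + κδ.sectR t) x := by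
    refine ae_eq_of_setLIntegral_eq (fun x => hκ'.finite (t, x)) fun B A hB hA => ?_
    have e : ∀ x, (κ.sectR t + κδ.sectR t) x A = κ (t, x) A + κδ (t, x) A := fun x => rfl
    simp_rw [e]
    have hm : Measurable fun x => κ (t, x) A := (κ.measurable_coe hA).comp measurable_prodMk_left
    rw [lintegral_add_left hm, ← hκ.eq_lintegral t ht B A hB hA, ← hκδ.eq_lintegral t ht B A hB hA,
      hsub t ht _ (hB.prod hA), add_tsub_cancel_of_le (hle t ht _)]
    exact (hκ'.eq_lintegral t ht B A hB hA).symm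
  filter_upwards [key] with x hx
  change κ'.sectR t x = κ (t, x) + κδ (t, x) at hx
  rw [Kernel.sectR_apply] at hx
  rw [hx]
  exact Measure.le_add_right le_rfl

lemma gainKernel_le (M : Model d E) [IsSFiniteKernel κ] [IsSFiniteKernel κ'] {t : ℝ}
    (h : ∀ᵐ x, κ (t, x) ≤ κ' (t, x)) : gainKernel M κ t ≤ gainKernel M κ' t := by
  refine Measure.le_iff.2 fun S hS => ?_
  rw [← lintegral_indicator_one hS, ← lintegral_indicator_one hS,
    lintegral_gainKernel M κ t (measurable_one.indicator hS),
    lintegral_gainKernel M κ' t (measurable_one.indicator hS)]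
  gcongr 2⁻¹ * ?_
  refine lintegral_mono_ae ?_
  filter_upwards [h] with x hx
  exact lintegral_mono' hx fun y => lintegral_mono' hx le_rfl

end Density

/-! ### Moments of densities -/

section Moment

variable (M : Model d E) (κ : Kernel (ℝ × Space d) E)

/-- `‖⟨w², μ_s⟩‖_∞`. -/
def supMoment (s : ℝ) : ℝ≥0∞ :=
  essSup (fun x => ∫⁻ y, M.w y ^ 2 ∂κ (s, x)) volume

/-- `⟨w, μ_s⟩`, integrated over space. -/
def weight (s : ℝ) : ℝ≥0∞ := ∫⁻ p, M.w p.2 ∂spaceTime κ s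

/-- An essential supremum is at most `q` exactly when the slice on which the function exceeds `q` is
null, and the measure of a slice depends measurably on the time. -/
lemma measurable_supMoment : Measurable (supMoment M κ) := by
  have hf : Measurable fun p : ℝ × Space d => ∫⁻ y, M.w y ^ 2 ∂κ p :=
    (M.measurable_w.pow_const 2).lintegral_kernel
  refine measurable_of_Iic fun q => ?_
  have e : supMoment M κ ⁻¹' Iic q =
      {s | volume (Prod.mk s ⁻¹' {p : ℝ × Space d | q < ∫⁻ y, M.w y ^ 2 ∂κ p}) = 0} := by
    ext s
    rw [mem_preimage, mem_Iic, mem_ofPred_eq, supMoment]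
    have h : volume (Prod.mk s ⁻¹' {p : ℝ × Space d | q < ∫⁻ y, M.w y ^ 2 ∂κ p}) = 0 ↔
        ∀ᵐ x, ∫⁻ y, M.w y ^ 2 ∂κ (s, x) ≤ q := by
      rw [ae_iff]
      simp only [not_le]
      rfl
    rw [h]
    refine ⟨fun h => ?_, fun h => essSup_le_of_ae_le q h⟩
    filter_upwards [ENNReal.ae_le_essSup fun x => ∫⁻ y, M.w y ^ 2 ∂κ (s, x)] with x hx
    exact hx.trans h
  rw [e]
  exact measurable_measure_prodMk_left (measurableSet_lt measurable_const hf)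
    (measurableSet_singleton 0)

lemma measurable_weight : Measurable (weight M κ) :=
  (M.measurable_w.comp measurable_snd).lintegral_kernel

lemma ae_lintegral_w_sq_le (s : ℝ) : ∀ᵐ x, ∫⁻ y, M.w y ^ 2 ∂κ (s, x) ≤ supMoment M κ s :=
  ENNReal.ae_le_essSup _

lemma lossRate_le (s : ℝ) (x : Space d) (y : E) :
    lossRate M κ s x y ≤ M.w y * ∫⁻ y', M.w y' ∂κ (s, x) := by
  rw [← lintegral_const_mul _ M.measurable_w]
  exact lintegral_mono fun y' => M.K_univ_le y y'

variable {M κ} in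
lemma lintegral_w_le {C : ℝ≥0∞} (hC : ∀ y, 1 ≤ C * M.w y) (p : ℝ × Space d) :
    ∫⁻ y, M.w y ∂κ p ≤ C * ∫⁻ y, M.w y ^ 2 ∂κ p := by
  rw [← lintegral_const_mul _ (M.measurable_w.pow_const 2)]
  refine lintegral_mono fun y => ?_
  calc M.w y = 1 * M.w y := (one_mul _).symm
    _ ≤ C * M.w y * M.w y := by gcongr; exact hC y
    _ = C * M.w y ^ 2 := by ring

/-- From `K ≤ w w'` and `1 ≤ C w`, the rate is at most `C w(y)` times the second moment, for almost
every position. The factor `w(y)` may be unbounded, hence a separate dominating function for each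
type in `IntegrableRate`. -/
lemma integrableRate_lossRate {t : ℝ} (h : ∫⁻ s in Ioo 0 t, supMoment M κ s ≠ ∞) :
    IntegrableRate (lossRate M κ) t := by
  obtain ⟨C, hC, hC1⟩ := M.exists_one_le_mul_w
  intro y
  refine ⟨fun τ => M.w y * C * supMoment M κ τ, ?_, ae_of_all _ fun τ => ?_⟩
  · rw [lintegral_const_mul' _ _ (ENNReal.mul_ne_top (M.w_ne_top y) hC)]
    exact ENNReal.mul_ne_top (ENNReal.mul_ne_top (M.w_ne_top y) hC) h
  · filter_upwards [ae_lintegral_w_sq_le M κ τ] with x hx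
    refine (lossRate_le M κ τ x y).trans ?_
    rw [mul_assoc]
    gcongr
    exact (lintegral_w_le hC1 _).trans (by gcongr)

variable [IsSFiniteKernel κ]

/-- The rate at which mass, weighted by `w`, is lost from the process `ν` with density `κ'`
to the process with density `κ`. -/
def weightedLoss (κ' : Kernel (ℝ × Space d) E) (s : ℝ) : ℝ≥0∞ :=
  ∫⁻ p, lossRate M κ s p.1 p.2 * M.w p.2 ∂spaceTime κ' s

lemma measurable_weightedLoss (κ' : Kernel (ℝ × Space d) E) :
    Measurable (weightedLoss M κ κ') := by
  refine Measurable.lintegral_kernel_prod_right (κ := spaceTime κ')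
    (f := fun s (p : Space d × E) => lossRate M κ s p.1 p.2 * M.w p.2) ?_
  exact (measurable_lossRate M κ).mul (M.measurable_w.comp measurable_snd.snd)

lemma weightedLoss_le (s : ℝ) : weightedLoss M κ κ s ≤ supMoment M κ s * weight M κ s := by
  have hw : Measurable fun p : Space d × E => M.w p.2 := M.measurable_w.comp measurable_snd
  have hl : Measurable fun p : Space d × E => lossRate M κ s p.1 p.2 * M.w p.2 :=
    (measurable_lossRate_right M κ s).mul hw
  have hx : Measurable fun x => ∫⁻ y, M.w y ∂κ (s, x) :=
    (Measurable.lintegral_kernel (κ := κ) M.measurable_w).comp measurable_prodMk_left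
  rw [weightedLoss, weight, lintegral_spaceTime κ s hl, lintegral_spaceTime κ s hw,
    ← lintegral_const_mul _ hx]
  refine lintegral_mono_ae ?_
  filter_upwards [ae_lintegral_w_sq_le M κ s] with x h
  calc ∫⁻ y, lossRate M κ s x y * M.w y ∂κ (s, x)
      ≤ ∫⁻ y, M.w y ^ 2 * ∫⁻ y', M.w y' ∂κ (s, x) ∂κ (s, x) := by
        refine lintegral_mono fun y => ?_
        calc _ ≤ (M.w y * ∫⁻ y', M.w y' ∂κ (s, x)) * M.w y := by
              gcongr; exact lossRate_le M κ s x y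
          _ = _ := by ring
    _ = (∫⁻ y, M.w y ^ 2 ∂κ (s, x)) * ∫⁻ y', M.w y' ∂κ (s, x) :=
        lintegral_mul_const _ (M.measurable_w.pow_const 2)
    _ ≤ _ := by gcongr

lemma Kminus_univ_le {C : ℝ≥0∞} (hC : ∀ y, 1 ≤ C * M.w y) (s : ℝ) :
    Kminus M κ s univ ≤ C * weightedLoss M κ κ s := by
  have hw : Measurable fun p : Space d × E => M.w p.2 := M.measurable_w.comp measurable_snd
  have hl : Measurable fun p : Space d × E => lossRate M κ s p.1 p.2 * M.w p.2 :=
    (measurable_lossRate_right M κ s).mul hw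
  rw [← lintegral_one, lintegral_Kminus M κ s measurable_const, weightedLoss,
    ← lintegral_const_mul _ hl]
  refine lintegral_mono fun p => ?_
  calc _ ≤ lossRate M κ s p.1 p.2 * (C * M.w p.2) := by gcongr; exact hC _
    _ = _ := by ring

end Moment

/-! ### From the mild equation to the propagators -/

/-- An equation between measures on all measurable sets, with mixtures, holds for all integrals. -/
lemma lintegral_add_eq_of_forall_measurableSet {X Y : Type*} [MeasurableSpace X] [MeasurableSpace Y]
    {ρ : Measure Y} {a b : Y → Measure X} (ha : Measurable a) (hb : Measurable b) {A B : Measure X}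
    (h : ∀ S, MeasurableSet S → A S + ∫⁻ s, a s S ∂ρ = B S + ∫⁻ s, b s S ∂ρ)
    {F : X → ℝ≥0∞} (hF : Measurable F) :
    ∫⁻ x, F x ∂A + ∫⁻ s, ∫⁻ x, F x ∂a s ∂ρ = ∫⁻ x, F x ∂B + ∫⁻ s, ∫⁻ x, F x ∂b s ∂ρ := by
  have e : A + ρ.bind a = B + ρ.bind b := by
    ext S hS
    rw [Measure.add_apply, Measure.add_apply, Measure.bind_apply hS ha.aemeasurable,
      Measure.bind_apply hS hb.aemeasurable, h S hS]
  rw [← Measure.lintegral_bind ha.aemeasurable hF.aemeasurable,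
    ← Measure.lintegral_bind hb.aemeasurable hF.aemeasurable, ← lintegral_add_measure, e,
    lintegral_add_measure]

section

variable (M : Model d E) {c : ℝ → Space d → E → ℝ≥0∞}

lemma measurable_heatFun (h : ℝ) {F : Space d × E → ℝ≥0∞} (hF : Measurable F) :
    Measurable (heatFun M h F) :=
  measurable_heatFun_comp M (F := fun _ => F) measurable_const measurable_id
    (hF.comp measurable_snd)

lemma measurable_killFun (hc : Measurable fun p : ℝ × Space d × E => c p.1 p.2.1 p.2.2) (s t : ℝ)
    {F : Space d × E → ℝ≥0∞} (hF : Measurable F) : Measurable (killFun M c s t F) :=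
  measurable_killFun_comp M hc (F := fun _ => F) measurable_const measurable_const measurable_id
    (hF.comp measurable_snd)

lemma measurable_heat_kernel (η : Kernel ℝ (Space d × E)) [IsSFiniteKernel η] (t : ℝ) :
    Measurable fun s => heat M (t - s) (η s) := by
  refine Measure.measurable_of_measurable_coe _ fun S hS => ?_
  simp_rw [← lintegral_indicator_one hS, lintegral_heat M _ _ (measurable_one.indicator hS)]
  refine Measurable.lintegral_kernel_prod_right (κ := η)
    (f := fun s p => heatFun M (t - s) (S.indicator 1) p) ?_
  exact measurable_heatFun_comp M (F := fun _ => S.indicator 1) (by fun_prop) measurable_snd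
    ((measurable_one.indicator hS).comp measurable_snd)

lemma measurable_heat_Kminus (κ : Kernel (ℝ × Space d) E) [IsSFiniteKernel κ] (t : ℝ) :
    Measurable fun s => heat M (t - s) (Kminus M κ s) := by
  refine Measure.measurable_of_measurable_coe _ fun S hS => ?_
  have hf : Measurable (S.indicator (1 : Space d × E → ℝ≥0∞)) := measurable_one.indicator hS
  have hF : Measurable fun p : ℝ × Space d × E => heatFun M (t - p.1) (S.indicator 1) p.2 :=
    measurable_heatFun_comp M (F := fun _ => S.indicator 1) (by fun_prop) measurable_snd
      (hf.comp measurable_snd)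
  have e : ∀ s, heat M (t - s) (Kminus M κ s) S =
      ∫⁻ p, lossRate M κ s p.1 p.2 * heatFun M (t - s) (S.indicator 1) p ∂spaceTime κ s := by
    intro s
    rw [← lintegral_indicator_one hS, lintegral_heat M _ _ hf,
      lintegral_Kminus M κ s (measurable_heatFun M _ hf)]
  simp_rw [e]
  exact Measurable.lintegral_kernel_prod_right (κ := spaceTime κ)
    (f := fun s (p : Space d × E) => lossRate M κ s p.1 p.2 * heatFun M (t - s) (S.indicator 1) p)
    ((measurable_lossRate M κ).mul hF)

lemma measurable_propagate_kernel (hc : Measurable fun p : ℝ × Space d × E => c p.1 p.2.1 p.2.2)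
    (η : Kernel ℝ (Space d × E)) [IsSFiniteKernel η] :
    Measurable fun p : ℝ × ℝ => propagate M c p.1 p.2 (η p.1) := by
  refine Measure.measurable_of_measurable_coe _ fun S hS => ?_
  have hf : Measurable (S.indicator (1 : Space d × E → ℝ≥0∞)) := measurable_one.indicator hS
  have e : ∀ p : ℝ × ℝ, propagate M c p.1 p.2 (η p.1) S =
      if p.1 < p.2 then ∫⁻ q, killFun M c p.1 p.2 (S.indicator 1) q ∂η p.1 else η p.1 S := by
    intro p
    split_ifs with h
    · rw [← lintegral_indicator_one hS, lintegral_propagate M hc h _ hf]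
    · rw [propagate, if_neg h]
  simp_rw [e]
  refine Measurable.ite (measurableSet_lt measurable_fst measurable_snd) ?_
    ((η.measurable_coe hS).comp measurable_fst)
  refine Measurable.lintegral_kernel_prod_right (κ := η.comap (fun p : ℝ × ℝ => p.1) measurable_fst)
    (f := fun (p : ℝ × ℝ) q => killFun M c p.1 p.2 (S.indicator 1) q) ?_
  exact measurable_killFun_comp M hc (F := fun _ => S.indicator 1) (by fun_prop) (by fun_prop)
    measurable_snd (hf.comp measurable_snd)

lemma propagate_apply (hc : Measurable fun p : ℝ × Space d × E => c p.1 p.2.1 p.2.2) {s t : ℝ}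
    (hst : s < t) (μ : Measure (Space d × E)) {S : Set (Space d × E)} (hS : MeasurableSet S) :
    propagate M c s t μ S = ∫⁻ q, killFun M c s t (S.indicator 1) q ∂μ := by
  rw [← lintegral_indicator_one hS, lintegral_propagate M hc hst _ (measurable_one.indicator hS)]

lemma propagate_mono (hc : Measurable fun p : ℝ × Space d × E => c p.1 p.2.1 p.2.2) (s t : ℝ)
    {μ ν : Measure (Space d × E)} (h : μ ≤ ν) : propagate M c s t μ ≤ propagate M c s t ν := by
  by_cases hst : s < t
  · refine Measure.le_iff.2 fun S hS => ?_
    rw [propagate_apply M hc hst _ hS, propagate_apply M hc hst _ hS]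
    exact lintegral_mono' h le_rfl
  · rwa [propagate, propagate, if_neg hst, if_neg hst]

end

namespace IsStrongSolution

variable {M : Model d E} {T : ℝ≥0∞} {μ : ℝ → Measure (Space d × E)}

lemma zero_mem_timeDomain {t : ℝ} (ht : t ∈ timeDomain T) : (0 : ℝ) ∈ timeDomain T :=
  ⟨le_rfl, (ENNReal.ofReal_le_ofReal ht.1).trans_lt ht.2⟩

lemma mem_timeDomain_of_le {s t : ℝ} (ht : t ∈ timeDomain T) (hs : 0 ≤ s) (hst : s ≤ t) :
    s ∈ timeDomain T :=
  ⟨hs, (ENNReal.ofReal_le_ofReal hst).trans_lt ht.2⟩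

lemma integrableRate (hμ : IsStrongSolution M T μ) {t : ℝ} (ht : t ∈ timeDomain T) :
    IntegrableRate (lossRate M (density T μ)) t :=
  integrableRate_lossRate M _ (hμ.moment_two t ht).ne

variable [StandardBorelSpace E] (hμ : IsStrongSolution M T μ)
include hμ

lemma isSFiniteKernel : IsSFiniteKernel (density T μ) :=
  (isDensity_density hμ.process).isSFiniteKernel

lemma measurable_rate :
    Measurable fun p : ℝ × Space d × E => lossRate M (density T μ) p.1 p.2.1 p.2.2 := by
  have := hμ.isSFiniteKernel
  exact measurable_lossRate M _

lemma weight_eq {t : ℝ} (ht : t ∈ timeDomain T) :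
    weight M (density T μ) t = ∫⁻ q, M.w q.2 ∂μ t := by
  rw [weight, (isDensity_density hμ.process).eq_spaceTime hμ.process ht]

lemma exists_weight_le {t : ℝ} (ht : t ∈ timeDomain T) :
    ∃ C : ℝ≥0∞, C ≠ ∞ ∧ ∀ s ∈ Icc 0 t, weight M (density T μ) s ≤ C := by
  refine ⟨_, (hμ.moment_one t ht).ne, fun s hs => ?_⟩
  rw [hμ.weight_eq (mem_timeDomain_of_le ht hs.1 hs.2)]
  exact le_iSup₂ (f := fun s (_ : s ∈ Icc 0 t) => ∫⁻ q, M.w q.2 ∂μ s) s hs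

lemma lintegral_supMoment_mul_weight_ne_top {t : ℝ} (ht : t ∈ timeDomain T) :
    ∫⁻ s in Ioo 0 t, supMoment M (density T μ) s * weight M (density T μ) s ≠ ∞ := by
  obtain ⟨C, hC, h⟩ := hμ.exists_weight_le ht
  have h2 : ∫⁻ s in Ioo 0 t, supMoment M (density T μ) s * C ≠ ∞ := by
    rw [lintegral_mul_const' _ _ hC]
    exact ENNReal.mul_ne_top (hμ.moment_two t ht).ne hC
  refine ne_top_of_le_ne_top h2 (setLIntegral_mono' measurableSet_Ioo fun s hs => ?_)
  gcongr
  exact h s (Ioo_subset_Icc_self hs)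

lemma lintegral_weightedLoss_ne_top {t : ℝ} (ht : t ∈ timeDomain T) :
    ∫⁻ s in Ioo 0 t, weightedLoss M (density T μ) (density T μ) s ≠ ∞ := by
  have := hμ.isSFiniteKernel
  exact ne_top_of_le_ne_top (hμ.lintegral_supMoment_mul_weight_ne_top ht)
    (lintegral_mono fun s => weightedLoss_le M _ s)

/-- The mild equation, tested with functions. -/
lemma lintegral_equation {t : ℝ} (ht : t ∈ timeDomain T) (ht0 : 0 < t) {F : Space d × E → ℝ≥0∞}
    (hF : Measurable F) :
    ∫⁻ p, F p ∂μ t + ∫⁻ s in Ioo 0 t, ∫⁻ p, lossRate M (density T μ) s p.1 p.2 *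
        heatFun M (t - s) F p ∂spaceTime (density T μ) s =
      ∫⁻ p, heatFun M t F p ∂μ 0 + ∫⁻ s in Ioo 0 t, ∫⁻ p, heatFun M (t - s) F p
        ∂gainKernel M (density T μ) s := by
  have := hμ.isSFiniteKernel
  have h1 := hμ.equation t ht ht0
  simp_rw [Kplus_eq_gainKernel] at h1
  have h2 := lintegral_add_eq_of_forall_measurableSet (ρ := volume.restrict (Ioo 0 t))
    (measurable_heat_Kminus M (density T μ) t)
    (measurable_heat_kernel M (gainKernel M (density T μ)) t) h1 hF
  simp_rw [lintegral_heat M _ _ hF, lintegral_Kminus M _ _ (measurable_heatFun M _ hF)] at h2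
  exact h2

/-- A strong solution solves the propagator form of the equation. -/
lemma apply_eq_lintegral_killFun {t : ℝ} (ht : t ∈ timeDomain T) (ht0 : 0 < t)
    {S : Set (Space d × E)} (hS : MeasurableSet S) :
    μ t S = ∫⁻ p, killFun M (lossRate M (density T μ)) 0 t (S.indicator 1) p ∂μ 0 +
      ∫⁻ s in Ioo 0 t, ∫⁻ p, killFun M (lossRate M (density T μ)) s t (S.indicator 1) p
        ∂gainKernel M (density T μ) s := by
  have := hμ.isSFiniteKernel
  have := hμ.process.finite 0 (zero_mem_timeDomain ht)
  have hc := hμ.measurable_rate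
  have hrate := hμ.integrableRate ht
  set κ := density T μ with hκ
  set c := lossRate M κ with hcdef
  have hf : Measurable (S.indicator (1 : Space d × E → ℝ≥0∞)) := measurable_one.indicator hS
  -- `U r` is the killed flow of the test function from `r` to the final time, `F r` its product
  -- with the rate, and `Z s` the part of the free flow from time `s` that killing removes, so that
  -- the free flow is `U s + Z s`.
  let U : ℝ → Space d × E → ℝ≥0∞ := fun r => killFun M c r t (S.indicator 1)
  let F : ℝ → Space d × E → ℝ≥0∞ := fun r p => c r p.1 p.2 * U r p
  let Z : ℝ → Space d × E → ℝ≥0∞ := fun s p => ∫⁻ r in Ioo s t, heatFun M (r - s) (F r) p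
  have hU : Measurable fun p : ℝ × Space d × E => U p.1 p.2 :=
    measurable_killFun_comp M hc (F := fun _ => S.indicator 1) measurable_fst measurable_const
      measurable_snd (hf.comp measurable_snd)
  have hF : Measurable fun p : ℝ × Space d × E => F p.1 p.2 := hc.mul hU
  have hH : Measurable fun p : ℝ × ℝ × Space d × E => heatFun M (p.1 - p.2.1) (F p.1) p.2.2 :=
    measurable_heatFun_comp M (h := fun p : ℝ × ℝ × Space d × E => p.1 - p.2.1)
      (F := fun p => F p.1) (by fun_prop) measurable_snd.snd
      (hF.comp (f := fun q : (ℝ × ℝ × Space d × E) × Space d × E => (q.1.1, q.2)) (by fun_prop))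
  have hZ : Measurable fun p : ℝ × Space d × E => Z p.1 p.2 :=
    measurable_setLIntegral_Ioo (f := fun (p : ℝ × Space d × E) r => heatFun M (r - p.1) (F r) p.2)
      measurable_fst measurable_const
      (hH.comp (f := fun q : (ℝ × Space d × E) × ℝ => (q.2, q.1.1, q.1.2)) (by fun_prop))
  have hUs : ∀ s, Measurable (U s) := fun s => measurable_killFun M hc s t hf
  have hcs : ∀ s, Measurable fun p : Space d × E => c s p.1 p.2 :=
    measurable_lossRate_right M κ
  have hZs : ∀ s, Measurable (Z s) := fun s =>
    hZ.comp (f := fun p : Space d × E => (s, p)) (by fun_prop)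
  have duhamel : ∀ s, 0 ≤ s → s < t → ∀ p, heatFun M (t - s) (S.indicator 1) p = U s p + Z s p :=
    fun s hs hst p => heatFun_eq_killFun_add M hc hrate hs hst le_rfl hf p
  -- the mild equation at the time `r`, integrated over `r`
  have e1 : ∀ r ∈ Ioo 0 t, ∫⁻ p, c r p.1 p.2 * U r p ∂spaceTime κ r +
      ∫⁻ s in Ioo 0 r, ∫⁻ p, c s p.1 p.2 * heatFun M (r - s) (F r) p ∂spaceTime κ s =
      ∫⁻ p, heatFun M r (F r) p ∂μ 0 +
        ∫⁻ s in Ioo 0 r, ∫⁻ p, heatFun M (r - s) (F r) p ∂gainKernel M κ s := by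
    intro r hr
    have hrT := mem_timeDomain_of_le ht hr.1.le hr.2.le
    have hFr : Measurable (F r) := (hcs r).mul (hUs r)
    rw [← hμ.lintegral_equation hrT hr.1 hFr, (isDensity_density hμ.process).eq_spaceTime hμ.process hrT]
  have e2 := setLIntegral_congr_fun (μ := volume) measurableSet_Ioo e1
  have hcU : Measurable fun r => ∫⁻ p, c r p.1 p.2 * U r p ∂spaceTime κ r :=
    Measurable.lintegral_kernel_prod_right (κ := spaceTime κ)
      (f := fun r (p : Space d × E) => c r p.1 p.2 * U r p) (hc.mul hU)
  have hH0 : Measurable fun p : ℝ × Space d × E => heatFun M p.1 (F p.1) p.2 :=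
    measurable_heatFun_comp M (h := fun p : ℝ × Space d × E => p.1)
      (F := fun p => F p.1) (by fun_prop) measurable_snd
      (hF.comp (f := fun q : (ℝ × Space d × E) × Space d × E => (q.1.1, q.2)) (by fun_prop))
  have hμ0 : Measurable fun r => ∫⁻ p, heatFun M r (F r) p ∂μ 0 := hH0.lintegral_prod_right'
  rw [lintegral_add_left hcU, lintegral_add_left hμ0,
    lintegral_triangle_swap_kernel (spaceTime κ)
      (G := fun r s (p : Space d × E) => c s p.1 p.2 * heatFun M (r - s) (F r) p)
      ((hc.comp (f := fun p : ℝ × ℝ × Space d × E => p.2) (by fun_prop)).mul hH),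
    lintegral_triangle_swap_kernel (gainKernel M κ)
      (G := fun r s (p : Space d × E) => heatFun M (r - s) (F r) p) hH,
    lintegral_lintegral_swap (f := fun r p => heatFun M r (F r) p) hH0.aemeasurable] at e2
  have e3 : ∀ s p, ∫⁻ r in Ioo s t, c s p.1 p.2 * heatFun M (r - s) (F r) p = c s p.1 p.2 * Z s p :=
    fun s p => lintegral_const_mul _
      (hH.comp (f := fun r : ℝ => (r, s, p)) (by fun_prop))
  simp_rw [e3] at e2
  have e4 : ∀ p, ∫⁻ r in Ioo 0 t, heatFun M r (F r) p = Z 0 p := fun p => by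
    simp only [Z, sub_zero]
  simp_rw [e4] at e2
  change _ = _ + ∫⁻ s in Ioo 0 t, ∫⁻ p, Z s p ∂gainKernel M κ s at e2
  -- the loss term of the mild equation at the time `t`
  have e5 : ∫⁻ s in Ioo 0 t, ∫⁻ p, c s p.1 p.2 * heatFun M (t - s) (S.indicator 1) p
        ∂spaceTime κ s =
      (∫⁻ r in Ioo 0 t, ∫⁻ p, c r p.1 p.2 * U r p ∂spaceTime κ r) +
        ∫⁻ s in Ioo 0 t, ∫⁻ p, c s p.1 p.2 * Z s p ∂spaceTime κ s := by
    rw [← lintegral_add_left hcU]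
    refine setLIntegral_congr_fun measurableSet_Ioo fun s hs => ?_
    have hcUs : Measurable fun p : Space d × E => c s p.1 p.2 * U s p := (hcs s).mul (hUs s)
    rw [← lintegral_add_left hcUs]
    refine lintegral_congr fun p => ?_
    rw [duhamel s hs.1.le hs.2, mul_add]
  -- Subtraction in `ℝ≥0∞` requires a finite quantity. The heat flow of an indicator is at most `1`,
  -- so this term is bounded by the total loss, which the moment conditions control.
  have hfin : ∫⁻ s in Ioo 0 t, ∫⁻ p, c s p.1 p.2 * heatFun M (t - s) (S.indicator 1) p
      ∂spaceTime κ s ≠ ∞ := by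
    obtain ⟨C, hC, hC1⟩ := M.exists_one_le_mul_w
    have h1 : ∫⁻ s in Ioo 0 t, C * weightedLoss M κ κ s ≠ ∞ := by
      rw [lintegral_const_mul' _ _ hC]
      exact ENNReal.mul_ne_top hC (hμ.lintegral_weightedLoss_ne_top ht)
    refine ne_top_of_le_ne_top h1 (setLIntegral_mono' measurableSet_Ioo fun s hs => ?_)
    refine le_trans ?_ (Kminus_univ_le M κ hC1 s)
    rw [← lintegral_one, lintegral_Kminus M κ s measurable_const]
    refine lintegral_mono fun p => ?_
    gcongr
    exact heatFun_le_one M (sub_pos.2 hs.2) (fun p => indicator_le_self' (by simp) p) p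
  have e6 : ∫⁻ p, heatFun M t (S.indicator 1) p ∂μ 0 = ∫⁻ p, U 0 p ∂μ 0 + ∫⁻ p, Z 0 p ∂μ 0 := by
    rw [← lintegral_add_left (hUs 0)]
    refine lintegral_congr fun p => ?_
    rw [← duhamel 0 le_rfl ht0, sub_zero]
  have e7 : ∫⁻ s in Ioo 0 t, ∫⁻ p, heatFun M (t - s) (S.indicator 1) p ∂gainKernel M κ s =
      (∫⁻ s in Ioo 0 t, ∫⁻ p, U s p ∂gainKernel M κ s) +
        ∫⁻ s in Ioo 0 t, ∫⁻ p, Z s p ∂gainKernel M κ s := by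
    have hUg : Measurable fun s => ∫⁻ p, U s p ∂gainKernel M κ s :=
      Measurable.lintegral_kernel_prod_right (κ := gainKernel M κ) (f := U) hU
    rw [← lintegral_add_left hUg]
    refine setLIntegral_congr_fun measurableSet_Ioo fun s hs => ?_
    rw [← lintegral_add_left (hUs s)]
    exact lintegral_congr fun p => duhamel s hs.1.le hs.2 p
  have e8 := hμ.lintegral_equation ht ht0 hf
  rw [lintegral_indicator_one hS, e6, e7] at e8
  -- By `e5` and `e2` the loss term equals the sum of all the `Z` contributions of the initial
  -- measure and of the gain. Cancelling it leaves exactly the `U` contributions.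
  refine (ENNReal.add_left_inj hfin).1 (e8.trans ?_)
  rw [e5, e2]
  ring

lemma isPropagatorSolution : IsPropagatorSolution M T μ μ where
  process := hμ.process
  equation t ht S hS := by
    have := hμ.isSFiniteKernel
    have hc := hμ.measurable_rate
    rcases ht.1.eq_or_lt with rfl | h0
    · simp [propagator, propagate]
    · rw [hμ.apply_eq_lintegral_killFun ht h0 hS]
      congr 1
      · exact (propagate_apply M hc h0 _ hS).symm
      · refine setLIntegral_congr_fun measurableSet_Ioo fun s hs => ?_
        rw [propagator, Kplus_eq_gainKernel, propagate_apply M hc hs.2 _ hS]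

end IsStrongSolution

/-! ### The weighted balance of gain and loss -/

section Collision

variable (M : Model d E)

lemma measurable_K_univ_mul_w :
    Measurable (Function.uncurry fun y y' => M.K (y, y') univ * M.w y) :=
  (M.K.measurable_coe MeasurableSet.univ).mul (M.measurable_w.comp measurable_fst)

lemma measurable_lintegral_K_w : Measurable (Function.uncurry fun y y' => ∫⁻ z, M.w z ∂M.K (y, y')) :=
  M.measurable_w.lintegral_kernel

/-- The second term carries the arguments in the order `(y', y)`, so that both summands are values
of the single function `K(y, y', E) w(y)` which also describes the loss. -/
lemma lintegral_K_w_le (y y' : E) : ∫⁻ z, M.w z ∂M.K (y, y') ≤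
    M.K (y, y') univ * M.w y + M.K (y', y) univ * M.w y' := by
  rw [M.K_symm y' y]
  calc ∫⁻ z, M.w z ∂M.K (y, y') ≤ ∫⁻ _, (M.w y + M.w y') ∂M.K (y, y') :=
        lintegral_mono_ae (M.w_le_add y y')
    _ = _ := by rw [lintegral_const]; ring

/-- If `n ≤ m` then passing from `n` to `m` raises the gain of weight at most by the loss. -/
lemma collision_le {n m : Measure E} [IsFiniteMeasure n] [IsFiniteMeasure m] (hle : n ≤ m)
    {α : ℝ≥0∞} (hα : ∫⁻ y, M.w y ^ 2 ∂m ≤ α) :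
    2⁻¹ * ∫⁻ y, ∫⁻ y', ∫⁻ z, M.w z ∂M.K (y, y') ∂m ∂m +
        ∫⁻ y, (∫⁻ y', M.K (y, y') univ ∂m) * M.w y ∂n + α * ∫⁻ y, M.w y ∂n ≤
      2⁻¹ * ∫⁻ y, ∫⁻ y', ∫⁻ z, M.w z ∂M.K (y, y') ∂n ∂n +
        ∫⁻ y, (∫⁻ y', M.K (y, y') univ ∂m) * M.w y ∂m + α * ∫⁻ y, M.w y ∂m := by
  -- With `m = n + δ` the bilinear forms expand and every comparison becomes a sum of nonnegative
  -- terms, which avoids subtracting quantities that may be infinite.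
  obtain ⟨δ, hδ, rfl⟩ : ∃ δ : Measure E, IsFiniteMeasure δ ∧ m = n + δ :=
    ⟨m - n, inferInstance, by rw [add_comm, Measure.sub_add_cancel_of_le hle]⟩
  let g : E → E → ℝ≥0∞ := fun y y' => ∫⁻ z, M.w z ∂M.K (y, y')
  let h : E → E → ℝ≥0∞ := fun y y' => M.K (y, y') univ * M.w y
  have hg : Measurable (Function.uncurry g) := measurable_lintegral_K_w M
  have hh : Measurable (Function.uncurry h) := measurable_K_univ_mul_w M
  let I : (E → E → ℝ≥0∞) → Measure E → Measure E → ℝ≥0∞ := fun f a b => ∫⁻ y, ∫⁻ y', f y y' ∂b ∂a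
  have hadd : ∀ f : E → E → ℝ≥0∞, Measurable (Function.uncurry f) → ∀ a : Measure E,
      I f a (n + δ) = I f a n + I f a δ := fun f hf a => by
    simp only [I, lintegral_add_measure]
    exact lintegral_add_left hf.lintegral_prod_right' _
  have hadd' : ∀ f : E → E → ℝ≥0∞, ∀ b : Measure E, I f (n + δ) b = I f n b + I f δ b :=
    fun f b => lintegral_add_measure _ _ _
  have hsymm : I g δ n = I g n δ := by
    have e : ∀ y y', g y y' = g y' y := fun y y' => by simp only [g, M.K_symm y y']
    simp only [I]
    rw [lintegral_lintegral_swap hg.aemeasurable]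
    simp_rw [e]
  have hgh : ∀ a b : Measure E, SFinite a → SFinite b → I g a b ≤ I h a b + I h b a := by
    intro a b _ _
    have e : I h b a = ∫⁻ y, ∫⁻ y', h y' y ∂b ∂a := lintegral_lintegral_swap hh.aemeasurable
    rw [e]
    simp only [I]
    have hu : Measurable fun y => ∫⁻ y', h y y' ∂b := hh.lintegral_prod_right'
    rw [← lintegral_add_left hu]
    refine lintegral_mono fun y => ?_
    have hy : Measurable fun y' => h y y' := hh.comp measurable_prodMk_left
    dsimp only
    rw [← lintegral_add_left hy]
    exact lintegral_mono fun y' => lintegral_K_w_le M y y'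
  -- The mixed gain `I g n δ` is bounded by `I h δ n`, which is part of the increase of the loss,
  -- and by `I h n δ`, which is not. The latter is the source of the correction with `α`, through `K
  -- w ≤ w² w'`.
  have hnδ : I h n δ ≤ α * ∫⁻ y, M.w y ∂δ := by
    calc I h n δ ≤ ∫⁻ y, ∫⁻ y', M.w y ^ 2 * M.w y' ∂δ ∂n := by
          refine lintegral_mono fun y => lintegral_mono fun y' => ?_
          calc h y y' ≤ M.w y * M.w y' * M.w y := by
                simp only [h]; gcongr; exact M.K_univ_le y y'
            _ = _ := by ring
      _ = (∫⁻ y, M.w y ^ 2 ∂n) * ∫⁻ y, M.w y ∂δ := by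
          simp_rw [lintegral_const_mul _ M.measurable_w]
          rw [lintegral_mul_const _ (M.measurable_w.pow_const 2)]
      _ ≤ _ := by
          gcongr
          exact (lintegral_mono' hle le_rfl).trans hα
  have eh : ∀ a b : Measure E, ∫⁻ y, (∫⁻ y', M.K (y, y') univ ∂b) * M.w y ∂a = I h a b := by
    intro a b
    refine lintegral_congr fun y => ?_
    have hy : Measurable fun y' => M.K (y, y') univ :=
      (M.K.measurable_coe MeasurableSet.univ).comp measurable_prodMk_left
    exact (lintegral_mul_const _ hy).symm
  rw [eh, eh]
  change 2⁻¹ * I g (n + δ) (n + δ) + I h n (n + δ) + _ ≤ 2⁻¹ * I g n n + I h (n + δ) (n + δ) + _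
  rw [hadd g hg, hadd' g, hadd' g, hadd h hh, hadd h hh, hadd' h, hadd' h, hsymm,
    lintegral_add_measure, mul_add α]
  have e1 : 2⁻¹ * (I g n n + I g n δ + (I g n δ + I g δ δ)) =
      2⁻¹ * I g n n + I g n δ + 2⁻¹ * I g δ δ := by
    calc _ = 2⁻¹ * I g n n + (2⁻¹ + 2⁻¹) * I g n δ + 2⁻¹ * I g δ δ := by ring
      _ = _ := by rw [ENNReal.inv_two_add_inv_two, one_mul]
  have e2 : 2⁻¹ * I g δ δ ≤ I h δ δ := by
    calc 2⁻¹ * I g δ δ ≤ 2⁻¹ * (I h δ δ + I h δ δ) := by gcongr; exact hgh δ δ inferInstance inferInstance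
      _ = (2⁻¹ + 2⁻¹) * I h δ δ := by ring
      _ = _ := by rw [ENNReal.inv_two_add_inv_two, one_mul]
  have e3 : I g n δ ≤ α * ∫⁻ y, M.w y ∂δ + I h δ n := (hgh n δ inferInstance inferInstance).trans (by gcongr)
  rw [e1]
  calc _ ≤ 2⁻¹ * I g n n + (α * ∫⁻ y, M.w y ∂δ + I h δ n) + I h δ δ + (I h n n + I h n δ) +
        α * ∫⁻ y, M.w y ∂n := by gcongr
    _ = _ := by ring

variable {M} {κ κ' : Kernel (ℝ × Space d) E}

/-- The rate at which coagulation produces weight. -/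
def weightedGain (M : Model d E) (κ : Kernel (ℝ × Space d) E) (s : ℝ) : ℝ≥0∞ :=
  ∫⁻ p, M.w p.2 ∂gainKernel M κ s

variable (M) in
lemma measurable_weightedGain (κ : Kernel (ℝ × Space d) E) : Measurable (weightedGain M κ) :=
  (M.measurable_w.comp measurable_snd).lintegral_kernel

lemma weightedGain_add_le [IsSFiniteKernel κ] [IsSFiniteKernel κ'] (hκ : ∀ p, IsFiniteMeasure (κ p))
    (hκ' : ∀ p, IsFiniteMeasure (κ' p)) {s : ℝ} (hle : ∀ᵐ x, κ' (s, x) ≤ κ (s, x)) :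
    weightedGain M κ s + weightedLoss M κ κ' s + supMoment M κ s * weight M κ' s ≤
      weightedGain M κ' s + weightedLoss M κ κ s + supMoment M κ s * weight M κ s := by
  have hw : Measurable fun p : Space d × E => M.w p.2 := M.measurable_w.comp measurable_snd
  have hl : Measurable fun p : Space d × E => lossRate M κ s p.1 p.2 * M.w p.2 :=
    (measurable_lossRate_right M κ s).mul hw
  have m1 : ∀ (ζ : Kernel (ℝ × Space d) E) [IsSFiniteKernel ζ], Measurable fun x =>
      ∫⁻ y, ∫⁻ y', ∫⁻ z, M.w z ∂M.K (y, y') ∂ζ (s, x) ∂ζ (s, x) := fun ζ _ => by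
    have h1 : Measurable fun q : Space d × E => ∫⁻ y', ∫⁻ z, M.w z ∂M.K (q.2, y') ∂ζ (s, q.1) :=
      Measurable.lintegral_kernel_prod_right (κ := ζ.comap (fun q : Space d × E => (s, q.1))
        (by fun_prop)) (f := fun q y' => ∫⁻ z, M.w z ∂M.K (q.2, y'))
        ((measurable_lintegral_K_w M).comp (f := fun q : (Space d × E) × E => (q.1.2, q.2))
          (by fun_prop))
    exact Measurable.lintegral_kernel_prod_right (κ := ζ.sectR s)
      (f := fun x y => ∫⁻ y', ∫⁻ z, M.w z ∂M.K (y, y') ∂ζ (s, x)) h1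
  have m2 : ∀ (ζ : Kernel (ℝ × Space d) E) [IsSFiniteKernel ζ], Measurable fun x =>
      ∫⁻ y, lossRate M κ s x y * M.w y ∂ζ (s, x) := fun ζ _ =>
    Measurable.lintegral_kernel_prod_right (κ := ζ.sectR s)
      (f := fun x y => lossRate M κ s x y * M.w y) hl
  have m3 : ∀ (ζ : Kernel (ℝ × Space d) E) [IsSFiniteKernel ζ], Measurable fun x =>
      ∫⁻ y, M.w y ∂ζ (s, x) := fun ζ _ =>
    (Measurable.lintegral_kernel (κ := ζ) M.measurable_w).comp measurable_prodMk_left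
  simp only [weightedGain, weightedLoss, weight]
  rw [lintegral_gainKernel M κ s hw, lintegral_gainKernel M κ' s hw, lintegral_spaceTime κ' s hl,
    lintegral_spaceTime κ s hl, lintegral_spaceTime κ' s hw, lintegral_spaceTime κ s hw]
  dsimp only
  have m4 : ∀ (ζ ζ' : Kernel (ℝ × Space d) E) [IsSFiniteKernel ζ] [IsSFiniteKernel ζ'],
      (2⁻¹ * ∫⁻ x, ∫⁻ y, ∫⁻ y', ∫⁻ z, M.w z ∂M.K (y, y') ∂ζ (s, x) ∂ζ (s, x)) +
        (∫⁻ x, ∫⁻ y, lossRate M κ s x y * M.w y ∂ζ' (s, x)) +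
        supMoment M κ s * ∫⁻ x, ∫⁻ y, M.w y ∂ζ' (s, x) =
      ∫⁻ x, (2⁻¹ * ∫⁻ y, ∫⁻ y', ∫⁻ z, M.w z ∂M.K (y, y') ∂ζ (s, x) ∂ζ (s, x) +
        ∫⁻ y, lossRate M κ s x y * M.w y ∂ζ' (s, x) +
        supMoment M κ s * ∫⁻ y, M.w y ∂ζ' (s, x)) := fun ζ ζ' _ _ => by
    rw [← lintegral_const_mul _ (m1 ζ), ← lintegral_const_mul _ (m3 ζ'),
      ← lintegral_add_left ((m1 ζ).const_mul _)]
    exact (lintegral_add_left (((m1 ζ).const_mul _).add (m2 ζ')) _).symm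
  rw [m4 κ κ', m4 κ' κ]
  refine lintegral_mono_ae ?_
  filter_upwards [hle, ae_lintegral_w_sq_le M κ s] with x h1 h2
  have := hκ (s, x)
  have := hκ' (s, x)
  exact collision_le M h1 h2

end Collision

section Balance

variable (M : Model d E) {c : ℝ → Space d → E → ℝ≥0∞} {T : ℝ≥0∞}
  {ν : ℝ → Measure (Space d × E)} {η : Kernel ℝ (Space d × E)} [IsSFiniteKernel η]
  {μ₀ : Measure (Space d × E)}

lemma lintegral_eq_lintegral_killFun
    (hc : Measurable fun p : ℝ × Space d × E => c p.1 p.2.1 p.2.2) {t : ℝ} (ht0 : 0 < t)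
    (h : ∀ S : Set (Space d × E), MeasurableSet S →
      ν t S = propagate M c 0 t μ₀ S + ∫⁻ s in Ioo 0 t, propagate M c s t (η s) S)
    {F : Space d × E → ℝ≥0∞} (hF : Measurable F) :
    ∫⁻ p, F p ∂ν t = ∫⁻ p, killFun M c 0 t F p ∂μ₀ +
      ∫⁻ s in Ioo 0 t, ∫⁻ p, killFun M c s t F p ∂η s := by
  have h1 := lintegral_add_eq_of_forall_measurableSet (ρ := volume.restrict (Ioo 0 t))
    (A := ν t) (a := fun _ : ℝ => 0) (B := propagate M c 0 t μ₀)
    (b := fun s => propagate M c s t (η s)) measurable_const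
    ((measurable_propagate_kernel M hc η).comp (f := fun s : ℝ => (s, t)) (by fun_prop))
    (fun S hS => by simpa using h S hS) hF
  simp only [lintegral_zero_measure, lintegral_zero, add_zero] at h1
  rw [h1, lintegral_propagate M hc ht0 _ hF]
  congr 1
  exact setLIntegral_congr_fun measurableSet_Ioo fun s hs => lintegral_propagate M hc hs.2 _ hF

/-- A weight which is constant in space is transported by the propagators, up to its loss. -/
lemma lintegral_w_add_loss [SFinite μ₀]
    (hc : Measurable fun p : ℝ × Space d × E => c p.1 p.2.1 p.2.2)
    {t : ℝ} (hrate : IntegrableRate c t) (ht : 0 ≤ t)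
    (h : ∀ r ∈ Icc 0 t, ∀ S : Set (Space d × E), MeasurableSet S →
      ν r S = propagate M c 0 r μ₀ S + ∫⁻ s in Ioo 0 r, propagate M c s r (η s) S) :
    ∫⁻ p, M.w p.2 ∂ν t + ∫⁻ r in Ioo 0 t, ∫⁻ p, c r p.1 p.2 * M.w p.2 ∂ν r =
      ∫⁻ p, M.w p.2 ∂μ₀ + ∫⁻ s in Ioo 0 t, ∫⁻ p, M.w p.2 ∂η s := by
  rcases ht.eq_or_lt with rfl | ht0
  · have e : ν 0 = μ₀ := by
      ext S hS
      rw [h 0 (by simp) S hS]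
      simp [propagate]
    simp [e]
  let W : Space d × E → ℝ≥0∞ := fun p => M.w p.2
  have hW : Measurable W := M.measurable_w.comp measurable_snd
  let F : ℝ → Space d × E → ℝ≥0∞ := fun r p => c r p.1 p.2 * W p
  -- The weight expected to be lost before time `t` by a particle present at `p` at time `s`. Since
  -- the heat flow fixes `W`, Duhamel's formula says that surviving and lost weight add up to `W`.
  let Y : ℝ → Space d × E → ℝ≥0∞ := fun s p => ∫⁻ r in Ioo s t, killFun M c s r (F r) p
  have hF : Measurable fun p : ℝ × Space d × E => F p.1 p.2 := hc.mul (hW.comp measurable_snd)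
  have hFr : ∀ r, Measurable (F r) := fun r =>
    hF.comp (f := fun p : Space d × E => (r, p)) (by fun_prop)
  have hk : Measurable fun p : ℝ × ℝ × Space d × E => killFun M c p.2.1 p.1 (F p.1) p.2.2 :=
    measurable_killFun_comp M hc (X := ℝ × ℝ × Space d × E) (F := fun p => F p.1)
      measurable_snd.fst measurable_fst measurable_snd.snd
      (hF.comp (f := fun q : (ℝ × ℝ × Space d × E) × Space d × E => (q.1.1, q.2)) (by fun_prop))
  have hk0 : Measurable fun p : ℝ × Space d × E => killFun M c 0 p.1 (F p.1) p.2 :=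
    hk.comp (f := fun p : ℝ × Space d × E => (p.1, 0, p.2)) (by fun_prop)
  have hkt : Measurable fun p : ℝ × Space d × E => killFun M c p.1 t W p.2 :=
    measurable_killFun_comp M hc (X := ℝ × Space d × E) (F := fun _ => W)
      measurable_fst measurable_const measurable_snd (hW.comp measurable_snd)
  have duhamel : ∀ s, 0 ≤ s → s < t → ∀ p, killFun M c s t W p + Y s p = W p := by
    intro s hs hst p
    have h1 := heatFun_eq_killFun_add' M hc hrate hs hst le_rfl hW p
    rw [heatFun_comp_snd M (sub_pos.2 hst)] at h1
    refine Eq.trans ?_ h1.symm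
    congr 1
    refine setLIntegral_congr_fun measurableSet_Ioo fun r hr => ?_
    have e : (fun p : Space d × E => c r p.1 p.2 * heatFun M (t - r) W p) = F r := by
      funext p
      rw [heatFun_comp_snd M (sub_pos.2 hr.2)]
    rw [e]
  have e1 : ∫⁻ r in Ioo 0 t, ∫⁻ p, c r p.1 p.2 * M.w p.2 ∂ν r =
      ∫⁻ p, Y 0 p ∂μ₀ + ∫⁻ s in Ioo 0 t, ∫⁻ p, Y s p ∂η s := by
    have e2 : ∀ r ∈ Ioo 0 t, ∫⁻ p, c r p.1 p.2 * M.w p.2 ∂ν r =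
        ∫⁻ p, killFun M c 0 r (F r) p ∂μ₀ +
          ∫⁻ s in Ioo 0 r, ∫⁻ p, killFun M c s r (F r) p ∂η s := fun r hr =>
      lintegral_eq_lintegral_killFun M hc hr.1 (h r (Ioo_subset_Icc_self hr)) (hFr r)
    rw [setLIntegral_congr_fun measurableSet_Ioo e2, lintegral_add_left hk0.lintegral_prod_right',
      lintegral_lintegral_swap (f := fun r p => killFun M c 0 r (F r) p) hk0.aemeasurable,
      lintegral_triangle_swap_kernel η (G := fun r s p => killFun M c s r (F r) p) hk]
  rw [e1, lintegral_eq_lintegral_killFun M hc ht0 (h t (right_mem_Icc.2 ht)) hW]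
  have e3 : ∫⁻ p, W p ∂μ₀ = ∫⁻ p, killFun M c 0 t W p ∂μ₀ + ∫⁻ p, Y 0 p ∂μ₀ := by
    rw [← lintegral_add_left (measurable_killFun M hc 0 t hW)]
    exact lintegral_congr fun p => (duhamel 0 le_rfl ht0 p).symm
  have e4 : ∫⁻ s in Ioo 0 t, ∫⁻ p, W p ∂η s =
      (∫⁻ s in Ioo 0 t, ∫⁻ p, killFun M c s t W p ∂η s) + ∫⁻ s in Ioo 0 t, ∫⁻ p, Y s p ∂η s := by
    have hm : Measurable fun s => ∫⁻ p, killFun M c s t W p ∂η s :=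
      Measurable.lintegral_kernel_prod_right (κ := η) (f := fun s p => killFun M c s t W p) hkt
    rw [← lintegral_add_left hm]
    refine setLIntegral_congr_fun measurableSet_Ioo fun s hs => ?_
    rw [← lintegral_add_left (measurable_killFun M hc s t hW)]
    exact lintegral_congr fun p => (duhamel s hs.1.le hs.2 p).symm
  change _ = ∫⁻ p, W p ∂μ₀ + ∫⁻ s in Ioo 0 t, ∫⁻ p, W p ∂η s
  rw [e3, e4]
  ring

end Balance

/-! ### The successive approximations -/

/-- `P^μ_{t0} μ_0 + ∫_0^t P^μ_{ts} K⁺(ν_s) ds`, where `κ` is the density of `ν`. -/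
def picard (M : Model d E) (T : ℝ≥0∞) (μ : ℝ → Measure (Space d × E))
    (κ : Kernel (ℝ × Space d) E) (t : ℝ) : Measure (Space d × E) :=
  propagator M T μ 0 t (μ 0) +
    (volume.restrict (Ioo 0 t)).bind fun s => propagator M T μ s t (Kplus M κ s)

/-- The successive approximations. -/
def picardIterate (M : Model d E) (T : ℝ≥0∞) (μ : ℝ → Measure (Space d × E)) :
    ℕ → ℝ → Measure (Space d × E)
  | 0 => fun t => propagator M T μ 0 t (μ 0)
  | k + 1 => picard M T μ (density T (picardIterate M T μ k))

section Mono

variable [StandardBorelSpace E] (M : Model d E) {T : ℝ≥0∞} {ν ν' : ℝ → Measure (Space d × E)}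
  (hν : IsProcess T ν) (hν' : IsProcess T ν') {t : ℝ} (ht : t ∈ timeDomain T) (h : ν t ≤ ν' t)
include hν hν' ht h

lemma weight_mono : weight M (density T ν) t ≤ weight M (density T ν') t := by
  rw [weight, weight, ← (isDensity_density hν).eq_spaceTime hν ht,
    ← (isDensity_density hν').eq_spaceTime hν' ht]
  exact lintegral_mono' h le_rfl

lemma weightedLoss_mono (κ : Kernel (ℝ × Space d) E) :
    weightedLoss M κ (density T ν) t ≤ weightedLoss M κ (density T ν') t := by
  rw [weightedLoss, weightedLoss, ← (isDensity_density hν).eq_spaceTime hν ht,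
    ← (isDensity_density hν').eq_spaceTime hν' ht]
  exact lintegral_mono' h le_rfl

end Mono

namespace IsStrongSolution

variable {M : Model d E} {T : ℝ≥0∞} {μ : ℝ → Measure (Space d × E)} [StandardBorelSpace E]
  (hμ : IsStrongSolution M T μ) {κ κ' : Kernel (ℝ × Space d) E}
include hμ

lemma measurable_propagator_Kplus (κ : Kernel (ℝ × Space d) E) [IsSFiniteKernel κ] :
    Measurable fun p : ℝ × ℝ => propagator M T μ p.1 p.2 (Kplus M κ p.1) := by
  simp_rw [Kplus_eq_gainKernel]
  exact measurable_propagate_kernel M hμ.measurable_rate (gainKernel M κ)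

lemma picard_apply (κ : Kernel (ℝ × Space d) E) [IsSFiniteKernel κ] (t : ℝ)
    {S : Set (Space d × E)} (hS : MeasurableSet S) :
    picard M T μ κ t S = propagator M T μ 0 t (μ 0) S +
      ∫⁻ s in Ioo 0 t, propagator M T μ s t (Kplus M κ s) S := by
  have h : Measurable fun s => propagator M T μ s t (Kplus M κ s) :=
    (hμ.measurable_propagator_Kplus κ).comp (f := fun s : ℝ => (s, t)) (by fun_prop)
  rw [picard, Measure.add_apply, Measure.bind_apply hS h.aemeasurable]

lemma measurable_propagator_initial {S : Set (Space d × E)} (hS : MeasurableSet S) :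
    Measurable fun t : timeDomain T => propagator M T μ 0 t (μ 0) S := by
  rcases isEmpty_or_nonempty (timeDomain T) with h | ⟨⟨t, ht⟩⟩
  · exact measurable_of_empty _
  have := hμ.process.finite 0 (zero_mem_timeDomain ht)
  have h1 := measurable_propagate_kernel M hμ.measurable_rate (Kernel.const ℝ (μ 0))
  have h2 := h1.comp (f := fun t : timeDomain T => ((0 : ℝ), (t : ℝ))) (by fun_prop)
  exact (Measure.measurable_coe hS).comp h2

lemma measurable_picard (κ : Kernel (ℝ × Space d) E) [IsSFiniteKernel κ] {S : Set (Space d × E)}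
    (hS : MeasurableSet S) : Measurable fun t : timeDomain T => picard M T μ κ t S := by
  simp_rw [hμ.picard_apply κ _ hS]
  refine (hμ.measurable_propagator_initial hS).add (measurable_setLIntegral_Ioo measurable_const
    measurable_subtype_coe (f := fun (t : timeDomain T) s =>
      propagator M T μ s t (Kplus M κ s) S) ?_)
  have h := (hμ.measurable_propagator_Kplus κ).comp
    (f := fun q : timeDomain T × ℝ => (q.2, (q.1 : ℝ))) (by fun_prop)
  exact (Measure.measurable_coe hS).comp h

lemma picard_mono [IsSFiniteKernel κ] [IsSFiniteKernel κ']
    (h : ∀ s ∈ timeDomain T, ∀ᵐ x, κ (s, x) ≤ κ' (s, x)) {t : ℝ} (ht : t ∈ timeDomain T) :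
    picard M T μ κ t ≤ picard M T μ κ' t := by
  refine Measure.le_iff.2 fun S hS => ?_
  rw [hμ.picard_apply κ t hS, hμ.picard_apply κ' t hS]
  gcongr 1
  refine setLIntegral_mono' measurableSet_Ioo fun s hs => ?_
  rw [Kplus_eq_gainKernel, Kplus_eq_gainKernel]
  exact propagate_mono M hμ.measurable_rate s t
    (gainKernel_le M (h s (mem_timeDomain_of_le ht hs.1.le hs.2.le))) S

lemma eq_picard {ν : ℝ → Measure (Space d × E)} (hν : IsPropagatorSolution M T μ ν) {t : ℝ}
    (ht : t ∈ timeDomain T) : ν t = picard M T μ (density T ν) t := by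
  have := (isDensity_density hν.process).isSFiniteKernel
  ext S hS
  rw [hμ.picard_apply _ t hS, hν.equation t ht S hS]

/-- The two claims need each other. Lying below the solution `μ` makes an iterate finite with
absolutely continuous first marginal, so that it is a process and has a density; comparing densities
then gives the bound for the next iterate. -/
lemma picardIterate_spec (k : ℕ) : IsProcess T (picardIterate M T μ k) ∧
    ∀ ν, IsPropagatorSolution M T μ ν → ∀ t ∈ timeDomain T, picardIterate M T μ k t ≤ ν t := by
  induction k with
  | zero =>
    have h : ∀ ν, IsPropagatorSolution M T μ ν → ∀ t ∈ timeDomain T,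
        picardIterate M T μ 0 t ≤ ν t := fun ν hν t ht => by
      rw [hμ.eq_picard hν ht]
      exact Measure.le_add_right le_rfl
    exact ⟨hμ.process.of_le (h μ hμ.isPropagatorSolution) fun S hS =>
      hμ.measurable_propagator_initial hS, h⟩
  | succ k ih =>
    have := (isDensity_density ih.1).isSFiniteKernel
    have h : ∀ ν, IsPropagatorSolution M T μ ν → ∀ t ∈ timeDomain T,
        picardIterate M T μ (k + 1) t ≤ ν t := fun ν hν t ht => by
      have := (isDensity_density hν.process).isSFiniteKernel
      rw [hμ.eq_picard hν ht]
      exact hμ.picard_mono (fun s hs => (isDensity_density ih.1).ae_le ih.1 hν.process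
        (isDensity_density hν.process) (ih.2 ν hν) hs) ht
    exact ⟨hμ.process.of_le (h μ hμ.isPropagatorSolution) fun S hS => hμ.measurable_picard _ hS, h⟩

lemma isProcess_picardIterate (k : ℕ) : IsProcess T (picardIterate M T μ k) :=
  (hμ.picardIterate_spec k).1

lemma isDensity_picardIterate (k : ℕ) :
    IsDensity T (picardIterate M T μ k) (density T (picardIterate M T μ k)) :=
  isDensity_density (hμ.isProcess_picardIterate k)

lemma isSFiniteKernel_picardIterate (k : ℕ) :
    IsSFiniteKernel (density T (picardIterate M T μ k)) :=
  (hμ.isDensity_picardIterate k).isSFiniteKernel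

lemma isIteration_picardIterate : IsIteration M T μ (picardIterate M T μ) where
  process := hμ.isProcess_picardIterate
  zero t _ := rfl
  succ k t _ S hS := by
    have := hμ.isSFiniteKernel_picardIterate k
    exact hμ.picard_apply _ t hS

lemma picardIterate_le_succ (k : ℕ) {t : ℝ} (ht : t ∈ timeDomain T) :
    picardIterate M T μ k t ≤ picardIterate M T μ (k + 1) t := by
  induction k generalizing t with
  | zero => exact Measure.le_add_right le_rfl
  | succ k ih =>
    have := hμ.isSFiniteKernel_picardIterate k
    have := hμ.isSFiniteKernel_picardIterate (k + 1)
    exact hμ.picard_mono (fun s hs => (hμ.isDensity_picardIterate k).ae_le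
      (hμ.isProcess_picardIterate k) (hμ.isProcess_picardIterate (k + 1))
      (hμ.isDensity_picardIterate (k + 1)) (fun r hr => ih hr) hs) ht

lemma monotone_picardIterate {t : ℝ} (ht : t ∈ timeDomain T) :
    Monotone fun k => picardIterate M T μ k t :=
  monotone_nat_of_le_succ fun k => hμ.picardIterate_le_succ k ht

lemma picardIterate_le (k : ℕ) {t : ℝ} (ht : t ∈ timeDomain T) : picardIterate M T μ k t ≤ μ t :=
  (hμ.picardIterate_spec k).2 μ hμ.isPropagatorSolution t ht

/-! ### Convergence -/

/-- The balance of weight for a process in terms of the gain of another one. -/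
lemma weight_add_lintegral {ν : ℝ → Measure (Space d × E)} (hν : IsProcess T ν)
    [IsSFiniteKernel κ] (h : ∀ t ∈ timeDomain T, ν t = picard M T μ κ t) {t : ℝ}
    (ht : t ∈ timeDomain T) :
    weight M (density T ν) t + ∫⁻ s in Ioo 0 t, weightedLoss M (density T μ) (density T ν) s =
      ∫⁻ p, M.w p.2 ∂μ 0 + ∫⁻ s in Ioo 0 t, weightedGain M κ s := by
  have := hμ.process.finite 0 (zero_mem_timeDomain ht)
  have hd := isDensity_density hν
  have e := lintegral_w_add_loss M (ν := ν) (η := gainKernel M κ) (μ₀ := μ 0) hμ.measurable_rate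
    (hμ.integrableRate ht) ht.1 fun r hr S hS => by
      rw [h r (mem_timeDomain_of_le ht hr.1 hr.2), hμ.picard_apply κ r hS]
      simp_rw [Kplus_eq_gainKernel]
      rfl
  rw [weight, ← hd.eq_spaceTime hν ht]
  refine Eq.trans ?_ e
  congr 1
  refine setLIntegral_congr_fun measurableSet_Ioo fun s hs => ?_
  rw [weightedLoss, ← hd.eq_spaceTime hν (mem_timeDomain_of_le ht hs.1.le hs.2.le)]

/-- One step of the comparison of the solution with the successive approximations. -/
lemma weight_add_le (k : ℕ) {t : ℝ} (ht : t ∈ timeDomain T) :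
    weight M (density T μ) t +
        (∫⁻ s in Ioo 0 t, weightedLoss M (density T μ) (density T (picardIterate M T μ k)) s) +
        ∫⁻ s in Ioo 0 t, supMoment M (density T μ) s *
          weight M (density T (picardIterate M T μ k)) s ≤
      weight M (density T (picardIterate M T μ (k + 1))) t +
        (∫⁻ s in Ioo 0 t, weightedLoss M (density T μ) (density T (picardIterate M T μ (k + 1))) s) +
        ∫⁻ s in Ioo 0 t, supMoment M (density T μ) s * weight M (density T μ) s := by
  have := hμ.isSFiniteKernel
  have := hμ.isSFiniteKernel_picardIterate k
  have := hμ.isSFiniteKernel_picardIterate (k + 1)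
  have h1 := hμ.weight_add_lintegral hμ.process (fun t ht => hμ.eq_picard hμ.isPropagatorSolution ht)
    ht
  have h2 := hμ.weight_add_lintegral (hμ.isProcess_picardIterate (k + 1)) (fun t _ => rfl) ht
  have hfin := hμ.lintegral_weightedLoss_ne_top ht
  have add3 : ∀ f g h : ℝ → ℝ≥0∞, Measurable f → Measurable g →
      (∫⁻ s in Ioo 0 t, f s) + (∫⁻ s in Ioo 0 t, g s) + ∫⁻ s in Ioo 0 t, h s =
        ∫⁻ s in Ioo 0 t, (f s + g s + h s) := fun f g h hf hg => by
    rw [← lintegral_add_left hf]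
    exact (lintegral_add_left (hf.add hg) h).symm
  set κ := density T μ
  set ζ := density T (picardIterate M T μ k)
  set ζ' := density T (picardIterate M T μ (k + 1))
  have mG := measurable_weightedGain M
  have mL := measurable_weightedLoss M κ
  have h3 : (∫⁻ s in Ioo 0 t, weightedGain M κ s) + (∫⁻ s in Ioo 0 t, weightedLoss M κ ζ s) +
        ∫⁻ s in Ioo 0 t, supMoment M κ s * weight M ζ s ≤
      (∫⁻ s in Ioo 0 t, weightedGain M ζ s) + (∫⁻ s in Ioo 0 t, weightedLoss M κ κ s) +
        ∫⁻ s in Ioo 0 t, supMoment M κ s * weight M κ s := by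
    rw [add3 _ _ _ (mG κ) (mL ζ), add3 _ _ _ (mG ζ) (mL κ)]
    refine setLIntegral_mono' measurableSet_Ioo fun s hs => ?_
    have hsT := mem_timeDomain_of_le ht hs.1.le hs.2.le
    exact weightedGain_add_le (isDensity_density hμ.process).finite
      (hμ.isDensity_picardIterate k).finite
      ((hμ.isDensity_picardIterate k).ae_le (hμ.isProcess_picardIterate k) hμ.process
        (isDensity_density hμ.process) (fun r hr => hμ.picardIterate_le k hr) hsT)
  -- Adding the total loss of `μ`, which is finite, makes the balance `h1` applicable; the gains are
  -- compared by `h3`, and the balance `h2` of the next iterate turns the result back into its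
  -- weight.
  refine (ENNReal.add_le_add_iff_right hfin).1 ?_
  calc _ = (weight M κ t + ∫⁻ s in Ioo 0 t, weightedLoss M κ κ s) +
        ((∫⁻ s in Ioo 0 t, weightedLoss M κ ζ s) +
          ∫⁻ s in Ioo 0 t, supMoment M κ s * weight M ζ s) := by ring
    _ = ∫⁻ p, M.w p.2 ∂μ 0 + ((∫⁻ s in Ioo 0 t, weightedGain M κ s) +
        (∫⁻ s in Ioo 0 t, weightedLoss M κ ζ s) +
          ∫⁻ s in Ioo 0 t, supMoment M κ s * weight M ζ s) := by rw [h1]; ring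
    _ ≤ ∫⁻ p, M.w p.2 ∂μ 0 + ((∫⁻ s in Ioo 0 t, weightedGain M ζ s) +
        (∫⁻ s in Ioo 0 t, weightedLoss M κ κ s) +
          ∫⁻ s in Ioo 0 t, supMoment M κ s * weight M κ s) := by gcongr
    _ = (∫⁻ p, M.w p.2 ∂μ 0 + ∫⁻ s in Ioo 0 t, weightedGain M ζ s) +
        ((∫⁻ s in Ioo 0 t, weightedLoss M κ κ s) +
          ∫⁻ s in Ioo 0 t, supMoment M κ s * weight M κ s) := by ring
    _ = _ := by rw [← h2]; ring

/-- The weight missing in the limit, `A - B`, satisfies the inequality of `weight_add_le` with both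
approximations replaced by their limit. It is dominated by its own integral against the second
moment, and Grönwall's lemma applies. -/
lemma iSup_weight_picardIterate {t : ℝ} (ht : t ∈ timeDomain T) :
    ⨆ k, weight M (density T (picardIterate M T μ k)) t = weight M (density T μ) t := by
  let κ := density T μ
  let ζ : ℕ → Kernel (ℝ × Space d) E := fun k => density T (picardIterate M T μ k)
  let A : ℝ → ℝ≥0∞ := weight M κ
  let B : ℝ → ℝ≥0∞ := fun s => ⨆ k, weight M (ζ k) s
  have mA : Measurable A := measurable_weight M κ
  have mB : Measurable B := Measurable.iSup fun k => measurable_weight M (ζ k)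
  have mα : Measurable (supMoment M κ) := measurable_supMoment M κ
  have hmono : ∀ s ∈ timeDomain T, Monotone fun k => weight M (ζ k) s := fun s hs =>
    monotone_nat_of_le_succ fun k => weight_mono M (hμ.isProcess_picardIterate k)
      (hμ.isProcess_picardIterate (k + 1)) hs (hμ.picardIterate_le_succ k hs)
  have hBA : ∀ s ∈ timeDomain T, B s ≤ A s := fun s hs =>
    iSup_le fun k => weight_mono M (hμ.isProcess_picardIterate k) hμ.process hs
      (hμ.picardIterate_le k hs)
  obtain ⟨C, hC, hAC⟩ := hμ.exists_weight_le ht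
  have key : ∀ r ∈ Icc 0 t, A r - B r ≤ ∫⁻ s in Ioo 0 r, supMoment M κ s * (A s - B s) := by
    intro r hr
    have hrT := mem_timeDomain_of_le ht hr.1 hr.2
    have hsT : ∀ s ∈ Ioo 0 r, s ∈ timeDomain T :=
      fun s hs => mem_timeDomain_of_le hrT hs.1.le hs.2.le
    have hLmono : Monotone fun k => ∫⁻ s in Ioo 0 r, weightedLoss M κ (ζ k) s :=
      monotone_nat_of_le_succ fun k => setLIntegral_mono' measurableSet_Ioo fun s hs =>
        weightedLoss_mono M (hμ.isProcess_picardIterate k) (hμ.isProcess_picardIterate (k + 1))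
          (hsT s hs) (hμ.picardIterate_le_succ k (hsT s hs)) κ
    -- The losses of the iterates `k` and `k + 1` stand on opposite sides of `weight_add_le` and
    -- have the same limit `Λ`. Being finite, `Λ` cancels after the passage to the limit, without
    -- having to be identified with the loss of `μ`.
    set Λ := ⨆ k, ∫⁻ s in Ioo 0 r, weightedLoss M κ (ζ k) s with hΛ
    have hΛfin : Λ ≠ ∞ := by
      refine ne_top_of_le_ne_top (hμ.lintegral_weightedLoss_ne_top hrT) (iSup_le fun k => ?_)
      exact setLIntegral_mono' measurableSet_Ioo fun s hs =>
        weightedLoss_mono M (hμ.isProcess_picardIterate k) hμ.process (hsT s hs)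
          (hμ.picardIterate_le k (hsT s hs)) κ
    have hαmono : ∀ᵐ s ∂volume.restrict (Ioo 0 r),
        Monotone fun k => supMoment M κ s * weight M (ζ k) s := by
      filter_upwards [ae_restrict_mem measurableSet_Ioo] with s hs i j hij
      exact mul_le_mul_right (hmono s (hsT s hs) hij) _
    have hI : ∫⁻ s in Ioo 0 r, supMoment M κ s * B s =
        ⨆ k, ∫⁻ s in Ioo 0 r, supMoment M κ s * weight M (ζ k) s := by
      refine Eq.trans (lintegral_congr fun s => ENNReal.mul_iSup _ _) (lintegral_iSup'
        (fun k => (mα.mul (measurable_weight M (ζ k))).aemeasurable) hαmono)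
    have hαmono' : Monotone fun k => ∫⁻ s in Ioo 0 r, supMoment M κ s * weight M (ζ k) s :=
      fun i j hij => lintegral_mono_ae (by
        filter_upwards [hαmono] with s hs using hs hij)
    have hB : Tendsto (fun k => weight M (ζ (k + 1)) r) atTop (𝓝 (B r)) :=
      (tendsto_add_atTop_iff_nat 1).2 (tendsto_atTop_iSup (hmono r hrT))
    have hL := tendsto_atTop_iSup hLmono
    have hα := tendsto_atTop_iSup hαmono'
    rw [← hΛ] at hL
    rw [← hI] at hα
    have hlim : A r + Λ + ∫⁻ s in Ioo 0 r, supMoment M κ s * B s ≤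
        B r + Λ + ∫⁻ s in Ioo 0 r, supMoment M κ s * A s :=
      le_of_tendsto_of_tendsto' ((tendsto_const_nhds.add hL).add hα)
        ((hB.add ((tendsto_add_atTop_iff_nat 1).2 hL)).add tendsto_const_nhds)
        fun k => hμ.weight_add_le k hrT
    have hsplit : ∫⁻ s in Ioo 0 r, supMoment M κ s * A s =
        (∫⁻ s in Ioo 0 r, supMoment M κ s * B s) +
          ∫⁻ s in Ioo 0 r, supMoment M κ s * (A s - B s) := by
      have mαB : Measurable fun s => supMoment M κ s * B s := mα.mul mB
      rw [← lintegral_add_left mαB]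
      refine setLIntegral_congr_fun measurableSet_Ioo fun s hs => ?_
      rw [← mul_add, add_tsub_cancel_of_le (hBA s (hsT s hs))]
    have hfin : Λ + ∫⁻ s in Ioo 0 r, supMoment M κ s * B s ≠ ∞ := by
      refine ENNReal.add_ne_top.2 ⟨hΛfin, ne_top_of_le_ne_top
        (hμ.lintegral_supMoment_mul_weight_ne_top hrT) ?_⟩
      exact setLIntegral_mono' measurableSet_Ioo fun s hs => by gcongr; exact hBA s (hsT s hs)
    rw [hsplit] at hlim
    rw [tsub_le_iff_left]
    refine (ENNReal.add_le_add_iff_right hfin).1 ?_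
    calc _ = A r + Λ + ∫⁻ s in Ioo 0 r, supMoment M κ s * B s := by ring
      _ ≤ _ := hlim
      _ = _ := by ring
  have h0 := eq_zero_of_le_lintegral mα (hμ.moment_two t ht).ne (f := fun s => A s - B s) hC
    (fun s hs => tsub_le_self.trans (hAC s hs)) key t (right_mem_Icc.2 ht.1)
  exact le_antisymm (hBA t ht) (tsub_eq_zero_iff_le.1 h0)

/-- Since `1 ≤ C w`, the mass missing from any set is at most `C` times the missing weight, which
tends to zero. The comparison is written additively, and the finite weight of `μ` cancels at the
end. -/
lemma tendsto_picardIterate {t : ℝ} (ht : t ∈ timeDomain T) (S : Set (Space d × E)) :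
    Tendsto (fun k => picardIterate M T μ k t S) atTop (𝓝 (μ t S)) := by
  obtain ⟨C, hC, hC1⟩ := M.exists_one_le_mul_w
  obtain ⟨D, hD, hAD⟩ := hμ.exists_weight_le ht
  have hmono : Monotone fun k => picardIterate M T μ k t S := fun i j hij =>
    hμ.monotone_picardIterate ht hij S
  have hlim := tendsto_atTop_iSup hmono
  set L := ⨆ k, picardIterate M T μ k t S
  have hwmono : Monotone fun k => weight M (density T (picardIterate M T μ k)) t :=
    monotone_nat_of_le_succ fun k => weight_mono M (hμ.isProcess_picardIterate k)
      (hμ.isProcess_picardIterate (k + 1)) ht (hμ.picardIterate_le_succ k ht)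
  have hwlim := tendsto_atTop_iSup hwmono
  rw [hμ.iSup_weight_picardIterate ht] at hwlim
  have hle : L ≤ μ t S := iSup_le fun k => hμ.picardIterate_le k ht S
  have key : ∀ k, μ t S + C * weight M (density T (picardIterate M T μ k)) t ≤
      picardIterate M T μ k t S + C * weight M (density T μ) t := by
    intro k
    have hk := hμ.isProcess_picardIterate k
    have := hk.finite t ht
    have e := Measure.sub_add_cancel_of_le (hμ.picardIterate_le k ht)
    set δ := μ t - picardIterate M T μ k t
    have hδ : δ S ≤ C * ∫⁻ p, M.w p.2 ∂δ := by
      have hw : Measurable fun p : Space d × E => M.w p.2 := M.measurable_w.comp measurable_snd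
      rw [← lintegral_const_mul _ hw]
      refine (measure_mono (subset_univ S)).trans ?_
      rw [← lintegral_one]
      exact lintegral_mono fun p => hC1 p.2
    rw [hμ.weight_eq ht, weight, ← (isDensity_density hk).eq_spaceTime hk ht, ← e,
      Measure.add_apply, lintegral_add_measure, mul_add]
    calc δ S + picardIterate M T μ k t S + C * ∫⁻ p, M.w p.2 ∂picardIterate M T μ k t
        ≤ C * ∫⁻ p, M.w p.2 ∂δ + picardIterate M T μ k t S +
          C * ∫⁻ p, M.w p.2 ∂picardIterate M T μ k t := by gcongr
      _ = _ := by ring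
  have h2 : μ t S + C * weight M (density T μ) t ≤ L + C * weight M (density T μ) t :=
    le_of_tendsto_of_tendsto' (tendsto_const_nhds.add (ENNReal.Tendsto.const_mul hwlim (Or.inr hC)))
      (hlim.add tendsto_const_nhds) key
  have h3 : μ t S ≤ L := (ENNReal.add_le_add_iff_right (ENNReal.mul_ne_top hC
    (ne_top_of_le_ne_top hD (hAD t (right_mem_Icc.2 ht.1))))).1 h2
  rwa [le_antisymm hle h3] at hlim

theorem isMinimalPropagatorSolution : IsMinimalPropagatorSolution M T μ μ where
  solution := hμ.isPropagatorSolution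
  minimal ν hν t ht := Measure.le_iff.2 fun S _ =>
    le_of_tendsto' (hμ.tendsto_picardIterate ht S) fun k => (hμ.picardIterate_spec k).2 ν hν t ht S
  limit := ⟨_, hμ.isIteration_picardIterate, fun _ ht S _ => hμ.tendsto_picardIterate ht S⟩

end IsStrongSolution

/-! ### Disintegration along a function with absolutely continuous law -/

/-- The image of `μ` on the graph of `f` is disintegrated over the law of `f`, and the conditional
laws are multiplied by the density of that law with respect to `l`. -/
lemma exists_kernel_of_map_absolutelyContinuous {X Y : Type*} [MeasurableSpace X] [MeasurableEq X]
    [MeasurableSpace Y] [StandardBorelSpace Y] {μ : Measure Y} [IsFiniteMeasure μ] {f : Y → X}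
    (hf : Measurable f) {l : Measure X} [SigmaFinite l] (h : μ.map f ≪ l) :
    ∃ ρ : Kernel X Y, (∀ x, ∀ᵐ y ∂ρ x, f y = x) ∧
      ∀ A, MeasurableSet A → μ A = ∫⁻ x, ρ x A ∂l := by
  rcases isEmpty_or_nonempty Y with hY | hY
  · exact ⟨0, by simp, fun A _ => by simp [Set.eq_empty_of_isEmpty A]⟩
  have hg : Measurable fun y => (f y, y) := hf.prodMk measurable_id
  let τ : Measure (X × Y) := μ.map fun y => (f y, y)
  have hτ : τ.fst = μ.map f := Measure.map_map measurable_fst hg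
  let κ : Kernel X Y := τ.condKernel
  have hr : Measurable ((μ.map f).rnDeriv l) := Measure.measurable_rnDeriv _ _
  have hD : MeasurableSet {p : X × Y | f p.2 = p.1} :=
    measurableSet_eq_fun (hf.comp measurable_snd) measurable_fst
  -- The indicator of the graph changes nothing for almost every `x`, but it makes `f y = x` hold
  -- under the kernel for every `x`, as the notion of absolutely continuous mass demands.
  let g : X → Y → ℝ≥0∞ := fun x y =>
    (μ.map f).rnDeriv l x * {p : X × Y | f p.2 = p.1}.indicator 1 (x, y)
  have hgm : Measurable (Function.uncurry g) :=
    (hr.comp measurable_fst).mul (measurable_one.indicator hD)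
  refine ⟨Kernel.withDensity κ g, fun x => ?_, fun A hA => ?_⟩
  · have hgx : Measurable (g x) := hgm.comp measurable_prodMk_left
    rw [Kernel.withDensity_apply κ hgm, ae_withDensity_iff hgx]
    refine ae_of_all _ fun y hy => ?_
    by_contra hne
    exact hy (by simp [g, hne])
  · have hS : MeasurableSet {p : X × Y | f p.2 = p.1 ∧ p.2 ∈ A} := hD.inter (measurable_snd hA)
    have e1 : μ A = τ {p : X × Y | f p.2 = p.1 ∧ p.2 ∈ A} := by
      rw [Measure.map_apply hg hS]
      congr 1
      ext y
      simp
    have hm : Measurable fun x => κ x (Prod.mk x ⁻¹' {p : X × Y | f p.2 = p.1 ∧ p.2 ∈ A}) :=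
      Kernel.measurable_kernel_prodMk_left hS
    have e2 : τ {p : X × Y | f p.2 = p.1 ∧ p.2 ∈ A} =
        (τ.fst ⊗ₘ κ) {p : X × Y | f p.2 = p.1 ∧ p.2 ∈ A} := by
      rw [Measure.disintegrate τ τ.condKernel]
    rw [e1, e2, Measure.compProd_apply hS, hτ,
      ← Measure.withDensity_rnDeriv_eq _ _ h,
      lintegral_withDensity_eq_lintegral_mul _ (Measure.measurable_rnDeriv _ _) hm]
    refine lintegral_congr fun x => ?_
    have hx : Measurable fun y => {p : X × Y | f p.2 = p.1}.indicator (1 : X × Y → ℝ≥0∞) (x, y) :=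
      (measurable_one.indicator hD).comp measurable_prodMk_left
    rw [Kernel.withDensity_apply' κ hgm, lintegral_const_mul _ hx, Pi.mul_apply]
    congr 1
    rw [← lintegral_indicator hA, ← lintegral_indicator_one (measurable_prodMk_left hS)]
    refine lintegral_congr fun y => ?_
    by_cases h1 : y ∈ A <;> by_cases h2 : f y = x <;> simp [indicator, h1, h2]

/-! ### Integer mass -/

section Mass

variable (M : Model d E)

lemma measurableSet_integer_mass : MeasurableSet {q : Space d × E | ¬ ∃ n : ℕ, M.m q.2 = n} := by
  have h : MeasurableSet (range ((↑) : ℕ → ℝ)) := (countable_range _).measurableSet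
  have e : {q : Space d × E | ¬ ∃ n : ℕ, M.m q.2 = n} =
      ((fun q : Space d × E => M.m q.2) ⁻¹' range ((↑) : ℕ → ℝ))ᶜ := by
    ext q
    simp [eq_comm]
  rw [e]
  exact ((M.measurable_m.comp measurable_snd) h).compl

variable {M} {c : ℝ → Space d → E → ℝ≥0∞}

lemma hasIntegerMass_propagate (hc : Measurable fun p : ℝ × Space d × E => c p.1 p.2.1 p.2.2)
    {ν : Measure (Space d × E)} (h : HasIntegerMass (fun q : Space d × E => M.m q.2) ν) (s t : ℝ) :
    HasIntegerMass (fun q : Space d × E => M.m q.2) (propagate M c s t ν) := by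
  have hN := measurableSet_integer_mass M
  by_cases hst : s < t
  · rw [HasIntegerMass, propagate_apply M hc hst _ hN, lintegral_eq_zero_iff
      (measurable_killFun M hc s t (measurable_one.indicator hN))]
    have h' : ∀ᵐ q ∂ν, ∃ n : ℕ, M.m q.2 = n := h
    filter_upwards [h'] with q hq
    refine lintegral_eq_zero_of_ae_eq_zero (ae_of_all _ fun x' => ?_)
    have hx : (x', q.2) ∉ {q : Space d × E | ¬ ∃ n : ℕ, M.m q.2 = n} := fun h => h hq
    dsimp only
    rw [indicator_of_notMem hx, mul_zero]
    rfl
  · rwa [propagate, if_neg hst]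

lemma ae_spaceTime {κ : Kernel (ℝ × Space d) E} [IsSFiniteKernel κ] {s : ℝ}
    {N : Set (Space d × E)} (hN : MeasurableSet N) (h : spaceTime κ s N = 0) :
    ∀ᵐ x, ∀ᵐ y ∂κ (s, x), (x, y) ∉ N := by
  rw [spaceTime_apply, Measure.compProd_apply hN, lintegral_eq_zero_iff
    (Kernel.measurable_kernel_prodMk_left hN)] at h
  filter_upwards [h] with x hx
  exact measure_eq_zero_iff_ae_notMem.1 hx

lemma gainKernel_null {κ : Kernel (ℝ × Space d) E} [IsSFiniteKernel κ] {s : ℝ}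
    {A : Set E} (hA : MeasurableSet A)
    (h : ∀ᵐ x, ∀ᵐ y ∂κ (s, x), ∀ᵐ y' ∂κ (s, x), ∀ᵐ z ∂M.K (y, y'), z ∉ A) :
    gainKernel M κ s (Prod.snd ⁻¹' A) = 0 := by
  have hm : Measurable ((Prod.snd ⁻¹' A).indicator (1 : Space d × E → ℝ≥0∞)) :=
    measurable_one.indicator (measurable_snd hA)
  rw [← lintegral_indicator_one (measurable_snd hA), lintegral_gainKernel M κ s hm]
  refine mul_eq_zero_of_right _ (lintegral_eq_zero_of_ae_eq_zero ?_)
  filter_upwards [h] with x hx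
  refine lintegral_eq_zero_of_ae_eq_zero ?_
  filter_upwards [hx] with y hy
  refine lintegral_eq_zero_of_ae_eq_zero ?_
  filter_upwards [hy] with y' hy'
  refine lintegral_eq_zero_of_ae_eq_zero ?_
  filter_upwards [hy'] with z hz
  exact indicator_of_notMem (show (x, z) ∉ Prod.snd ⁻¹' A from hz) _

lemma hasIntegerMass_gainKernel {κ : Kernel (ℝ × Space d) E} [IsSFiniteKernel κ] {s : ℝ}
    (h : HasIntegerMass (fun q : Space d × E => M.m q.2) (spaceTime κ s)) :
    HasIntegerMass (fun q : Space d × E => M.m q.2) (gainKernel M κ s) := by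
  have hA : MeasurableSet {y : E | ¬ ∃ n : ℕ, M.m y = n} :=
    measurable_prodMk_left (x := (0 : Space d)) (measurableSet_integer_mass M)
  refine gainKernel_null hA ?_
  filter_upwards [ae_spaceTime (measurableSet_integer_mass M) h] with x hx
  filter_upwards [hx] with y hy
  filter_upwards [hx] with y' hy'
  filter_upwards [M.K_mass y y'] with z hz hn
  obtain ⟨n, hn1⟩ := not_not.1 hy
  obtain ⟨n', hn2⟩ := not_not.1 hy'
  exact hn ⟨n + n', by push_cast; rw [hz, ← hn1, ← hn2]⟩

/-! ### Absolutely continuous mass -/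

/-- The law of the mass is absolutely continuous. -/
def ACMass (M : Model d E) (ν : Measure (Space d × E)) : Prop :=
  ∀ N : Set ℝ, MeasurableSet N → volume N = 0 → ν {p | M.m p.2 ∈ N} = 0

/-- The joint law of position and mass is absolutely continuous. -/
def ACPositionMass (M : Model d E) (ν : Measure (Space d × E)) : Prop :=
  ∀ N : Set (Space d × ℝ), MeasurableSet N → volume N = 0 → ν {p | (p.1, M.m p.2) ∈ N} = 0

lemma measurable_position_mass : Measurable fun p : Space d × E => (p.1, M.m p.2) :=
  measurable_fst.prodMk (M.measurable_m.comp measurable_snd)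

lemma measurable_mass : Measurable fun p : Space d × E => M.m p.2 :=
  M.measurable_m.comp measurable_snd

/-- For almost every mass the slice of a null set at that mass is null in space. Absolute continuity
of the mass lets almost every particle avoid the exceptional masses, and the propagator spreads each
particle with a density in position. Nothing is required of the initial joint law. -/
lemma acPositionMass_propagate (hc : Measurable fun p : ℝ × Space d × E => c p.1 p.2.1 p.2.2)
    {ν : Measure (Space d × E)} (h : ACMass M ν) {s t : ℝ} (hst : s < t) :
    ACPositionMass M (propagate M c s t ν) := by
  intro N hN hN0
  have hS : MeasurableSet {p : Space d × E | (p.1, M.m p.2) ∈ N} := measurable_position_mass hN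
  rw [propagate_apply M hc hst _ hS, lintegral_eq_zero_iff
    (measurable_killFun M hc s t (measurable_one.indicator hS))]
  have hslice : Measurable fun r : ℝ => volume ((fun x : Space d => (x, r)) ⁻¹' N) :=
    measurable_measure_prodMk_right hN
  have h1 : volume {r : ℝ | volume ((fun x : Space d => (x, r)) ⁻¹' N) ≠ 0} = 0 := by
    rw [Measure.volume_eq_prod, Measure.prod_apply_symm hN, lintegral_eq_zero_iff hslice] at hN0
    exact hN0
  have h2 : ∀ᵐ q ∂ν, volume ((fun x : Space d => (x, M.m q.2)) ⁻¹' N) = 0 := by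
    have h3 := h _ (hslice (measurableSet_singleton 0)).compl h1
    rw [ae_iff]
    exact h3
  filter_upwards [h2] with q hq
  refine lintegral_eq_zero_of_ae_eq_zero ?_
  have h4 : ∀ᵐ x' : Space d, (x', M.m q.2) ∉ N := measure_eq_zero_iff_ae_notMem.1 hq
  filter_upwards [h4] with x' hx'
  have hx : (x', q.2) ∉ {p : Space d × E | (p.1, M.m p.2) ∈ N} := hx'
  rw [indicator_of_notMem hx, mul_zero]
  rfl

/-- The mass of a product is `m(y) + m(y')` with both parents at the same position. For a fixed
partner, the masses `r` with `r + m(y')` in a null set form a translate of it, so by Fubini almost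
every `(x, r)` meets no bad partners at `x`. Colliding particles share a position, so the joint law
of position and mass is what carries this to almost every parent. -/
lemma acMass_gainKernel {κ : Kernel (ℝ × Space d) E} [IsSFiniteKernel κ] {s : ℝ}
    (h : ACPositionMass M (spaceTime κ s)) : ACMass M (gainKernel M κ s) := by
  intro N hN hN0
  have hA : MeasurableSet {y : E | M.m y ∈ N} := M.measurable_m hN
  have hT : MeasurableSet {q : (Space d × ℝ) × E | q.1.2 + M.m q.2 ∈ N} :=
    (measurable_fst.snd.add (M.measurable_m.comp measurable_snd)) hN
  have hF : Measurable fun p : Space d × ℝ => κ (s, p.1) {y' | p.2 + M.m y' ∈ N} :=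
    Kernel.measurable_kernel_prodMk_left (κ := κ.comap (fun p : Space d × ℝ => (s, p.1))
      (by fun_prop)) hT
  have hnull : volume {p : Space d × ℝ | κ (s, p.1) {y' | p.2 + M.m y' ∈ N} ≠ 0} = 0 := by
    have h1 : ∫⁻ p : Space d × ℝ, κ (s, p.1) {y' | p.2 + M.m y' ∈ N} = 0 := by
      rw [Measure.volume_eq_prod, lintegral_prod _ hF.aemeasurable]
      refine lintegral_eq_zero_of_ae_eq_zero (ae_of_all _ fun x => ?_)
      have hx : MeasurableSet {q : ℝ × E | q.1 + M.m q.2 ∈ N} :=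
        (measurable_fst.add (M.measurable_m.comp measurable_snd)) hN
      have e : ∫⁻ r : ℝ, κ (s, x) {y' | r + M.m y' ∈ N} =
          ∫⁻ y', volume {r : ℝ | r + M.m y' ∈ N} ∂κ (s, x) := by
        have e1 := Measure.prod_apply (μ := (volume : Measure ℝ)) (ν := κ (s, x)) hx
        rw [Measure.prod_apply_symm hx] at e1
        exact e1.symm
      change ∫⁻ r : ℝ, κ (s, x) {y' | r + M.m y' ∈ N} = 0
      rw [e]
      refine lintegral_eq_zero_of_ae_eq_zero (ae_of_all _ fun y' => ?_)
      exact (measure_preimage_add_right volume (M.m y') N).trans hN0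
    rw [lintegral_eq_zero_iff hF] at h1
    exact h1
  have h2 := h _ (hF (measurableSet_singleton 0)).compl hnull
  refine gainKernel_null hA ?_
  filter_upwards [ae_spaceTime (measurable_position_mass (hF (measurableSet_singleton 0)).compl) h2]
    with x hx
  filter_upwards [hx] with y hy
  have h3 : ∀ᵐ y' ∂κ (s, x), M.m y + M.m y' ∉ N :=
    measure_eq_zero_iff_ae_notMem.1 (not_not.1 hy)
  filter_upwards [h3] with y' hy'
  filter_upwards [M.K_mass y y'] with z hz hn
  exact hy' (hz ▸ hn)

lemma ACPositionMass.acMass {ν : Measure (Space d × E)} (h : ACPositionMass M ν) : ACMass M ν := by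
  intro N hN hN0
  refine h (Prod.snd ⁻¹' N) (measurable_snd hN) ?_
  rw [Measure.volume_eq_prod, ← univ_prod, Measure.prod_prod, hN0, mul_zero]

/-! ### Absolutely continuous mass: passage between kernels and null sets -/

lemma acMass_of_hasACMass {ν : Measure (Space d × E)}
    (h : HasACMass (fun q : Space d × E => M.m q.2) ν) : ACMass M ν := by
  obtain ⟨ρ, h1, h2⟩ := h
  intro N hN hN0
  have hS : MeasurableSet {p : Space d × E | M.m p.2 ∈ N} := measurable_mass hN
  rw [h2 _ hS]
  refine lintegral_eq_zero_of_ae_eq_zero ?_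
  have hae : ∀ᵐ r : ℝ, r ∉ N := measure_eq_zero_iff_ae_notMem.1 hN0
  filter_upwards [ae_restrict_mem measurableSet_Ioi, ae_restrict_of_ae hae] with r hr hrN
  rw [Pi.zero_apply, measure_eq_zero_iff_ae_notMem]
  filter_upwards [h1 r hr] with p hp
  rwa [hp]

lemma acMass_of_hasACMassLocally {ν : Measure (Space d × E)} (h : HasACMassLocally M.m ν) :
    ACMass M ν := by
  obtain ⟨ρ, h1, h2⟩ := h
  intro N hN hN0
  have e : {p : Space d × E | M.m p.2 ∈ N} = univ ×ˢ {y | M.m y ∈ N} := by ext; simp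
  have hS : MeasurableSet {y | M.m y ∈ N} := M.measurable_m hN
  rw [e, h2 _ _ MeasurableSet.univ hS]
  refine lintegral_eq_zero_of_ae_eq_zero (ae_of_all _ fun x => lintegral_eq_zero_of_ae_eq_zero ?_)
  have hae : ∀ᵐ r : ℝ, r ∉ N := measure_eq_zero_iff_ae_notMem.1 hN0
  filter_upwards [ae_restrict_mem measurableSet_Ioi, ae_restrict_of_ae hae] with r hr hrN
  rw [Pi.zero_apply, measure_eq_zero_iff_ae_notMem]
  filter_upwards [h1 x r hr] with y hy
  rwa [hy]

variable [StandardBorelSpace E]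

lemma ACMass.hasACMass {ν : Measure (Space d × E)} [IsFiniteMeasure ν] (h : ACMass M ν) :
    HasACMass (fun q : Space d × E => M.m q.2) ν := by
  have hac : ν.map (fun q : Space d × E => M.m q.2) ≪ volume.restrict (Ioi 0) := by
    refine Measure.AbsolutelyContinuous.mk fun N hN hN0 => ?_
    rw [Measure.restrict_apply hN] at hN0
    rw [Measure.map_apply measurable_mass hN]
    refine Eq.trans ?_ (h _ (hN.inter measurableSet_Ioi) hN0)
    congr 1
    ext p
    simp [M.m_pos]
  obtain ⟨ρ, h1, h2⟩ := exists_kernel_of_map_absolutelyContinuous measurable_mass hac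
  exact ⟨ρ, fun r _ => h1 r, h2⟩

lemma ACPositionMass.hasACMassLocally {ν : Measure (Space d × E)} [IsFiniteMeasure ν]
    (h : ACPositionMass M ν) : HasACMassLocally M.m ν := by
  have hac : ν.map (fun p : Space d × E => (p.1, M.m p.2)) ≪
      (volume : Measure (Space d)).prod (volume.restrict (Ioi (0 : ℝ))) := by
    refine Measure.AbsolutelyContinuous.mk fun N hN hN0 => ?_
    have e : (volume : Measure (Space d)).prod (volume.restrict (Ioi (0 : ℝ))) =
        (volume : Measure (Space d × ℝ)).restrict (univ ×ˢ Ioi 0) := by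
      rw [Measure.volume_eq_prod, ← Measure.prod_restrict, Measure.restrict_univ]
    rw [e, Measure.restrict_apply hN] at hN0
    rw [Measure.map_apply measurable_position_mass hN]
    refine Eq.trans ?_ (h _ (hN.inter (MeasurableSet.univ.prod measurableSet_Ioi)) hN0)
    congr 1
    ext p
    simp [M.m_pos]
  obtain ⟨ρ, h1, h2⟩ := exists_kernel_of_map_absolutelyContinuous measurable_position_mass hac
  -- The disintegration yields measures on `ℝ^d × E` concentrated on points with position `x`, so
  -- forgetting the position loses nothing: the set `B` only tests whether `x ∈ B`.
  refine ⟨ρ.map Prod.snd, fun x r _ => ?_, fun B A hB hA => ?_⟩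
  · rw [Kernel.map_apply _ measurable_snd,
      ae_map_iff measurable_snd.aemeasurable (measurableSet_eq_fun M.measurable_m measurable_const)]
    filter_upwards [h1 (x, r)] with p hp
    exact (Prod.ext_iff.1 hp).2
  · rw [h2 _ (hB.prod hA), lintegral_prod _ (ρ.measurable_coe (hB.prod hA)).aemeasurable,
      ← lintegral_indicator hB]
    refine lintegral_congr fun x => ?_
    have e : ∀ r, ρ (x, r) (B ×ˢ A) = B.indicator (fun _ => ρ.map Prod.snd (x, r) A) x := by
      intro r
      rw [Kernel.map_apply' _ measurable_snd _ hA]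
      by_cases hx : x ∈ B
      · rw [indicator_of_mem hx]
        refine measure_congr ?_
        filter_upwards [h1 (x, r)] with p hp
        have hp1 : p.1 = x := (Prod.ext_iff.1 hp).1
        refine propext ⟨fun hp' => hp'.2, fun hp' => ⟨?_, hp'⟩⟩
        rwa [hp1]
      · rw [indicator_of_notMem hx, measure_eq_zero_iff_ae_notMem]
        filter_upwards [h1 (x, r)] with p hp hpB
        have hp1 : p.1 = x := (Prod.ext_iff.1 hp).1
        exact hx (hp1 ▸ hpB.1)
    simp_rw [e]
    by_cases hx : x ∈ B <;> simp [hx]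

end Mass

/-! ### Transfer of the mass properties from the approximations to the solution -/

namespace IsStrongSolution

variable {M : Model d E} {T : ℝ≥0∞} {μ : ℝ → Measure (Space d × E)} [StandardBorelSpace E]
  (hμ : IsStrongSolution M T μ)
include hμ

lemma null_of_forall_picardIterate {t : ℝ} (ht : t ∈ timeDomain T) {S : Set (Space d × E)}
    (h : ∀ k, picardIterate M T μ k t S = 0) : μ t S = 0 :=
  tendsto_nhds_unique (hμ.tendsto_picardIterate ht S) (by simp [h])

theorem hasIntegerMass (h : HasIntegerMass (fun q : Space d × E => M.m q.2) (μ 0)) {t : ℝ}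
    (ht : t ∈ timeDomain T) : HasIntegerMass (fun q : Space d × E => M.m q.2) (μ t) := by
  refine hμ.null_of_forall_picardIterate ht fun k => ?_
  induction k generalizing t with
  | zero => exact hasIntegerMass_propagate hμ.measurable_rate h 0 t
  | succ k ih =>
    have := hμ.isSFiniteKernel_picardIterate k
    rw [picardIterate, hμ.picard_apply _ t (measurableSet_integer_mass M)]
    refine add_eq_zero.2 ⟨hasIntegerMass_propagate hμ.measurable_rate h 0 t, ?_⟩
    refine setLIntegral_eq_zero measurableSet_Ioo fun s hs => ?_
    rw [Kplus_eq_gainKernel]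
    refine hasIntegerMass_propagate hμ.measurable_rate (hasIntegerMass_gainKernel ?_) s t
    have hsT := mem_timeDomain_of_le ht hs.1.le hs.2.le
    rw [← (hμ.isDensity_picardIterate k).eq_spaceTime (hμ.isProcess_picardIterate k) hsT]
    exact ih hsT

/-- Each iteration step trades one property for the other: coagulation turns jointly absolutely
continuous position and mass into absolutely continuous mass only, and propagation over the positive
time `t - s` restores the joint property. The restriction to `t > 0` is essential, since `μ 0` is
assumed to have only the weaker property. -/
lemma acPositionMass (h : ACMass M (μ 0)) {t : ℝ} (ht : t ∈ timeDomain T) (ht0 : 0 < t) :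
    ACPositionMass M (μ t) := by
  intro N hN hN0
  refine hμ.null_of_forall_picardIterate ht fun k => ?_
  -- The induction must carry the property for all null sets at once, because the step invokes it
  -- for a different set, that of positions and masses with bad partners.
  suffices H : ACPositionMass M (picardIterate M T μ k t) from H N hN hN0
  clear hN0 hN N
  induction k generalizing t with
  | zero => exact acPositionMass_propagate hμ.measurable_rate h ht0
  | succ k ih =>
    have := hμ.isSFiniteKernel_picardIterate k
    intro N hN hN0
    have hS : MeasurableSet {p : Space d × E | (p.1, M.m p.2) ∈ N} := measurable_position_mass hN
    rw [picardIterate, hμ.picard_apply _ t hS]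
    refine add_eq_zero.2 ⟨acPositionMass_propagate hμ.measurable_rate h ht0 N hN hN0, ?_⟩
    refine setLIntegral_eq_zero measurableSet_Ioo fun s hs => ?_
    rw [Kplus_eq_gainKernel]
    refine acPositionMass_propagate hμ.measurable_rate (acMass_gainKernel ?_) hs.2 N hN hN0
    have hsT := mem_timeDomain_of_le ht hs.1.le hs.2.le
    rw [← (hμ.isDensity_picardIterate k).eq_spaceTime (hμ.isProcess_picardIterate k) hsT]
    exact ih hsT hs.1

theorem hasACMass (h : HasACMass (fun q : Space d × E => M.m q.2) (μ 0)) {t : ℝ}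
    (ht : t ∈ timeDomain T) : HasACMass (fun q : Space d × E => M.m q.2) (μ t) := by
  have := hμ.process.finite t ht
  rcases ht.1.eq_or_lt with rfl | ht0
  · exact h
  · exact (hμ.acPositionMass (acMass_of_hasACMass h) ht ht0).acMass.hasACMass

theorem hasACMassLocally (h : HasACMassLocally M.m (μ 0)) {t : ℝ} (ht : t ∈ timeDomain T) :
    HasACMassLocally M.m (μ t) := by
  have := hμ.process.finite t ht
  rcases ht.1.eq_or_lt with rfl | ht0
  · exact h
  · exact (hμ.acPositionMass (acMass_of_hasACMassLocally h) ht ht0).hasACMassLocally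

end IsStrongSolution

end CoagDiff

end

theorem theorem2 {d : ℕ} {E : Type*} [MeasurableSpace E] [StandardBorelSpace E]
    (M : CoagDiff.Model d E) (T : ENNReal)
    (μ : ℝ → MeasureTheory.Measure (CoagDiff.Space d × E))
    (hμ : CoagDiff.IsStrongSolution M T μ) :
    CoagDiff.IsMinimalPropagatorSolution M T μ μ ∧
    (CoagDiff.HasIntegerMass (fun q : CoagDiff.Space d × E => M.m q.2) (μ 0) →
      ∀ t ∈ CoagDiff.timeDomain T,
        CoagDiff.HasIntegerMass (fun q : CoagDiff.Space d × E => M.m q.2) (μ t)) ∧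
    (CoagDiff.HasACMass (fun q : CoagDiff.Space d × E => M.m q.2) (μ 0) →
      ∀ t ∈ CoagDiff.timeDomain T,
        CoagDiff.HasACMass (fun q : CoagDiff.Space d × E => M.m q.2) (μ t)) ∧
    (CoagDiff.HasACMassLocally M.m (μ 0) →
      ∀ t ∈ CoagDiff.timeDomain T, CoagDiff.HasACMassLocally M.m (μ t)) :=
  ⟨hμ.isMinimalPropagatorSolution, fun h _ ht => hμ.hasIntegerMass h ht,
    fun h _ ht => hμ.hasACMass h ht, fun h _ ht => hμ.hasACMassLocally h ht⟩
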